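/- Let $m\ge 0$ and let $$L:\quad y^{(m)}=\sum_{i=0}^{m-1}q_i\,y^{(i)},\qquad q_0,\dots,q_{m-1}\in\mathbb C(z),$$ be a linear differential equation with set of singular points $S=\{t_1,\dots,t_r\}\subset\mathbb C$ (the poles of the $q_i$), all of which are regular singular points, i.e. $q_i$ has a pole of order at most $m-i$ at each $t_j$. Assume that $L$ is generic: for each $t_j\in S$ the space of solutions near $t_j$ (on a small disc about $t_j$ cut along a radius) has a basis $y_1,\dots,y_m$ such that $y_2,\dots,y_m$ extend holomorphically to $t_j$ and $y_1$ does not. Let $A_L\subset\mathbb C$ be the union of the perpendicular bisectors (full real lines) of the segments joining two distinct points of $S$, and let $U$ be a connected component of $\mathbb C\setminus A_L$. Let $f_1,f_2$ be two solutions of $L$ over $U\setminus S$, i.e. two solutions holomorphic near a point $z_0\in U\setminus S$ together with their simultaneous analytic continuations along paths in $U\setminus S$ starting at $z_0$. Assume that $f_2$ is not the restriction of an entire function; if $L$ is Fuchsian also at $\infty$ (i.e. $q_i=O(z^{-(m-i)})$ as $z\to\infty$ for all $i$), it is enough to assume that $f_2$ is not a polynomial. Then there is a constant $c\in\mathbb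 C\cup\{\infty\}$, depending on $f_1$, $f_2$ and $U$ but not on the point $z\in U\setminus S$ nor on the path along which the solutions are continued to $z$, such that for all $z\in U\setminus S$ one has $f_2^{(n)}(z)\ne 0$ for all large $n$ and $$\lim_{n\to\infty}\frac{f_1^{(n)}(z)}{f_2^{(n)}(z)}=c .$$ Moreover, if the Taylor series of $f_2$ at $z_0$ does not extend holomorphically to a disc about $z_0$ of radius larger than the distance from $z_0$ to $S$ (that is, $f_2$ does not extend holomorphically across the singular point nearest to $z_0$), then $c$ is a finite number; and if in addition $f_1$ does so extend, then $c=0$. -/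

import Mathlib

open Filter Topology

namespace FuchsianODE

/-- The set `S` of singular points in the affine plane of the linear differential equation
`y⁽ᵐ⁾ = ∑_{i < m} qᵢ y⁽ⁱ⁾` with rational coefficients: the poles of the `qᵢ`
(the denominator of a `RatFunc` is coprime to its numerator). -/
def singularSet {m : ℕ} (q : Fin m → RatFunc ℂ) : Set ℂ :=
  {t | ∃ i, ((q i).denom).eval t = 0}

/-- `A_L`: the union of the perpendicular bisectors (real lines in `ℂ`) of the segments joining
two distinct singular points. -/
def bisectorSet {m : ℕ} (q : Fin m → RatFunc ℂ) : Set ℂ :=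
  {z | ∃ s ∈ singularSet q, ∃ t ∈ singularSet q, s ≠ t ∧ z ∈ AffineSubspace.perpBisector s t}

/-- Every singular point in `ℂ` is regular: `qᵢ` has a pole of order at most `m - i` at each
point `t` of `ℂ`. -/
def IsRegularAtFinite {m : ℕ} (q : Fin m → RatFunc ℂ) : Prop :=
  ∀ t : ℂ, ∀ i : Fin m, ((q i).denom).rootMultiplicity t ≤ m - (i : ℕ)

/-- The point at infinity is at most a regular singular point: `qᵢ = O(z^{-(m-i)})` as `z → ∞`.
(For `qᵢ = 0` the left-hand side is `⊥`.) -/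
def IsRegularAtInfinity {m : ℕ} (q : Fin m → RatFunc ℂ) : Prop :=
  ∀ i : Fin m, ((q i).num).degree + ((m - (i : ℕ) : ℕ) : WithBot ℕ) ≤ ((q i).denom).degree

/-- `y` is a holomorphic solution of `y⁽ᵐ⁾ = ∑_{i < m} qᵢ y⁽ⁱ⁾` on `W`
(used for open `W` free of singular points). -/
def IsSolutionOn {m : ℕ} (q : Fin m → RatFunc ℂ) (W : Set ℂ) (y : ℂ → ℂ) : Prop :=
  AnalyticOnNhd ℂ y W ∧
    ∀ z ∈ W, iteratedDeriv m y z =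
      ∑ i : Fin m, RatFunc.eval (RingHom.id ℂ) z (q i) * iteratedDeriv (i : ℕ) y z

/-- `y` is (the germ at `z₀` of) a holomorphic solution. -/
def IsSolutionNear {m : ℕ} (q : Fin m → RatFunc ℂ) (z₀ : ℂ) (y : ℂ → ℂ) : Prop :=
  ∃ ε > 0, IsSolutionOn q (Metric.ball z₀ ε) y

/-- `y₁, …, yₘ` is a basis of the `ℂ`-vector space of solutions on `W`. -/
def IsSolutionBasisOn {m : ℕ} (q : Fin m → RatFunc ℂ) (W : Set ℂ) (y : Fin m → ℂ → ℂ) : Prop :=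
  (∀ i, IsSolutionOn q W (y i)) ∧
  (∀ a : Fin m → ℂ, (∀ z ∈ W, ∑ i, a i * y i z = 0) → ∀ i, a i = 0) ∧
  (∀ f : ℂ → ℂ, IsSolutionOn q W f → ∃ a : Fin m → ℂ, ∀ z ∈ W, f z = ∑ i, a i * y i z)

/-- The disc of radius `r` about `t`, cut along the radius going to the left; solutions near a
singular point `t` are single-valued on it. -/
def slitDisc (t : ℂ) (r : ℝ) : Set ℂ :=
  {z | z ∈ Metric.ball t r ∧ z - t ∈ Complex.slitPlane}

/-- A function `y` on `W` (with `t` in the closure of `W`) extends holomorphically to `t`. -/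
def ExtendsTo (t : ℂ) (W : Set ℂ) (y : ℂ → ℂ) : Prop :=
  ∃ g : ℂ → ℂ, AnalyticAt ℂ g t ∧ y =ᶠ[𝓝[W] t] g

/-- The equation is generic: near each singular point `t` in `ℂ` there is a basis of the space of
solutions of which exactly one member does not extend holomorphically to `t`. -/
def IsGeneric {m : ℕ} (q : Fin m → RatFunc ℂ) : Prop :=
  ∀ t ∈ singularSet q, ∃ r > 0, singularSet q ∩ Metric.ball t r = {t} ∧
    ∃ y : Fin m → ℂ → ℂ, IsSolutionBasisOn q (slitDisc t r) y ∧
      ∃ k : Fin m, ¬ ExtendsTo t (slitDisc t r) (y k) ∧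
        ∀ i, i ≠ k → ExtendsTo t (slitDisc t r) (y i)

/-- `F s`, `0 ≤ s ≤ 1`, is the analytic continuation along the path `γ` of the germ `f` at the
starting point of `γ`. -/
def IsContinuationAlong {z₀ z : ℂ} (γ : Path z₀ z) (f : ℂ → ℂ) (F : unitInterval → ℂ → ℂ) :
    Prop :=
  F 0 =ᶠ[𝓝 z₀] f ∧
  (∀ s, AnalyticAt ℂ (F s) (γ s)) ∧
  (∀ s, ∀ᶠ s' in 𝓝 s, F s' =ᶠ[𝓝 (γ s')] F s)

/-- The germ of `f` at `z₀` is the germ of an entire function. -/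
def IsEntireGerm (z₀ : ℂ) (f : ℂ → ℂ) : Prop :=
  ∃ g : ℂ → ℂ, Differentiable ℂ g ∧ f =ᶠ[𝓝 z₀] g

/-- The germ of `f` at `z₀` is the germ of a polynomial function. -/
def IsPolynomialGerm (z₀ : ℂ) (f : ℂ → ℂ) : Prop :=
  ∃ p : Polynomial ℂ, f =ᶠ[𝓝 z₀] fun z => p.eval z

/-- The germ of `f` at `z₀` extends holomorphically to an open disc about `z₀` of radius larger
than the distance from `z₀` to the singular set, i.e. across the nearest singular point(s). -/
def ExtendsAcrossNearest {m : ℕ} (q : Fin m → RatFunc ℂ) (z₀ : ℂ) (f : ℂ → ℂ) : Prop :=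
  ∃ R > Metric.infDist z₀ (singularSet q), ∃ g : ℂ → ℂ,
    DifferentiableOn ℂ g (Metric.ball z₀ R) ∧ f =ᶠ[𝓝 z₀] g

end FuchsianODE

/-!
The limit exists because high derivatives at `z` are governed by the singularity that bounds the
disc of convergence, and away from the bisectors this disc is bounded by a single singular point.

A solution that is not entire has a Taylor series at `z` whose radius of convergence is `|z - t|` for
some singular point `t` (`exists_singular_of_not_entire`), and `t` is the only one at this distance.
In the logarithmic coordinate `x`, with `w = t + exp x`, the equation is a linear system with bounded
coefficients on a half-plane, so solutions extend to the half-plane and grow at most exponentially.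
Genericity says that all solutions are, modulo functions holomorphic at `t`, multiples of one function
`Φ`; hence the monodromy multiplies `Φ` by a constant modulo such functions, which determines the shape
of the singularity: `(w - t) ^ μ` or a pole and a logarithm, with holomorphic coefficients
(`exists_local_structure`). Darboux's method then bounds the Taylor coefficients of `f₂` from below by
`|z - t| ^ (-n)` times a power of `n` (`polyLower_of_singular`), whereas those of a function that
extends beyond `t` are exponentially smaller (`tendsto_iteratedDeriv_div_zero`).

So the quotient for `f₁` tends to `0` if `f₁` extends beyond `t`. If the disc of `f₁` is also bounded
by `t`, some `f₁ - c f₂` extends beyond `t` (`exists_sub_const_mul_extends`), and the limit is `c`. If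
the disc of `f₁` is smaller, the roles are exchanged and the limit is `∞`.

The constant does not depend on the point: along a path that avoids the bisectors, the distances to
the singular points keep their order, and whether the disc of convergence reaches beyond `t` does not
change (`IsContinuationAlong.extends_beyond_iff`). If `∞` is regular too, entire solutions grow
polynomially by the same logarithmic coordinate, so they are polynomials
(`isPolynomialGerm_of_isEntireGerm`).
-/

/-! ### Linear differential systems on convex domains -/

namespace LinearODE

variable {E : Type*} [NormedAddCommGroup E] [NormedSpace ℂ E]

theorem hasDerivAt_comp_segment {Y : ℂ → E} {Y' : E} {x₀ x : ℂ} {s : ℝ}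
    (h : HasDerivAt Y Y' (x₀ + s * (x - x₀))) :
    HasDerivAt (fun s : ℝ => Y (x₀ + s * (x - x₀))) ((x - x₀) • Y') s := by
  have h1 : HasDerivAt (fun s : ℝ => x₀ + (s : ℂ) * (x - x₀)) (x - x₀) s := by
    have := ((Complex.ofRealCLM.hasDerivAt (x := s)).mul_const (x - x₀)).const_add x₀
    simpa using this
  exact HasDerivAt.scomp s h h1

theorem segment_mem {Ω : Set ℂ} (hΩ : Convex ℝ Ω) {x₀ x : ℂ} (hx₀ : x₀ ∈ Ω) (hx : x ∈ Ω) {s : ℝ}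
    (hs : s ∈ Set.Icc (0 : ℝ) 1) : x₀ + (s : ℂ) * (x - x₀) ∈ Ω := by
  have := hΩ.add_smul_sub_mem hx₀ hx hs
  simpa using this

/-- Grönwall's inequality along segments. -/
theorem norm_le_exp {Ω : Set ℂ} (hΩ : Convex ℝ Ω) {B : ℂ → E →L[ℂ] E} {C : ℝ}
    (hB : ∀ x ∈ Ω, ‖B x‖ ≤ C) {Y : ℂ → E} (hY : ∀ x ∈ Ω, HasDerivAt Y (B x (Y x)) x)
    {x₀ x : ℂ} (hx₀ : x₀ ∈ Ω) (hx : x ∈ Ω) :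
    ‖Y x‖ ≤ ‖Y x₀‖ * Real.exp (C * ‖x - x₀‖) := by
  have hd : ∀ s ∈ Set.Icc (0 : ℝ) 1, HasDerivAt (fun s : ℝ => Y (x₀ + s * (x - x₀)))
      ((x - x₀) • B (x₀ + s * (x - x₀)) (Y (x₀ + s * (x - x₀)))) s := fun s hs =>
    hasDerivAt_comp_segment (hY _ (segment_mem hΩ hx₀ hx hs))
  have := norm_le_gronwallBound_of_norm_deriv_right_le (δ := ‖Y x₀‖) (K := C * ‖x - x₀‖) (ε := 0)
    (fun s hs => (hd s hs).continuousAt.continuousWithinAt)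
    (fun s hs => (hd s (Set.Ico_subset_Icc_self hs)).hasDerivWithinAt)
    (by simp) (fun s hs => by
      have h1 := hB _ (segment_mem hΩ hx₀ hx (Set.Ico_subset_Icc_self hs))
      rw [norm_smul, add_zero, mul_comm C, mul_assoc]
      exact mul_le_mul_of_nonneg_left ((B _).le_of_opNorm_le h1 _) (norm_nonneg _)) 1 (by simp)
  simpa [gronwallBound_ε0] using this

theorem eqOn {Ω : Set ℂ} (hΩ : Convex ℝ Ω) {B : ℂ → E →L[ℂ] E} {C : ℝ}
    (hB : ∀ x ∈ Ω, ‖B x‖ ≤ C) {Y Z : ℂ → E} (hY : ∀ x ∈ Ω, HasDerivAt Y (B x (Y x)) x)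
    (hZ : ∀ x ∈ Ω, HasDerivAt Z (B x (Z x)) x) {x₀ : ℂ} (hx₀ : x₀ ∈ Ω) (h0 : Y x₀ = Z x₀) :
    Set.EqOn Y Z Ω := by
  intro x hx
  have := norm_le_exp hΩ hB (Y := fun x => Y x - Z x)
    (fun x hx => by simpa using (hY x hx).fun_sub (hZ x hx)) hx₀ hx
  rw [h0, sub_self, norm_zero, zero_mul] at this
  exact sub_eq_zero.1 (norm_le_zero_iff.1 this)

/-- Existence for holomorphic linear systems with bounded coefficients on a convex open set: the
Picard series `∑ Yₙ`, with `Y₀ = v` and `Yₙ₊₁' = B Yₙ`, `Yₙ₊₁(x₀) = 0`, is dominated by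
`∑ ‖v‖ (C |x - x₀|)ⁿ / n!`. -/
theorem exists_solution [CompleteSpace E] {Ω : Set ℂ} (hΩ : Convex ℝ Ω) (hΩo : IsOpen Ω)
    {B : ℂ → E →L[ℂ] E} {C : ℝ} (hC : 0 ≤ C) (hB : ∀ x ∈ Ω, ‖B x‖ ≤ C)
    (hBd : DifferentiableOn ℂ B Ω) {x₀ : ℂ} (hx₀ : x₀ ∈ Ω) (v : E) :
    ∃ Y : ℂ → E, Y x₀ = v ∧ ∀ x ∈ Ω, HasDerivAt Y (B x (Y x)) x := by
  have step : ∀ Y : ℂ → E, DifferentiableOn ℂ Y Ω →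
      ∃ Z : ℂ → E, Z x₀ = 0 ∧ ∀ x ∈ Ω, HasDerivAt Z (B x (Y x)) x := by
    intro Y hY
    obtain ⟨g, hg⟩ := hΩ.exists_forall_hasDerivWithinAt (hBd.clm_apply hY)
    exact ⟨fun x => g x - g x₀, by simp, fun x hx =>
      ((hg x hx).hasDerivAt (hΩo.mem_nhds hx)).sub_const _⟩
  choose! P hP0 hPd using step
  let F : ℕ → ℂ → E := fun n => P^[n] (fun _ => v)
  have hFs : ∀ n, F (n + 1) = P (F n) := fun n => Function.iterate_succ_apply' P n _
  have hFd : ∀ n, DifferentiableOn ℂ (F n) Ω := by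
    intro n
    induction n with
    | zero => exact differentiableOn_const v
    | succ n ih =>
      rw [hFs]
      exact fun x hx => (hPd _ ih x hx).differentiableAt.differentiableWithinAt
  have hFD : ∀ n, ∀ x ∈ Ω, HasDerivAt (F (n + 1)) (B x (F n x)) x := fun n x hx => by
    rw [hFs]; exact hPd _ (hFd n) x hx
  have hF0 : ∀ n, F (n + 1) x₀ = 0 := fun n => by rw [hFs]; exact hP0 _ (hFd n)
  have hbd : ∀ n, ∀ x ∈ Ω, ‖F n x‖ ≤ ‖v‖ * ((C * ‖x - x₀‖) ^ n / (n.factorial : ℝ)) := by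
    intro n
    induction n with
    | zero => intro x hx; simp [F]
    | succ n ih =>
      intro x hx
      have hd : ∀ s ∈ Set.Icc (0 : ℝ) 1, HasDerivAt (fun s : ℝ => F (n + 1) (x₀ + s * (x - x₀)))
          ((x - x₀) • B (x₀ + s * (x - x₀)) (F n (x₀ + s * (x - x₀)))) s := fun s hs =>
        hasDerivAt_comp_segment (hFD n _ (segment_mem hΩ hx₀ hx hs))
      have hBB : ∀ s : ℝ, HasDerivAt
          (fun s : ℝ => ‖v‖ * ((C * ‖x - x₀‖) ^ (n + 1) / ((n + 1).factorial : ℝ)) * s ^ (n + 1))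
          (‖v‖ * ((C * ‖x - x₀‖) ^ (n + 1) / ((n + 1).factorial : ℝ)) * (((n + 1 : ℕ) : ℝ) * s ^ n))
          s := fun s => by
        simpa using (hasDerivAt_pow (n + 1) s).const_mul
          (‖v‖ * ((C * ‖x - x₀‖) ^ (n + 1) / ((n + 1).factorial : ℝ)))
      have := image_norm_le_of_norm_deriv_right_le_deriv_boundary
        (fun s hs => (hd s hs).continuousAt.continuousWithinAt)
        (fun s hs => (hd s (Set.Ico_subset_Icc_self hs)).hasDerivWithinAt)
        (by simp [hF0]) hBB (fun s hs => by
          have hm := segment_mem hΩ hx₀ hx (Set.Ico_subset_Icc_self hs)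
          have h1 := (B _).le_of_opNorm_le_of_le (hB _ hm) (ih _ hm)
          have hs0 : (0 : ℝ) ≤ s := hs.1
          have h2 : ‖x₀ + (s : ℂ) * (x - x₀) - x₀‖ = s * ‖x - x₀‖ := by
            rw [add_sub_cancel_left, norm_mul, Complex.norm_real, Real.norm_of_nonneg hs0]
          rw [h2] at h1
          rw [norm_smul]
          refine (mul_le_mul_of_nonneg_left h1 (norm_nonneg _)).trans (le_of_eq ?_)
          rw [Nat.factorial_succ]
          push_cast
          field_simp
          ring) (x := 1) (by simp)
      simpa using this
  let Y : ℂ → E := fun x => ∑' n, F n x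
  have key : ∀ x ∈ Ω, HasDerivAt Y (B x (Y x)) x := by
    intro x hx
    obtain ⟨R, hR⟩ : ∃ R : ℝ, ‖x - x₀‖ < R := exists_gt _
    have hR0 : 0 ≤ R := (norm_nonneg _).trans hR.le
    let U : Set ℂ := Ω ∩ Metric.ball x₀ R
    have hUo : IsOpen U := hΩo.inter Metric.isOpen_ball
    have hxU : x ∈ U := ⟨hx, by simpa [dist_eq_norm] using hR⟩
    have hu : Summable fun n : ℕ => ‖v‖ * ((C * R) ^ n / (n.factorial : ℝ)) :=
      (Real.summable_pow_div_factorial _).mul_left _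
    have hle : ∀ n, ∀ w ∈ U, ‖F n w‖ ≤ ‖v‖ * ((C * R) ^ n / (n.factorial : ℝ)) := by
      intro n w hw
      refine (hbd n w hw.1).trans ?_
      have : ‖w - x₀‖ ≤ R := by simpa [dist_eq_norm] using (Metric.mem_ball.1 hw.2).le
      gcongr
    have hd : DifferentiableAt ℂ Y x :=
      (Complex.differentiableOn_tsum_of_summable_norm hu
        (fun n => (hFd n).mono Set.inter_subset_left) hUo hle).differentiableAt
        (hUo.mem_nhds hxU)
    have hs := Complex.hasSum_deriv_of_summable_norm hu
        (fun n => (hFd n).mono Set.inter_subset_left) hUo hle hxU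
    have hsum : Summable fun n => F n x := .of_norm_bounded hu fun n => hle n x hxU
    have h1 : HasSum (fun n => deriv (F (n + 1)) x) (B x (Y x)) := by
      simp_rw [fun n => (hFD n x hx).deriv]
      exact (B x).hasSum hsum.hasSum
    have h2 := (hasSum_nat_add_iff' 1).2 hs
    have h3 : deriv (F 0) x = 0 := by simp [F]
    rw [Finset.sum_range_one, h3, sub_zero] at h2
    rw [h1.unique h2]
    exact hd.hasDerivAt
  refine ⟨Y, ?_, key⟩
  have : Y x₀ = F 0 x₀ := tsum_eq_single 0 fun n hn => by
    obtain ⟨k, rfl⟩ := Nat.exists_eq_succ_of_ne_zero hn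
    exact hF0 k
  simp [this, F]

/-- A solution on a smaller convex open set extends to the whole domain of the system. -/
theorem exists_extension [CompleteSpace E] {Ω Ω' : Set ℂ} (hΩ : Convex ℝ Ω) (hΩo : IsOpen Ω)
    {B : ℂ → E →L[ℂ] E} {C : ℝ} (hC : 0 ≤ C) (hB : ∀ x ∈ Ω, ‖B x‖ ≤ C)
    (hBd : DifferentiableOn ℂ B Ω) (hsub : Ω' ⊆ Ω) (hΩ' : Convex ℝ Ω') {Y : ℂ → E}
    (hY : ∀ x ∈ Ω', HasDerivAt Y (B x (Y x)) x) :
    ∃ Z : ℂ → E, (∀ x ∈ Ω, HasDerivAt Z (B x (Z x)) x) ∧ Set.EqOn Y Z Ω' := by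
  obtain rfl | ⟨x₀, hx₀⟩ := Ω'.eq_empty_or_nonempty
  · exact ⟨fun _ => 0, fun x _ => by simpa using hasDerivAt_const x (0 : E), by simp⟩
  · obtain ⟨Z, hZ0, hZ⟩ := exists_solution hΩ hΩo hC hB hBd (hsub hx₀) (Y x₀)
    exact ⟨Z, hZ, eqOn hΩ' (fun x hx => hB x (hsub hx)) hY (fun x hx => hZ x (hsub hx)) hx₀
      hZ0.symm⟩

end LinearODE

/-! ### Sequences bounded below by a power of the index -/

/-- `‖a n‖` is eventually bounded below by a constant times a negative power of `n`. -/
def PolyLower (a : ℕ → ℂ) : Prop :=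
  ∃ c > 0, ∃ M : ℕ, ∀ᶠ n : ℕ in atTop, c ≤ ‖a n‖ * (n : ℝ) ^ M

/-- The sequence `a` decays at most geometrically. -/
def SlowDecay (a : ℕ → ℂ) : Prop :=
  ∃ D : ℝ, 0 ≤ D ∧ ∀ᶠ n : ℕ in atTop, ‖a n‖ ≤ D * ‖a (n + 1)‖

theorem PolyLower.eventually_ne {a : ℕ → ℂ} (h : PolyLower a) : ∀ᶠ n in atTop, a n ≠ 0 := by
  obtain ⟨c, hc, M, h⟩ := h
  filter_upwards [h] with n hn h0
  rw [h0, norm_zero, zero_mul] at hn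
  exact absurd hn (not_le.2 hc)

/-- The recursion is that of the binomial coefficients, the Taylor coefficients of `v ^ μ` at `1`. -/
theorem binomial_polyLower {a : ℕ → ℂ} {μ : ℂ} (hμ : ∀ k : ℕ, μ ≠ k) (h0 : a 0 = 1)
    (h : ∀ n : ℕ, (n + 1) * a (n + 1) = (μ - n) * a n) : PolyLower a := by
  have hne : ∀ n, a n ≠ 0 := by
    intro n
    induction n with
    | zero => simp [h0]
    | succ n ih =>
      intro hn
      have := h n
      rw [hn, mul_zero, eq_comm, mul_eq_zero, sub_eq_zero] at this
      exact this.elim (hμ n) ih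
  obtain ⟨M, hM⟩ := exists_nat_ge (‖μ‖ + 2)
  obtain ⟨N, hN⟩ := exists_nat_ge (M * ‖μ‖ + 1)
  have hN1 : (1 : ℝ) ≤ N := by
    have : 0 ≤ (M : ℝ) * ‖μ‖ := by positivity
    linarith
  refine ⟨‖a N‖ * (N : ℝ) ^ M, mul_pos (norm_pos_iff.2 (hne N)) (by positivity), M, ?_⟩
  filter_upwards [eventually_ge_atTop N] with n hn
  induction n, hn using Nat.le_induction with
  | base => exact le_rfl
  | succ n hn ih =>
    refine ih.trans ?_
    have hnN : (N : ℝ) ≤ n := by exact_mod_cast hn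
    have hn0 : (0 : ℝ) < n := by linarith
    have h1 : ((n : ℝ) + 1) * ‖a (n + 1)‖ = ‖μ - n‖ * ‖a n‖ := by
      rw [← norm_mul, ← h n, norm_mul]
      congr 1
      have := Complex.norm_natCast (n + 1)
      push_cast at this
      exact this.symm
    have h2 : (n : ℝ) - ‖μ‖ ≤ ‖μ - n‖ := by
      have := norm_sub_norm_le (n : ℂ) μ
      rwa [Complex.norm_natCast, norm_sub_rev] at this
    have h3 : (n : ℝ) ^ M * (n + M) ≤ (n + 1 : ℝ) ^ M * n := by
      have := one_add_mul_le_pow (a := (1 / n : ℝ)) (by have : 0 ≤ 1 / (n : ℝ) := by positivity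
                                                        linarith) M
      have h4 : (n + 1 : ℝ) ^ M = (n : ℝ) ^ M * (1 + 1 / n) ^ M := by
        rw [← mul_pow]; congr 1; field_simp
      rw [h4, mul_assoc]
      refine mul_le_mul_of_nonneg_left ?_ (by positivity)
      calc (n : ℝ) + M = (1 + M * (1 / n)) * n := by field_simp
        _ ≤ _ := by gcongr
    -- `(n + M) (n - |μ|) ≥ n (n + 1)`, since `M ≥ |μ| + 2` and `n ≥ M |μ|`
    have h5 : (n : ℝ) * (n + 1) ≤ (n + M) * ‖μ - n‖ := by
      have : (n + M : ℝ) * (n - ‖μ‖) ≤ (n + M) * ‖μ - n‖ := by gcongr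
      nlinarith [norm_nonneg μ]
    push_cast
    have hA := norm_nonneg (a n)
    have h6 : ‖a (n + 1)‖ = ‖μ - n‖ * ‖a n‖ / (n + 1) := by field_simp; linarith
    rw [h6, div_mul_eq_mul_div, le_div_iff₀ (by positivity)]
    have h7 : (n : ℝ) ^ M * (n * (n + 1)) ≤ ((n + 1 : ℝ) ^ M * n) * ‖μ - n‖ :=
      calc (n : ℝ) ^ M * (n * (n + 1)) ≤ (n : ℝ) ^ M * ((n + M) * ‖μ - n‖) := by gcongr
        _ = ((n : ℝ) ^ M * (n + M)) * ‖μ - n‖ := by ring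
        _ ≤ _ := by gcongr
    have h8 : (n : ℝ) ^ M * (n + 1) ≤ (n + 1 : ℝ) ^ M * ‖μ - n‖ := by
      refine le_of_mul_le_mul_right ?_ hn0
      linarith
    nlinarith

theorem binomial_slowDecay {a : ℕ → ℂ} {μ : ℂ}
    (h : ∀ n : ℕ, (n + 1) * a (n + 1) = (μ - n) * a n) : SlowDecay a := by
  refine ⟨2, by norm_num, ?_⟩
  obtain ⟨N, hN⟩ := exists_nat_ge (2 * ‖μ‖ + 1)
  filter_upwards [eventually_ge_atTop N] with n hn
  have hnN : (N : ℝ) ≤ n := by exact_mod_cast hn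
  have h1 : ((n : ℝ) + 1) * ‖a (n + 1)‖ = ‖μ - n‖ * ‖a n‖ := by
    rw [← norm_mul, ← h n, norm_mul]
    congr 1
    have := Complex.norm_natCast (n + 1)
    push_cast at this
    exact this.symm
  have h2 : (n : ℝ) - ‖μ‖ ≤ ‖μ - n‖ := by
    have := norm_sub_norm_le (n : ℂ) μ
    rwa [Complex.norm_natCast, norm_sub_rev] at this
  have h3 : ((n : ℝ) + 1) ≤ 2 * ‖μ - n‖ := by linarith
  have : ((n : ℝ) + 1) * ‖a n‖ ≤ (n + 1) * (2 * ‖a (n + 1)‖) := by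
    nlinarith [norm_nonneg (a n)]
  exact le_of_mul_le_mul_left this (by positivity)

section Integrated

variable {a b : ℕ → ℂ} {κ : ℂ}

/-- The relation between `a` and `b` is that of the Taylor coefficients of a function and of a
primitive of `κ` times that function; it is only assumed for large indices, so as to ignore
polynomials. -/
theorem norm_of_integrated (h : ∀ᶠ n : ℕ in atTop, (n + 1) * b (n + 1) = κ * a n) :
    ∀ᶠ n : ℕ in atTop, ((n : ℝ) + 1) * ‖b (n + 1)‖ = ‖κ‖ * ‖a n‖ := by
  filter_upwards [h] with n hn
  rw [← norm_mul, ← hn, norm_mul]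
  congr 1
  have := Complex.norm_natCast (n + 1)
  push_cast at this
  exact this.symm

theorem PolyLower.integrated (hκ : κ ≠ 0) (ha : PolyLower a)
    (h : ∀ᶠ n : ℕ in atTop, (n + 1) * b (n + 1) = κ * a n) : PolyLower b := by
  obtain ⟨c, hc, M, hM⟩ := ha
  refine ⟨‖κ‖ * c, mul_pos (norm_pos_iff.2 hκ) hc, M + 1, ?_⟩
  rw [← map_add_atTop_eq_nat 1, eventually_map]
  filter_upwards [norm_of_integrated h, hM] with n hn hM
  push_cast
  calc ‖κ‖ * c ≤ ‖κ‖ * (‖a n‖ * (n : ℝ) ^ M) := by gcongr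
      _ ≤ ‖κ‖ * (‖a n‖ * (n + 1 : ℝ) ^ M) := by gcongr; linarith
      _ = (‖κ‖ * ‖a n‖) * (n + 1 : ℝ) ^ M := by ring
      _ = _ := by rw [← hn]; ring

theorem SlowDecay.integrated (hκ : κ ≠ 0) (ha : SlowDecay a)
    (h : ∀ᶠ n : ℕ in atTop, (n + 1) * b (n + 1) = κ * a n) : SlowDecay b := by
  obtain ⟨D, hD, hM⟩ := ha
  refine ⟨2 * D, by positivity, ?_⟩
  rw [← map_add_atTop_eq_nat 1, eventually_map]
  have hs := (tendsto_add_atTop_nat 1).eventually (norm_of_integrated h)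
  filter_upwards [norm_of_integrated h, hs, hM] with n hn hs hM
  push_cast at hs
  have h1 : ((n : ℝ) + 1) * ‖b (n + 1)‖ ≤ (n + 1) * (2 * D * ‖b (n + 1 + 1)‖) :=
    calc ((n : ℝ) + 1) * ‖b (n + 1)‖ = ‖κ‖ * ‖a n‖ := hn
      _ ≤ ‖κ‖ * (D * ‖a (n + 1)‖) := by gcongr
      _ = D * ((n + 1 + 1) * ‖b (n + 1 + 1)‖) := by rw [hs]; ring
      _ ≤ D * ((2 * (n + 1)) * ‖b (n + 1 + 1)‖) := by gcongr; linarith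
      _ = _ := by ring
  exact le_of_mul_le_mul_left h1 (by positivity)

/-- A primitive has Taylor coefficients of smaller order. -/
theorem SlowDecay.isLittleO_integrated (ha : SlowDecay a)
    (h : ∀ᶠ n : ℕ in atTop, (n + 1) * b (n + 1) = κ * a n) : b =o[atTop] a := by
  obtain ⟨D, hD, hM⟩ := ha
  rw [Asymptotics.isLittleO_iff]
  intro ε hε
  obtain ⟨N, hN⟩ := exists_nat_ge (‖κ‖ * D / ε)
  rw [← map_add_atTop_eq_nat 1, eventually_map]
  filter_upwards [norm_of_integrated h, hM, eventually_ge_atTop N] with n hn hM hnN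
  have hnN' : (N : ℝ) ≤ n := by exact_mod_cast hnN
  have h1 : ‖κ‖ * D ≤ (n + 1) * ε := by
    rw [div_le_iff₀ hε] at hN
    nlinarith
  have h2 : ((n : ℝ) + 1) * ‖b (n + 1)‖ ≤ (n + 1) * (ε * ‖a (n + 1)‖) :=
    calc ((n : ℝ) + 1) * ‖b (n + 1)‖ = ‖κ‖ * ‖a n‖ := hn
      _ ≤ ‖κ‖ * (D * ‖a (n + 1)‖) := by gcongr
      _ = (‖κ‖ * D) * ‖a (n + 1)‖ := by ring
      _ ≤ ((n + 1) * ε) * ‖a (n + 1)‖ := by gcongr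
      _ = _ := by ring
  exact le_of_mul_le_mul_left h2 (by positivity)

end Integrated

/-- A sequence with a nontrivial asymptotic expansion, up to errors of any polynomial order, along a
scale of sequences bounded below by powers of the index is itself bounded below by a power of the index: its first nonzero term
dominates. -/
theorem PolyLower.of_expansion {e : ℕ → ℕ → ℂ} (he : ∀ i, PolyLower (e i))
    (hee : ∀ i, e (i + 1) =o[atTop] e i) {a c : ℕ → ℂ} (hc : ∃ i, c i ≠ 0)
    (h : ∀ K : ℕ, ∃ N₀, ∀ N ≥ N₀, ∃ D : ℝ, ∀ᶠ n : ℕ in atTop,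
      ‖a n - ∑ i ∈ Finset.range N, c i * e i n‖ * (n : ℝ) ^ K ≤ D) : PolyLower a := by
  classical
  let i₀ := Nat.find hc
  have hi₀ : c i₀ ≠ 0 := Nat.find_spec hc
  have hlt : ∀ i < i₀, c i = 0 := fun i hi => not_not.1 (Nat.find_min hc hi)
  obtain ⟨d, hd, M, hM⟩ := he i₀
  have hscale : ∀ j, e (i₀ + 1 + j) =o[atTop] e i₀ := by
    intro j
    induction j with
    | zero => exact hee i₀
    | succ j ih => exact (hee (i₀ + 1 + j)).trans ih
  obtain ⟨N₀, hN₀⟩ := h (M + 1)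
  obtain ⟨D, hD⟩ := hN₀ (i₀ + 1 + N₀) (by omega)
  have hO : (fun n => a n - ∑ i ∈ Finset.range (i₀ + 1 + N₀), c i * e i n) =o[atTop] e i₀ := by
    rw [Asymptotics.isLittleO_iff]
    intro ε hε
    obtain ⟨N, hN⟩ := exists_nat_ge (D / (ε * d))
    filter_upwards [hM, hD, eventually_ge_atTop (N + 1)] with n h1 h2 h3
    have h3' : (N + 1 : ℝ) ≤ n := by exact_mod_cast h3
    have hn0 : (0 : ℝ) < n := by
      have : (0 : ℝ) ≤ N := N.cast_nonneg
      linarith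
    rw [div_le_iff₀ (by positivity)] at hN
    have h4 : D ≤ n * (ε * d) := hN.trans (by gcongr; linarith)
    have h5 : ‖a n - ∑ i ∈ Finset.range (i₀ + 1 + N₀), c i * e i n‖ * (n : ℝ) ^ (M + 1) ≤
        (ε * ‖e i₀ n‖) * (n : ℝ) ^ (M + 1) :=
      calc _ ≤ n * (ε * d) := h2.trans h4
        _ ≤ n * (ε * (‖e i₀ n‖ * (n : ℝ) ^ M)) := by gcongr
        _ = _ := by ring
    exact le_of_mul_le_mul_right h5 (by positivity)
  have hsum : ∀ n, ∑ i ∈ Finset.range (i₀ + 1 + N₀), c i * e i n =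
      c i₀ * e i₀ n + ∑ j ∈ Finset.range N₀, c (i₀ + 1 + j) * e (i₀ + 1 + j) n := by
    intro n
    rw [Finset.sum_range_add, Finset.sum_range_succ, Finset.sum_eq_zero, zero_add]
    intro i hi
    rw [hlt i (Finset.mem_range.1 hi), zero_mul]
  have hO2 : (fun n => a n - c i₀ * e i₀ n) =o[atTop] e i₀ := by
    have := hO.add (Asymptotics.IsLittleO.sum (s := Finset.range N₀)
      (A := fun j n => c (i₀ + 1 + j) * e (i₀ + 1 + j) n)
      fun j _ => (hscale j).const_mul_left _)
    refine this.congr_left fun n => ?_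
    rw [hsum n, Finset.sum_apply]
    ring
  have hc0 := norm_pos_iff.2 hi₀
  refine ⟨‖c i₀‖ / 2 * d, by positivity, M, ?_⟩
  filter_upwards [hM, (Asymptotics.isLittleO_iff.1 hO2) (half_pos hc0)] with n h1 h2
  have h3 := norm_sub_norm_le (c i₀ * e i₀ n) (a n)
  rw [norm_sub_rev, norm_mul] at h3
  have h4 : ‖c i₀‖ / 2 * ‖e i₀ n‖ ≤ ‖a n‖ := by linarith
  calc ‖c i₀‖ / 2 * d ≤ ‖c i₀‖ / 2 * (‖e i₀ n‖ * (n : ℝ) ^ M) := by gcongr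
    _ = (‖c i₀‖ / 2 * ‖e i₀ n‖) * (n : ℝ) ^ M := by ring
    _ ≤ _ := by gcongr

/-! ### Taylor coefficients of functions with an isolated algebraic or logarithmic singularity -/

/-- The `n`-th Taylor coefficient of `f` at `z`. -/
noncomputable def taylorCoeff (f : ℂ → ℂ) (z : ℂ) (n : ℕ) : ℂ := iteratedDeriv n f z / n.factorial

theorem AnalyticAt.iteratedDeriv' {f : ℂ → ℂ} {z : ℂ} (hf : AnalyticAt ℂ f z) (n : ℕ) :
    AnalyticAt ℂ (iteratedDeriv n f) z := by
  rw [iteratedDeriv_eq_iterate]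
  exact hf.iterated_deriv n

theorem taylorCoeff_succ (f : ℂ → ℂ) (z : ℂ) (n : ℕ) :
    ((n : ℂ) + 1) * taylorCoeff f z (n + 1) = taylorCoeff (deriv f) z n := by
  have h1 : (n.factorial : ℂ) ≠ 0 := by exact_mod_cast n.factorial_ne_zero
  have h2 : (n : ℂ) + 1 ≠ 0 := by exact_mod_cast n.succ_ne_zero
  rw [taylorCoeff, taylorCoeff, iteratedDeriv_succ', Nat.factorial_succ]
  push_cast
  field_simp

theorem taylorCoeff_congr {f g : ℂ → ℂ} {z : ℂ} (h : f =ᶠ[𝓝 z] g) (n : ℕ) :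
    taylorCoeff f z n = taylorCoeff g z n := by
  rw [taylorCoeff, taylorCoeff, h.iteratedDeriv_eq]

theorem taylorCoeff_add {f g : ℂ → ℂ} {z : ℂ} (hf : AnalyticAt ℂ f z) (hg : AnalyticAt ℂ g z)
    (n : ℕ) : taylorCoeff (fun w => f w + g w) z n = taylorCoeff f z n + taylorCoeff g z n := by
  rw [taylorCoeff, iteratedDeriv_fun_add hf.contDiffAt hg.contDiffAt, add_div]; rfl

theorem taylorCoeff_sub {f g : ℂ → ℂ} {z : ℂ} (hf : AnalyticAt ℂ f z) (hg : AnalyticAt ℂ g z)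
    (n : ℕ) : taylorCoeff (fun w => f w - g w) z n = taylorCoeff f z n - taylorCoeff g z n := by
  rw [taylorCoeff, iteratedDeriv_fun_sub hf.contDiffAt hg.contDiffAt, sub_div]; rfl

theorem taylorCoeff_const_mul (c : ℂ) (f : ℂ → ℂ) (z : ℂ) (n : ℕ) :
    taylorCoeff (fun w => c * f w) z n = c * taylorCoeff f z n := by
  rw [taylorCoeff, iteratedDeriv_const_mul_field, mul_div_assoc]; rfl

theorem taylorCoeff_sum {ι : Type*} (s : Finset ι) {f : ι → ℂ → ℂ} {z : ℂ}
    (hf : ∀ i ∈ s, AnalyticAt ℂ (f i) z) (n : ℕ) :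
    taylorCoeff (fun w => ∑ i ∈ s, f i w) z n = ∑ i ∈ s, taylorCoeff (f i) z n := by
  rw [taylorCoeff, iteratedDeriv_fun_sum fun i hi => (hf i hi).contDiffAt, Finset.sum_div]; rfl

/-- `v ^ (μ + i)`, or `v ^ (μ + i) log v` if `μ + i` is a natural number. For `μ ∉ ℕ` these are, in
decreasing order of size at `0`, the terms of an expansion at an algebraic (`μ ∉ ℤ`) or
logarithmic (`μ ∈ ℤ`) singularity, powers with natural exponents being left out. -/
noncomputable def singTerm (μ : ℂ) (i : ℕ) (v : ℂ) : ℂ :=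
  open Classical in
  if ∃ k : ℕ, μ + i = k then v ^ (μ + i) * Complex.log v else v ^ (μ + i)

theorem analyticAt_cpow_const {v : ℂ} (hv : v ∈ Complex.slitPlane) (ν : ℂ) :
    AnalyticAt ℂ (fun v : ℂ => v ^ ν) v :=
  analyticAt_id.cpow analyticAt_const hv

theorem analyticAt_complexLog {v : ℂ} (hv : v ∈ Complex.slitPlane) : AnalyticAt ℂ Complex.log v :=
  analyticAt_id.clog hv

theorem analyticAt_singTerm (μ : ℂ) (i : ℕ) {v : ℂ} (hv : v ∈ Complex.slitPlane) :
    AnalyticAt ℂ (singTerm μ i) v := by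
  unfold singTerm
  split_ifs
  · exact (analyticAt_cpow_const hv _).mul (analyticAt_complexLog hv)
  · exact analyticAt_cpow_const hv _

theorem eventually_slitPlane_one : ∀ᶠ v : ℂ in 𝓝 1, v ∈ Complex.slitPlane :=
  Complex.isOpen_slitPlane.mem_nhds Complex.one_mem_slitPlane

theorem taylorCoeff_natCast_cpow (k : ℕ) : ∀ᶠ n : ℕ in atTop,
    taylorCoeff (fun v : ℂ => v ^ (k : ℂ)) 1 n = 0 := by
  filter_upwards [eventually_gt_atTop k] with n hn
  simp [taylorCoeff, Nat.descFactorial_of_lt hn]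

/-- Each term of the scale is, up to a polynomial, a primitive of a multiple of the preceding
one. -/
theorem taylorCoeff_singTerm_succ (μ : ℂ) (i : ℕ) :
    ∃ κ ≠ 0, ∀ᶠ n : ℕ in atTop,
      (n + 1) * taylorCoeff (singTerm μ (i + 1)) 1 (n + 1) = κ * taylorCoeff (singTerm μ i) 1 n := by
  simp_rw [taylorCoeff_succ]
  by_cases hk : ∃ k : ℕ, μ + (i + 1 : ℕ) = k
  · obtain ⟨k, hk⟩ := hk
    have hE : singTerm μ (i + 1) = fun v => v ^ (k : ℂ) * Complex.log v := by
      funext v; rw [singTerm, if_pos ⟨k, hk⟩, hk]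
    have hd : deriv (singTerm μ (i + 1)) =ᶠ[𝓝 1] fun v =>
        (k : ℂ) * (v ^ ((k : ℂ) - 1) * Complex.log v) + v ^ ((k : ℂ) - 1) := by
      filter_upwards [eventually_slitPlane_one] with v hv
      rw [hE]
      have hv0 := Complex.slitPlane_ne_zero hv
      have := ((Complex.hasStrictDerivAt_cpow_const (c := (k : ℂ)) hv).hasDerivAt.mul
        (Complex.hasStrictDerivAt_log hv).hasDerivAt).deriv
      refine Eq.trans this ?_
      rw [Complex.cpow_sub _ _ hv0, Complex.cpow_one]
      field_simp
    obtain _ | k := k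
    · refine ⟨1, one_ne_zero, Eventually.of_forall fun n => ?_⟩
      have h1 : μ + i = -1 := by
        push_cast at hk
        linear_combination hk
      rw [taylorCoeff_congr hd, one_mul]
      congr 1
      funext v
      rw [singTerm, if_neg, h1]
      · simp
      · rintro ⟨k, hk'⟩
        rw [h1] at hk'
        have : ((k + 1 : ℕ) : ℂ) = 0 := by push_cast; rw [← hk']; ring
        exact absurd (Nat.cast_eq_zero.1 this) (by omega)
    · have h1 : μ + i = k := by
        push_cast at hk
        linear_combination hk
      refine ⟨(k + 1 : ℕ), by exact_mod_cast k.succ_ne_zero, ?_⟩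
      filter_upwards [taylorCoeff_natCast_cpow k] with n hn
      have h2 : ((k + 1 : ℕ) : ℂ) - 1 = k := by push_cast; ring
      have hE' : singTerm μ i = fun v => v ^ (k : ℂ) * Complex.log v := by
        funext v; rw [singTerm, if_pos ⟨k, h1⟩, h1]
      rw [taylorCoeff_congr hd, h2, taylorCoeff_add _ (analyticAt_cpow_const (by simp) _),
        taylorCoeff_const_mul, hn, add_zero, hE']
      exact analyticAt_const.mul ((analyticAt_cpow_const (by simp) _).mul (analyticAt_complexLog (by simp)))
  · have hk' : ¬ ∃ k : ℕ, μ + i = k := by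
      rintro ⟨k, h⟩
      exact hk ⟨k + 1, by push_cast; rw [← h]; ring⟩
    refine ⟨μ + i + 1, fun h0 => hk ⟨0, by push_cast; linear_combination h0⟩,
      Eventually.of_forall fun n => ?_⟩
    have hE' : singTerm μ i = fun v => v ^ (μ + i) := by
      funext v; rw [singTerm, if_neg hk']
    have hE : singTerm μ (i + 1) = fun v => v ^ (μ + i + 1) := by
      funext v; rw [singTerm, if_neg hk]; push_cast; rw [add_assoc]
    rw [← taylorCoeff_const_mul]
    refine taylorCoeff_congr ?_ n
    filter_upwards [eventually_slitPlane_one] with v hv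
    rw [hE, hE', (Complex.hasStrictDerivAt_cpow_const hv).hasDerivAt.deriv, add_sub_cancel_right]

theorem iteratedDeriv_cpow_const (μ : ℂ) (n : ℕ) :
    Set.EqOn (iteratedDeriv n fun v : ℂ => v ^ μ)
      (fun v => (∏ j ∈ Finset.range n, (μ - j)) * v ^ (μ - n)) Complex.slitPlane := by
  induction n with
  | zero => intro v _; simp
  | succ n ih =>
    intro v hv
    rw [iteratedDeriv_succ, (ih.eventuallyEq_of_mem
      (Complex.isOpen_slitPlane.mem_nhds hv)).deriv_eq,
      ((Complex.hasStrictDerivAt_cpow_const hv).hasDerivAt.const_mul _).deriv,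
      Finset.prod_range_succ]
    push_cast
    rw [sub_sub]
    ring

theorem taylorCoeff_singTerm_zero {μ : ℂ} (hμ : ∀ k : ℕ, μ ≠ k) :
    PolyLower (taylorCoeff (singTerm μ 0) 1) ∧ SlowDecay (taylorCoeff (singTerm μ 0) 1) := by
  have hE : singTerm μ 0 = fun v => v ^ μ := by
    funext v
    rw [singTerm, if_neg]
    · simp
    · rintro ⟨k, h⟩
      exact hμ k (by simpa using h)
  have hrec : ∀ n : ℕ, (n + 1) * taylorCoeff (singTerm μ 0) 1 (n + 1) =
      (μ - n) * taylorCoeff (singTerm μ 0) 1 n := by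
    intro n
    have h1 : (n.factorial : ℂ) ≠ 0 := by exact_mod_cast n.factorial_ne_zero
    have h2 : (n : ℂ) + 1 ≠ 0 := by exact_mod_cast n.succ_ne_zero
    rw [hE, taylorCoeff, taylorCoeff, iteratedDeriv_cpow_const _ _ (by simp),
      iteratedDeriv_cpow_const _ _ (by simp), Finset.prod_range_succ, Nat.factorial_succ]
    push_cast
    simp only [Complex.one_cpow]
    field_simp
  exact ⟨binomial_polyLower hμ (by simp [hE, taylorCoeff]) hrec, binomial_slowDecay hrec⟩

theorem taylorCoeff_singTerm {μ : ℂ} (hμ : ∀ k : ℕ, μ ≠ k) (i : ℕ) :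
    PolyLower (taylorCoeff (singTerm μ i) 1) ∧ SlowDecay (taylorCoeff (singTerm μ i) 1) := by
  induction i with
  | zero => exact taylorCoeff_singTerm_zero hμ
  | succ i ih =>
    obtain ⟨κ, hκ, h⟩ := taylorCoeff_singTerm_succ μ i
    exact ⟨ih.1.integrated hκ h, ih.2.integrated hκ h⟩

/-! ### Remainder estimates -/

theorem ball_one_subset_slitPlane : Metric.ball (1 : ℂ) 1 ⊆ Complex.slitPlane :=
  Complex.ball_one_subset_slitPlane

theorem eventuallyEq_iteratedDeriv_nhdsWithin {s : Set ℂ} (hs : IsOpen s) {f g : ℂ → ℂ} {p : ℂ}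
    (h : f =ᶠ[𝓝[s] p] g) (n : ℕ) : iteratedDeriv n f =ᶠ[𝓝[s] p] iteratedDeriv n g := by
  filter_upwards [eventually_eventually_nhdsWithin.2 h, self_mem_nhdsWithin] with v hv hvs
  rw [hs.nhdsWithin_eq hvs] at hv
  exact Filter.EventuallyEq.iteratedDeriv_eq n hv

/-- The functions `v ^ ν (g log v + k)`, with `g` and `k` analytic at `0`, are stable under
differentiation, at the cost of lowering `ν` by one. -/
theorem iteratedDeriv_cpow_mul_log (ν : ℂ) {g k : ℂ → ℂ} (hg : AnalyticAt ℂ g 0)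
    (hk : AnalyticAt ℂ k 0) (n : ℕ) : ∃ g' k' : ℂ → ℂ, AnalyticAt ℂ g' 0 ∧ AnalyticAt ℂ k' 0 ∧
      iteratedDeriv n (fun v => v ^ ν * (g v * Complex.log v + k v))
        =ᶠ[𝓝[Metric.ball 1 1] 0] fun v => v ^ (ν - n) * (g' v * Complex.log v + k' v) := by
  induction n with
  | zero => exact ⟨g, k, hg, hk, by simp⟩
  | succ n ih =>
    obtain ⟨g', k', hg', hk', h⟩ := ih
    refine ⟨fun v => (ν - n) * g' v + v * deriv g' v,
      fun v => g' v + ((ν - n) * k' v + v * deriv k' v),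
      (analyticAt_const.mul hg').add (analyticAt_id.mul hg'.deriv),
      hg'.add ((analyticAt_const.mul hk').add (analyticAt_id.mul hk'.deriv)), ?_⟩
    filter_upwards [eventually_eventually_nhdsWithin.2 h, self_mem_nhdsWithin,
      hg'.eventually_analyticAt.filter_mono nhdsWithin_le_nhds,
      hk'.eventually_analyticAt.filter_mono nhdsWithin_le_nhds] with v hv hvs hgv hkv
    rw [Metric.isOpen_ball.nhdsWithin_eq hvs] at hv
    have hvp := ball_one_subset_slitPlane hvs
    have hv0 := Complex.slitPlane_ne_zero hvp
    rw [iteratedDeriv_succ, Filter.EventuallyEq.deriv_eq hv]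
    have := ((Complex.hasStrictDerivAt_cpow_const (c := ν - n) hvp).hasDerivAt.mul
      ((hgv.differentiableAt.hasDerivAt.mul (Complex.hasStrictDerivAt_log hvp).hasDerivAt).add
        hkv.differentiableAt.hasDerivAt)).deriv
    refine Eq.trans this ?_
    simp only [Pi.add_apply, Pi.mul_apply]
    push_cast
    rw [← sub_sub, Complex.cpow_sub (ν - n) 1 hv0, Complex.cpow_one]
    field_simp
    ring

theorem norm_cpow_le_of_one_le_re {v σ : ℂ} (hv : v ≠ 0) (hv1 : ‖v‖ ≤ 1) (hσ : 1 ≤ σ.re) :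
    ‖v ^ σ‖ ≤ ‖v‖ * Real.exp (Real.pi * |σ.im|) := by
  rw [Complex.norm_cpow_of_ne_zero hv, div_eq_mul_inv, ← Real.exp_neg]
  gcongr
  · exact (Real.rpow_le_rpow_of_exponent_ge (norm_pos_iff.2 hv) hv1 hσ).trans_eq (Real.rpow_one _)
  · calc -(v.arg * σ.im) ≤ |v.arg * σ.im| := neg_le_abs _
      _ ≤ _ := by rw [abs_mul]; gcongr; exact Complex.abs_arg_le_pi v

theorem norm_mul_norm_log_le {v : ℂ} (hv : v ≠ 0) (hv1 : ‖v‖ ≤ 1) :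
    ‖v‖ * ‖Complex.log v‖ ≤ 1 + Real.pi := by
  have h1 : ‖Complex.log v‖ ≤ |Real.log ‖v‖| + Real.pi := by
    refine (Complex.norm_le_abs_re_add_abs_im _).trans ?_
    rw [Complex.log_re, Complex.log_im]
    gcongr
    exact Complex.abs_arg_le_pi v
  have h2 := (Real.abs_log_mul_self_lt ‖v‖ (norm_pos_iff.2 hv) hv1).le
  rw [abs_mul, abs_of_nonneg (norm_nonneg v)] at h2
  nlinarith [norm_nonneg v, Real.pi_pos]

theorem eventually_bounded_cpow_mul_log {ν : ℂ} (hν : 1 ≤ ν.re) {g k : ℂ → ℂ}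
    (hg : AnalyticAt ℂ g 0) (hk : AnalyticAt ℂ k 0) :
    ∃ D : ℝ, ∀ᶠ v in 𝓝[Metric.ball 1 1] (0 : ℂ), ‖v ^ ν * (g v * Complex.log v + k v)‖ ≤ D := by
  refine ⟨Real.exp (Real.pi * |ν.im|) * ((‖g 0‖ + 1) * (1 + Real.pi) + (‖k 0‖ + 1)), ?_⟩
  have hg1 : ∀ᶠ v in 𝓝 (0 : ℂ), ‖g v‖ < ‖g 0‖ + 1 :=
    hg.continuousAt.norm.eventually_lt_const (lt_add_one _)
  have hk1 : ∀ᶠ v in 𝓝 (0 : ℂ), ‖k v‖ < ‖k 0‖ + 1 :=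
    hk.continuousAt.norm.eventually_lt_const (lt_add_one _)
  have hv1 : ∀ᶠ v in 𝓝 (0 : ℂ), ‖v‖ < 1 := by
    have := Metric.ball_mem_nhds (0 : ℂ) one_pos
    filter_upwards [this] with v hv using by simpa using hv
  filter_upwards [self_mem_nhdsWithin, hg1.filter_mono nhdsWithin_le_nhds,
    hk1.filter_mono nhdsWithin_le_nhds, hv1.filter_mono nhdsWithin_le_nhds] with v hv hgv hkv hv1
  have hv0 := Complex.slitPlane_ne_zero (ball_one_subset_slitPlane hv)
  have h1 := norm_cpow_le_of_one_le_re hv0 hv1.le hν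
  have h2 := norm_mul_norm_log_le hv0 hv1.le
  have h3 : ‖g v * Complex.log v + k v‖ ≤ (‖g 0‖ + 1) * ‖Complex.log v‖ + (‖k 0‖ + 1) := by
    refine (norm_add_le _ _).trans ?_
    rw [norm_mul]
    gcongr
  rw [norm_mul]
  calc _ ≤ (‖v‖ * Real.exp (Real.pi * |ν.im|)) *
        ((‖g 0‖ + 1) * ‖Complex.log v‖ + (‖k 0‖ + 1)) := by gcongr
    _ = Real.exp (Real.pi * |ν.im|) *
        ((‖g 0‖ + 1) * (‖v‖ * ‖Complex.log v‖) + ‖v‖ * (‖k 0‖ + 1)) := by ring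
    _ ≤ _ := by
      gcongr
      nlinarith [norm_nonneg (k 0)]

theorem exists_bound_of_locally_bounded {f : ℂ → ℂ}
    (h : ∀ p ∈ Metric.closedBall (1 : ℂ) 1, ∃ D : ℝ, ∀ᶠ v in 𝓝[Metric.ball 1 1] p, ‖f v‖ ≤ D) :
    ∃ D : ℝ, ∀ v ∈ Metric.ball (1 : ℂ) 1, ‖f v‖ ≤ D := by
  have := (isCompact_closedBall (1 : ℂ) 1).induction_on
    (p := fun s => ∃ D : ℝ, ∀ v ∈ s, v ∈ Metric.ball (1 : ℂ) 1 → ‖f v‖ ≤ D)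
    ⟨0, by simp⟩ (fun s t hst ⟨D, hD⟩ => ⟨D, fun v hv => hD v (hst hv)⟩)
    (fun s t ⟨D, hD⟩ ⟨D', hD'⟩ => ⟨max D D', fun v hv hb => hv.elim
      (fun hv => (hD v hv hb).trans (le_max_left _ _))
      (fun hv => (hD' v hv hb).trans (le_max_right _ _))⟩)
    (fun p hp => by
      obtain ⟨D, hD⟩ := h p hp
      exact ⟨_, mem_nhdsWithin_of_mem_nhds (eventually_nhdsWithin_iff.1 hD), D, fun v hv hb => hv hb⟩)
  obtain ⟨D, hD⟩ := this
  exact ⟨D, fun v hv => hD v (Metric.ball_subset_closedBall hv) hv⟩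

theorem norm_iteratedDeriv_le_of_bounded {f : ℂ → ℂ} {z : ℂ} {D : ℝ}
    (hf : DifferentiableOn ℂ f (Metric.ball z 1)) (hD : ∀ v ∈ Metric.ball z 1, ‖f v‖ ≤ D) (n : ℕ) :
    ‖iteratedDeriv n f z‖ ≤ n.factorial * D := by
  have h1 : ∀ r ∈ Set.Ioo (0 : ℝ) 1, ‖iteratedDeriv n f z‖ ≤ n.factorial * D / r ^ n := by
    intro r hr
    have hsub : Metric.closedBall z r ⊆ Metric.ball z 1 := Metric.closedBall_subset_ball hr.2
    refine Complex.norm_iteratedDeriv_le_of_forall_mem_sphere_norm_le n hr.1 ?_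
      fun w hw => hD w (hsub (Metric.sphere_subset_closedBall hw))
    exact DifferentiableOn.diffContOnCl (hf.mono ((closure_mono Metric.ball_subset_closedBall).trans
      (by rw [Metric.isClosed_closedBall.closure_eq]; exact hsub)))
  have h2 : Tendsto (fun r : ℝ => n.factorial * D / r ^ n) (𝓝[<] 1) (𝓝 (n.factorial * D)) := by
    have : ContinuousAt (fun r : ℝ => n.factorial * D / r ^ n) 1 :=
      continuousAt_const.div (continuousAt_id.pow n) (by simp)
    have h3 : Tendsto (fun r : ℝ => n.factorial * D / r ^ n) (𝓝 1) (𝓝 (n.factorial * D)) := by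
      simpa [ContinuousAt] using this
    exact h3.mono_left nhdsWithin_le_nhds
  exact ge_of_tendsto h2 (by filter_upwards [Ioo_mem_nhdsLT (zero_lt_one)] with r hr using h1 r hr)

/-- If the `K`-th derivative is bounded on the unit disc, the Taylor coefficients at the centre
are `O(n ^ (-K))`. -/
theorem norm_taylorCoeff_mul_pow_le {f : ℂ → ℂ} {z : ℂ} {K : ℕ} {D : ℝ}
    (hf : DifferentiableOn ℂ f (Metric.ball z 1))
    (hD : ∀ v ∈ Metric.ball z 1, ‖iteratedDeriv K f v‖ ≤ D) :
    ∀ᶠ n : ℕ in atTop, ‖taylorCoeff f z n‖ * (n : ℝ) ^ K ≤ 2 ^ K * D := by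
  have hD0 : 0 ≤ D := (norm_nonneg _).trans (hD z (Metric.mem_ball_self one_pos))
  have hKd : DifferentiableOn ℂ (iteratedDeriv K f) (Metric.ball z 1) := fun v hv =>
    ((hf.analyticOnNhd Metric.isOpen_ball v hv).iteratedDeriv' K).differentiableAt
      |>.differentiableWithinAt
  filter_upwards [eventually_ge_atTop (2 * K)] with n hn
  obtain ⟨j, rfl⟩ := Nat.exists_eq_add_of_le' (show K ≤ n by omega)
  have h1 : ‖iteratedDeriv (j + K) f z‖ ≤ j.factorial * D := by
    have := norm_iteratedDeriv_le_of_bounded hKd hD j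
    rwa [iteratedDeriv_eq_iterate, iteratedDeriv_eq_iterate, ← Function.iterate_add_apply,
      ← iteratedDeriv_eq_iterate] at this
  have h2 : (((j + K).factorial : ℕ) : ℝ) = j.factorial * ((j + K).descFactorial K : ℕ) := by
    have := Nat.factorial_mul_descFactorial (show K ≤ j + K by omega)
    rw [Nat.add_sub_cancel] at this
    exact_mod_cast this.symm
  have h3 : ((j + K : ℕ) : ℝ) ^ K ≤ 2 ^ K * ((j + K).descFactorial K : ℕ) := by
    have := Nat.pow_sub_le_descFactorial (j + K) K
    have h4 : (j + K) ^ K ≤ (2 * (j + K + 1 - K)) ^ K := Nat.pow_le_pow_left (by omega) K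
    rw [mul_pow] at h4
    exact_mod_cast h4.trans (Nat.mul_le_mul_left _ this)
  have hj : (0 : ℝ) < j.factorial := by exact_mod_cast j.factorial_pos
  have hdf : (0 : ℝ) < ((j + K).descFactorial K : ℕ) := by
    exact_mod_cast Nat.pos_of_ne_zero (by simp [Nat.descFactorial_eq_zero_iff_lt])
  rw [taylorCoeff, norm_div, Complex.norm_natCast, h2, div_mul_eq_mul_div, div_le_iff₀ (by positivity)]
  calc _ ≤ (j.factorial * D) * (2 ^ K * ((j + K).descFactorial K : ℕ)) := by gcongr
    _ = _ := by ring

/-! ### Darboux's method -/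

/-- `f`, given on `W`, coincides near `p` within `W` with a function analytic at `p`. -/
def ExtendsWithin (f : ℂ → ℂ) (W : Set ℂ) (p : ℂ) : Prop :=
  ∃ g : ℂ → ℂ, AnalyticAt ℂ g p ∧ f =ᶠ[𝓝[W] p] g

theorem mem_slitPlane_of_mem_closedBall {p : ℂ} (hp : p ∈ Metric.closedBall (1 : ℂ) 1)
    (hp0 : p ≠ 0) : p ∈ Complex.slitPlane := by
  left
  have h1 : ‖p - 1‖ ^ 2 ≤ 1 := by
    rw [Metric.mem_closedBall, dist_eq_norm] at hp
    nlinarith [norm_nonneg (p - 1)]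
  have h2 : 0 < ‖p‖ ^ 2 := by positivity
  rw [Complex.sq_norm, Complex.normSq_apply] at h1 h2
  simp at h1
  nlinarith

/-- **Darboux's method.** Let `F` be holomorphic on the disc `|v - 1| < 1`, extend analytically
across every boundary point except `0`, and have at `0` an expansion in the terms
`singTerm μ i`, not all of whose coefficients vanish. Then its Taylor coefficients at `1` are
bounded below by a power of the index: after subtracting enough terms, the remainder has bounded
derivatives of high order on the disc. -/
theorem polyLower_taylorCoeff_of_expansion {F : ℂ → ℂ}
    (hF : DifferentiableOn ℂ F (Metric.ball 1 1))
    (hext : ∀ p ∈ Metric.sphere (1 : ℂ) 1, p ≠ 0 → ExtendsWithin F (Metric.ball 1 1) p)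
    {μ : ℂ} (hμ : ∀ k : ℕ, μ ≠ k) {c : ℕ → ℂ} (hc : ∃ i, c i ≠ 0)
    (hexp : ∀ K : ℕ, ∃ N₀, ∀ N ≥ N₀, ∃ ν : ℂ, K + 1 ≤ ν.re ∧ ∃ g k l : ℂ → ℂ,
      AnalyticAt ℂ g 0 ∧ AnalyticAt ℂ k 0 ∧ AnalyticAt ℂ l 0 ∧
      F =ᶠ[𝓝[Metric.ball 1 1] 0] fun v => ∑ i ∈ Finset.range N, c i * singTerm μ i v +
        v ^ ν * (g v * Complex.log v + k v) + l v) :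
    PolyLower (taylorCoeff F 1) := by
  refine PolyLower.of_expansion (e := fun i => taylorCoeff (singTerm μ i) 1)
    (fun i => (taylorCoeff_singTerm hμ i).1) (fun i => ?_) hc fun K => ?_
  · obtain ⟨κ, -, h⟩ := taylorCoeff_singTerm_succ μ i
    exact (taylorCoeff_singTerm hμ i).2.isLittleO_integrated h
  obtain ⟨N₀, hN₀⟩ := hexp K
  refine ⟨N₀, fun N hN => ?_⟩
  obtain ⟨ν, hν, g, k, l, hg, hk, hl, hFe⟩ := hN₀ N hN
  let S : ℂ → ℂ := fun v => ∑ i ∈ Finset.range N, c i * singTerm μ i v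
  have hSa : ∀ v ∈ Complex.slitPlane, AnalyticAt ℂ S v := fun v hv =>
    Finset.analyticAt_fun_sum _ fun i _ => analyticAt_const.mul (analyticAt_singTerm μ i hv)
  let R : ℂ → ℂ := fun v => F v - S v
  have hRd : DifferentiableOn ℂ R (Metric.ball 1 1) := hF.sub fun v hv =>
    (hSa v (ball_one_subset_slitPlane hv)).differentiableAt.differentiableWithinAt
  have hloc : ∀ p : ℂ, ∀ G : ℂ → ℂ, AnalyticAt ℂ G p → R =ᶠ[𝓝[Metric.ball 1 1] p] G →
      ∃ D : ℝ, ∀ᶠ v in 𝓝[Metric.ball 1 1] p, ‖iteratedDeriv K R v‖ ≤ D := by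
    intro p G hG hRG
    refine ⟨‖iteratedDeriv K G p‖ + 1, ?_⟩
    have h1 := (hG.iteratedDeriv' K).continuousAt.norm.eventually_lt_const (lt_add_one _)
    filter_upwards [eventuallyEq_iteratedDeriv_nhdsWithin Metric.isOpen_ball hRG K,
      h1.filter_mono nhdsWithin_le_nhds] with v hv hv1
    rw [hv]
    exact hv1.le
  obtain ⟨D, hD⟩ : ∃ D : ℝ, ∀ v ∈ Metric.ball (1 : ℂ) 1, ‖iteratedDeriv K R v‖ ≤ D := by
    refine exists_bound_of_locally_bounded fun p hp => ?_
    by_cases hp0 : p = 0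
    · subst hp0
      obtain ⟨g', k', hg', hk', h'⟩ := iteratedDeriv_cpow_mul_log ν hg hk K
      obtain ⟨D₁, hD₁⟩ := eventually_bounded_cpow_mul_log (ν := ν - K) (by simp; linarith) hg' hk'
      refine ⟨D₁ + (‖iteratedDeriv K l 0‖ + 1), ?_⟩
      have h1 := (hl.iteratedDeriv' K).continuousAt.norm.eventually_lt_const (lt_add_one _)
      have hRe : R =ᶠ[𝓝[Metric.ball 1 1] 0] fun v => v ^ ν * (g v * Complex.log v + k v) + l v := by
        filter_upwards [hFe] with v hv
        simp only [R, S, hv]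
        ring
      filter_upwards [eventuallyEq_iteratedDeriv_nhdsWithin Metric.isOpen_ball hRe K, h',
        hD₁, self_mem_nhdsWithin, h1.filter_mono nhdsWithin_le_nhds,
        hg.eventually_analyticAt.filter_mono nhdsWithin_le_nhds,
        hk.eventually_analyticAt.filter_mono nhdsWithin_le_nhds,
        hl.eventually_analyticAt.filter_mono nhdsWithin_le_nhds]
        with v hv1 hv2 hv3 hvs hv4 hgv hkv hlv
      have hvp := ball_one_subset_slitPlane hvs
      have ha : AnalyticAt ℂ (fun v => v ^ ν * (g v * Complex.log v + k v)) v :=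
        (analyticAt_cpow_const hvp _).mul ((hgv.mul (analyticAt_complexLog hvp)).add hkv)
      rw [hv1, iteratedDeriv_fun_add ha.contDiffAt hlv.contDiffAt, hv2]
      exact (norm_add_le _ _).trans (add_le_add hv3 hv4.le)
    · have hps := mem_slitPlane_of_mem_closedBall hp hp0
      obtain hlt | heq := (Metric.mem_closedBall.1 hp).lt_or_eq
      · exact hloc p R (hRd.analyticOnNhd Metric.isOpen_ball p hlt) EventuallyEq.rfl
      · obtain ⟨G, hG, hFG⟩ := hext p heq hp0
        refine hloc p (fun v => G v - S v) (hG.sub (hSa p hps)) ?_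
        filter_upwards [hFG] with v hv
        simp only [R, hv]
  refine ⟨2 ^ K * D, ?_⟩
  filter_upwards [norm_taylorCoeff_mul_pow_le hRd hD] with n hn
  have hF1 : AnalyticAt ℂ F 1 :=
    hF.analyticOnNhd Metric.isOpen_ball 1 (Metric.mem_ball_self one_pos)
  have : taylorCoeff R 1 n = taylorCoeff F 1 n -
      ∑ i ∈ Finset.range N, c i * taylorCoeff (singTerm μ i) 1 n := by
    have ha : ∀ i ∈ Finset.range N, AnalyticAt ℂ (fun v => c i * singTerm μ i v) 1 := fun i _ =>
      analyticAt_const.mul (analyticAt_singTerm μ i (by simp))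
    rw [taylorCoeff_sub hF1 (hSa 1 (by simp)), taylorCoeff_sum _ ha]
    simp_rw [taylorCoeff_const_mul]
  rwa [← this]

/-- Taylor's formula with analytic remainder. -/
theorem AnalyticAt.exists_taylor {h : ℂ → ℂ} (hh : AnalyticAt ℂ h 0) :
    ∃ c : ℕ → ℂ, (∀ N, ∃ r : ℂ → ℂ, AnalyticAt ℂ r 0 ∧
      ∀ v, h v = ∑ i ∈ Finset.range N, c i * v ^ i + v ^ N * r v) ∧
      ((∀ i, c i = 0) → ∀ᶠ v in 𝓝 0, h v = 0) := by
  obtain ⟨p, hp⟩ := hh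
  refine ⟨p.coeff, fun N => ⟨(Function.swap dslope 0)^[N] h,
    (hp.has_fpower_series_iterate_dslope_fslope N).analyticAt, fun v => ?_⟩, fun h0 => ?_⟩
  · induction N with
    | zero => simp
    | succ N ih =>
      have h1 : ((Function.swap dslope 0)^[N] h) 0 = p.coeff N := by
        have := (hp.has_fpower_series_iterate_dslope_fslope N).coeff_zero 1
        rw [← this]
        have h2 := FormalMultilinearSeries.coeff_iterate_fslope (p := p) N 0
        rw [zero_add] at h2
        exact h2
      have h3 := sub_smul_dslope ((Function.swap dslope 0)^[N] h) 0 v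
      rw [h1, sub_zero, smul_eq_mul] at h3
      rw [ih, Finset.sum_range_succ, Function.iterate_succ_apply', pow_succ]
      simp only [Function.swap]
      rw [mul_assoc (v ^ N), h3]
      ring
  · have : p = 0 := by
      ext1 n
      exact FormalMultilinearSeries.coeff_eq_zero.1 (h0 n)
    subst this
    exact hp.eventually_eq_zero

/-- Darboux's method at an algebraic singularity with non-integral exponent `μ`. -/
theorem polyLower_of_algebraic {F : ℂ → ℂ} (hF : DifferentiableOn ℂ F (Metric.ball 1 1))
    (hext : ∀ p ∈ Metric.sphere (1 : ℂ) 1, p ≠ 0 → ExtendsWithin F (Metric.ball 1 1) p)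
    (h0 : ¬ ExtendsWithin F (Metric.ball 1 1) 0) {μ : ℂ} (hμ : ∀ k : ℕ, μ ≠ k)
    (hμ' : ∀ k : ℕ, μ ≠ -k)
    {h k : ℂ → ℂ} (hh : AnalyticAt ℂ h 0) (hk : AnalyticAt ℂ k 0)
    (hFe : F =ᶠ[𝓝[Metric.ball 1 1] 0] fun v => v ^ μ * h v + k v) :
    PolyLower (taylorCoeff F 1) := by
  obtain ⟨c, hc, hc0⟩ := hh.exists_taylor
  have hlog : ∀ i : ℕ, ¬ ∃ k : ℕ, μ + i = k := by
    rintro i ⟨k, hk⟩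
    obtain hik | hik := le_total i k
    · exact hμ (k - i : ℕ) (by rw [Nat.cast_sub hik]; linear_combination hk)
    · exact hμ' (i - k : ℕ) (by rw [Nat.cast_sub hik]; linear_combination hk)
  refine polyLower_taylorCoeff_of_expansion hF hext hμ (c := c) ?_ fun K => ?_
  · by_contra! hall
    refine h0 ⟨k, hk, ?_⟩
    filter_upwards [hFe, (hc0 hall).filter_mono nhdsWithin_le_nhds] with v hv hv0
    rw [hv, hv0, mul_zero, zero_add]
  · obtain ⟨N₀, hN₀⟩ := exists_nat_ge (K + 1 - μ.re)
    refine ⟨N₀, fun N hN => ⟨μ + N, ?_, ?_⟩⟩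
    · have : (N₀ : ℝ) ≤ N := by exact_mod_cast hN
      simp
      linarith
    · obtain ⟨r, hr, hhr⟩ := hc N
      refine ⟨fun _ => 0, r, k, analyticAt_const, hr, hk, ?_⟩
      filter_upwards [hFe, self_mem_nhdsWithin] with v hv hvs
      have hv0 := Complex.slitPlane_ne_zero (ball_one_subset_slitPlane hvs)
      have hs : ∀ i : ℕ, singTerm μ i v = v ^ μ * v ^ i := fun i => by
        rw [singTerm, if_neg (hlog i), Complex.cpow_add _ _ hv0, Complex.cpow_natCast]
      simp_rw [hs]
      rw [hv, hhr v, Complex.cpow_add _ _ hv0, Complex.cpow_natCast, mul_add, Finset.mul_sum]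
      have : ∀ i, v ^ μ * (c i * v ^ i) = c i * (v ^ μ * v ^ i) := fun i => by ring
      simp_rw [this]
      ring

/-- Darboux's method at a pole, possibly combined with a logarithmic singularity. -/
theorem polyLower_of_logarithmic {F : ℂ → ℂ} (hF : DifferentiableOn ℂ F (Metric.ball 1 1))
    (hext : ∀ p ∈ Metric.sphere (1 : ℂ) 1, p ≠ 0 → ExtendsWithin F (Metric.ball 1 1) p)
    (h0 : ¬ ExtendsWithin F (Metric.ball 1 1) 0) {P : ℕ}
    {h g k : ℂ → ℂ} (hh : AnalyticAt ℂ h 0) (hg : AnalyticAt ℂ g 0) (hk : AnalyticAt ℂ k 0)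
    (hFe : F =ᶠ[𝓝[Metric.ball 1 1] 0] fun v => (v ^ P)⁻¹ * h v + g v * Complex.log v + k v) :
    PolyLower (taylorCoeff F 1) := by
  -- allow `P = 0` by passing to `P + 1`
  obtain ⟨Q, h, hh, hFe⟩ : ∃ Q : ℕ, ∃ h : ℂ → ℂ, AnalyticAt ℂ h 0 ∧
      F =ᶠ[𝓝[Metric.ball 1 1] 0]
        fun v => (v ^ (Q + 1))⁻¹ * h v + g v * Complex.log v + k v := by
    refine ⟨P, fun v => v * h v, analyticAt_id.mul hh, ?_⟩
    filter_upwards [hFe, self_mem_nhdsWithin] with v hv hvs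
    have hv0 := Complex.slitPlane_ne_zero (ball_one_subset_slitPlane hvs)
    rw [hv, pow_succ]
    field_simp
  obtain ⟨c, hc, hc0⟩ := hh.exists_taylor
  obtain ⟨d, hd, hd0⟩ := hg.exists_taylor
  obtain ⟨r, hr, hhr⟩ := hc (Q + 1)
  have hμ : ∀ k : ℕ, (-(Q + 1 : ℕ) : ℂ) ≠ k := by
    intro k hk
    have : ((k + (Q + 1) : ℕ) : ℂ) = 0 := by push_cast; rw [← hk]; push_cast; ring
    exact absurd (Nat.cast_eq_zero.1 this) (by omega)
  refine polyLower_taylorCoeff_of_expansion hF hext hμ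
    (c := fun i => if i < Q + 1 then c i else d (i - (Q + 1))) ?_ fun K => ?_
  · by_contra! hall
    have hd' : ∀ i, d i = 0 := fun i => by
      simpa [show ¬ i + (Q + 1) < Q + 1 by omega] using hall (i + (Q + 1))
    have hc' : ∀ i < Q + 1, c i = 0 := fun i hi => by simpa [hi] using hall i
    refine h0 ⟨fun v => r v + k v, hr.add hk, ?_⟩
    filter_upwards [hFe, (hd0 hd').filter_mono nhdsWithin_le_nhds, self_mem_nhdsWithin]
      with v hv hgv hvs
    have hv0 := Complex.slitPlane_ne_zero (ball_one_subset_slitPlane hvs)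
    rw [hv, hgv, hhr v, Finset.sum_eq_zero fun i hi => by rw [hc' i (Finset.mem_range.1 hi), zero_mul]]
    field_simp
    ring
  · refine ⟨Q + 1 + (K + 1), fun N hN => ?_⟩
    obtain ⟨N, rfl⟩ := Nat.exists_eq_add_of_le (show Q + 1 ≤ N by omega)
    obtain ⟨s, hs, hgs⟩ := hd N
    refine ⟨N, ?_, s, fun _ => 0, fun v => r v + k v, hs, analyticAt_const, hr.add hk, ?_⟩
    · have : K + 1 ≤ N := by omega
      simpa using (by exact_mod_cast this : ((K : ℝ) + 1) ≤ N)
    filter_upwards [hFe, self_mem_nhdsWithin] with v hv hvs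
    have hv0 := Complex.slitPlane_ne_zero (ball_one_subset_slitPlane hvs)
    have hs1 : ∀ i ∈ Finset.range (Q + 1),
        (if i < Q + 1 then c i else d (i - (Q + 1))) * singTerm (-(Q + 1 : ℕ)) i v =
          (v ^ (Q + 1))⁻¹ * (c i * v ^ i) := by
      intro i hi
      have hi := Finset.mem_range.1 hi
      rw [if_pos hi, singTerm, if_neg, Complex.cpow_add _ _ hv0, Complex.cpow_neg,
        Complex.cpow_natCast, Complex.cpow_natCast]
      · ring
      · rintro ⟨k, hk⟩
        have : ((k + (Q + 1) : ℕ) : ℂ) = i := by push_cast; rw [← hk]; push_cast; ring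
        have := Nat.cast_injective this
        omega
    have hs2 : ∀ i ∈ Finset.range N,
        (if Q + 1 + i < Q + 1 then c (Q + 1 + i) else d (Q + 1 + i - (Q + 1))) *
          singTerm (-(Q + 1 : ℕ)) (Q + 1 + i) v = d i * v ^ i * Complex.log v := by
      intro i _
      have h1 : (-(Q + 1 : ℕ) : ℂ) + ((Q + 1 + i : ℕ) : ℂ) = i := by push_cast; ring
      rw [if_neg (by omega), singTerm, if_pos ⟨i, h1⟩, h1, Complex.cpow_natCast,
        Nat.add_sub_cancel_left]
      ring
    rw [Finset.sum_range_add, Finset.sum_congr rfl hs1, Finset.sum_congr rfl hs2, hv, hhr v, hgs v,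
      ← Finset.mul_sum, ← Finset.sum_mul, Complex.cpow_natCast]
    field_simp
    ring

/-! ### Holomorphic extension of germs to discs -/

/-- The germ of `f` at `z` extends holomorphically to the open disc of radius `R` about `z`. -/
def ExtendsToBall (f : ℂ → ℂ) (z : ℂ) (R : ℝ) : Prop :=
  ∃ g : ℂ → ℂ, DifferentiableOn ℂ g (Metric.ball z R) ∧ f =ᶠ[𝓝 z] g

theorem ExtendsToBall.mono {f : ℂ → ℂ} {z : ℂ} {R R' : ℝ} (h : ExtendsToBall f z R) (hR : R' ≤ R) :
    ExtendsToBall f z R' := by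
  obtain ⟨g, hg, hfg⟩ := h
  exact ⟨g, hg.mono (Metric.ball_subset_ball hR), hfg⟩

/-- The sum of the Taylor series of `f` at `z`, a canonical extension of the germ. -/
noncomputable def taylorSum (f : ℂ → ℂ) (z w : ℂ) : ℂ :=
  ∑' n : ℕ, ((n.factorial : ℂ))⁻¹ * iteratedDeriv n f z * (w - z) ^ n

theorem taylorSum_eqOn {f g : ℂ → ℂ} {z : ℂ} {R : ℝ}
    (hg : DifferentiableOn ℂ g (Metric.ball z R)) (hfg : f =ᶠ[𝓝 z] g) :
    Set.EqOn (taylorSum f z) g (Metric.ball z R) := by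
  intro w hw
  rw [← Complex.taylorSeries_eq_on_ball' hw hg, taylorSum]
  simp_rw [hfg.iteratedDeriv_eq]

theorem ExtendsToBall.taylorSum {f : ℂ → ℂ} {z : ℂ} {R : ℝ} (hR : 0 < R)
    (h : ExtendsToBall f z R) :
    DifferentiableOn ℂ (taylorSum f z) (Metric.ball z R) ∧ f =ᶠ[𝓝 z] _root_.taylorSum f z := by
  obtain ⟨g, hg, hfg⟩ := h
  have := taylorSum_eqOn hg hfg
  refine ⟨hg.congr this, hfg.trans ?_⟩
  exact (this.eventuallyEq_of_mem (Metric.ball_mem_nhds z hR)).symm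

theorem ExtendsToBall.of_forall_lt {f : ℂ → ℂ} {z : ℂ} {R : ℝ} (hR : 0 < R)
    (h : ∀ r, 0 < r → r < R → ExtendsToBall f z r) : ExtendsToBall f z R := by
  refine ⟨_root_.taylorSum f z, fun w hw => ?_,
    ((h (R / 2) (by linarith) (by linarith)).taylorSum (by linarith)).2⟩
  obtain ⟨r, hr1, hr2⟩ := exists_between (max_lt hR (Metric.mem_ball.1 hw))
  have hr0 : 0 < r := (le_max_left _ _).trans_lt hr1
  exact (((h r hr0 hr2).taylorSum hr0).1.differentiableAt
    (Metric.isOpen_ball.mem_nhds ((le_max_right _ _).trans_lt hr1))).differentiableWithinAt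

theorem isEntireGerm_of_forall_extendsToBall {f : ℂ → ℂ} {z : ℂ}
    (h : ∀ R > 0, ExtendsToBall f z R) : FuchsianODE.IsEntireGerm z f := by
  refine ⟨taylorSum f z, fun w => ?_, ((h 1 one_pos).taylorSum one_pos).2⟩
  have hr : 0 < dist w z + 1 := by positivity
  exact ((h _ hr).taylorSum hr).1.differentiableAt
    (Metric.isOpen_ball.mem_nhds (by simp))

theorem eqOn_of_convex {f g : ℂ → ℂ} {W : Set ℂ} (hWo : IsOpen W) (hW : Convex ℝ W)
    (hf : DifferentiableOn ℂ f W) (hg : DifferentiableOn ℂ g W) {z : ℂ} (hz : z ∈ W)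
    (h : f =ᶠ[𝓝 z] g) : Set.EqOn f g W :=
  (hf.analyticOnNhd hWo).eqOn_of_preconnected_of_eventuallyEq (hg.analyticOnNhd hWo)
    hW.isPreconnected hz h

/-- Moving the centre of the disc. -/
theorem ExtendsToBall.recenter {f : ℂ → ℂ} {z z' : ℂ} {δ R : ℝ} (h : ExtendsToBall f z' R)
    (hf : DifferentiableOn ℂ f (Metric.ball z δ)) (hz' : z' ∈ Metric.ball z δ)
    (hR : dist z z' < R) : ExtendsToBall f z (R - dist z z') := by
  obtain ⟨g, hg, hfg⟩ := h
  refine ⟨g, hg.mono (Metric.ball_subset_ball' (by linarith)), ?_⟩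
  have hz : z ∈ Metric.ball z δ := Metric.mem_ball_self (dist_nonneg.trans_lt hz')
  have hR0 : 0 < R := dist_nonneg.trans_lt hR
  have := eqOn_of_convex (Metric.isOpen_ball.inter Metric.isOpen_ball)
    ((convex_ball z δ).inter (convex_ball z' R)) (hf.mono Set.inter_subset_left)
    (hg.mono Set.inter_subset_right) ⟨hz', Metric.mem_ball_self hR0⟩ hfg
  exact this.eventuallyEq_of_mem
    ((Metric.isOpen_ball.inter Metric.isOpen_ball).mem_nhds ⟨hz, hR⟩)

theorem exists_mem_segment_inter_ball {p p' : ℂ} {ε ε' : ℝ} (hε : 0 < ε) (hε' : 0 < ε')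
    (h : dist p p' < ε + ε') :
    ∃ x ∈ segment ℝ p p', x ∈ Metric.ball p ε ∧ x ∈ Metric.ball p' ε' := by
  have hs : 0 < ε + ε' := by linarith
  have h1 : 1 - ε / (ε + ε') = ε' / (ε + ε') := by field_simp; ring
  refine ⟨AffineMap.lineMap p p' (ε / (ε + ε')), ?_, ?_, ?_⟩
  · rw [segment_eq_image_lineMap]
    exact ⟨_, ⟨by positivity, by rw [div_le_one hs]; linarith⟩, rfl⟩
  · rw [Metric.mem_ball, dist_lineMap_left, Real.norm_of_nonneg (by positivity), div_mul_eq_mul_div,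
      div_lt_iff₀ hs]
    exact mul_lt_mul_of_pos_left h hε
  · rw [Metric.mem_ball, dist_lineMap_right, h1, Real.norm_of_nonneg (by positivity),
      div_mul_eq_mul_div, div_lt_iff₀ hs]
    exact mul_lt_mul_of_pos_left h hε'

/-- A function holomorphic on a disc that extends across each boundary point extends to a larger
concentric disc. -/
theorem exists_extendsToBall_gt {f : ℂ → ℂ} {z : ℂ} {R : ℝ} (hR : 0 < R)
    (hf : DifferentiableOn ℂ f (Metric.ball z R))
    (h : ∀ p ∈ Metric.sphere z R, ExtendsWithin f (Metric.ball z R) p) :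
    ∃ R' > R, ExtendsToBall f z R' := by
  classical
  have h' : ∀ p ∈ Metric.sphere z R, ∃ ε > 0, ∃ g : ℂ → ℂ,
      DifferentiableOn ℂ g (Metric.ball p ε) ∧
      ∀ w ∈ Metric.ball p ε, w ∈ Metric.ball z R → f w = g w := by
    intro p hp
    obtain ⟨g, hg, hfg⟩ := h p hp
    obtain ⟨ε, hε, hball⟩ := Metric.eventually_nhds_iff_ball.1
      (hg.eventually_analyticAt.and (eventually_nhdsWithin_iff.1 hfg))
    exact ⟨ε, hε, g, fun w hw => (hball w hw).1.differentiableAt.differentiableWithinAt,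
      fun w hw => (hball w hw).2⟩
  choose! ε hε g hg hfg using h'
  have hagree : ∀ p ∈ Metric.sphere z R, ∀ p' ∈ Metric.sphere z R,
      ∀ w ∈ Metric.ball p (ε p) ∩ Metric.ball p' (ε p'), g p w = g p' w := by
    intro p hp p' hp' w hw
    have hd : dist p p' < ε p + ε p' := by
      refine (dist_triangle_left p p' w).trans_lt ?_
      exact add_lt_add hw.1 hw.2
    obtain ⟨x, hx, hx1, hx2⟩ := exists_mem_segment_inter_ball (hε p hp) (hε p' hp') hd
    have hxz : x ∈ closure (Metric.ball z R) := by
      rw [closure_ball z hR.ne']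
      exact (convex_closedBall z R).segment_subset (Metric.sphere_subset_closedBall hp)
        (Metric.sphere_subset_closedBall hp') hx
    have hWo : IsOpen (Metric.ball p (ε p) ∩ Metric.ball p' (ε p')) :=
      Metric.isOpen_ball.inter Metric.isOpen_ball
    obtain ⟨y, hy, hyz⟩ := mem_closure_iff.1 hxz _ hWo ⟨hx1, hx2⟩
    refine eqOn_of_convex hWo ((convex_ball _ _).inter (convex_ball _ _))
      ((hg p hp).mono Set.inter_subset_left) ((hg p' hp').mono Set.inter_subset_right) hy ?_ hw
    filter_upwards [hWo.mem_nhds hy, Metric.isOpen_ball.mem_nhds hyz] with v hv hvz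
    rw [← hfg p hp v hv.1 hvz, ← hfg p' hp' v hv.2 hvz]
  let F : ℂ → ℂ := fun w => if w ∈ Metric.ball z R then f w else
    if hw : ∃ p ∈ Metric.sphere z R, w ∈ Metric.ball p (ε p) then g hw.choose w else 0
  have hF1 : ∀ w ∈ Metric.ball z R, F w = f w := fun w hw => if_pos hw
  have hF2 : ∀ p ∈ Metric.sphere z R, ∀ w ∈ Metric.ball p (ε p), F w = g p w := by
    intro p hp w hw
    by_cases hwz : w ∈ Metric.ball z R
    · rw [hF1 w hwz, hfg p hp w hw hwz]
    · have hex : ∃ p ∈ Metric.sphere z R, w ∈ Metric.ball p (ε p) := ⟨p, hp, hw⟩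
      have : F w = g hex.choose w := by simp only [F]; rw [if_neg hwz, dif_pos hex]
      rw [this]
      exact hagree _ hex.choose_spec.1 p hp w ⟨hex.choose_spec.2, hw⟩
  let V : Set ℂ := Metric.ball z R ∪ ⋃ p ∈ Metric.sphere z R, Metric.ball p (ε p)
  have hVo : IsOpen V := Metric.isOpen_ball.union
    (isOpen_biUnion fun p _ => Metric.isOpen_ball)
  have hsub : Metric.closedBall z R ⊆ V := by
    intro w hw
    obtain hlt | heq := (Metric.mem_closedBall.1 hw).lt_or_eq
    · exact Or.inl hlt
    · exact Or.inr (Set.mem_biUnion (Metric.mem_sphere.2 heq)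
        (Metric.mem_ball_self (hε w heq)))
  have hFd : ∀ w ∈ V, DifferentiableAt ℂ F w := by
    rintro w (hw | hw)
    · exact (hf.differentiableAt (Metric.isOpen_ball.mem_nhds hw)).congr_of_eventuallyEq
        (Filter.eventuallyEq_of_mem (Metric.isOpen_ball.mem_nhds hw) hF1)
    · obtain ⟨p, hp, hw⟩ := Set.mem_iUnion₂.1 hw
      exact ((hg p hp).differentiableAt (Metric.isOpen_ball.mem_nhds hw)).congr_of_eventuallyEq
        (Filter.eventuallyEq_of_mem (Metric.isOpen_ball.mem_nhds hw) (hF2 p hp))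
  obtain ⟨δ, hδ, hthick⟩ := (isCompact_closedBall z R).exists_thickening_subset_open hVo hsub
  rw [thickening_closedBall hδ hR.le] at hthick
  refine ⟨δ + R, by linarith, F, fun w hw => (hFd w (hthick hw)).differentiableWithinAt, ?_⟩
  exact (Filter.eventuallyEq_of_mem (Metric.ball_mem_nhds z hR) hF1).symm

namespace FuchsianODE

/-! ### Solutions and their analytic continuation -/

variable {m : ℕ} {q : Fin m → RatFunc ℂ}

theorem finite_singularSet (q : Fin m → RatFunc ℂ) : (singularSet q).Finite := by
  have : singularSet q = ⋃ i, {t | ((q i).denom).eval t = 0} := by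
    ext t; simp [singularSet]
  rw [this]
  exact Set.finite_iUnion fun i =>
    Polynomial.finite_setOfPred_isRoot (p := (q i).denom) (q i).denom_ne_zero

theorem denom_eval_ne_zero {z : ℂ} (hz : z ∉ singularSet q) (i : Fin m) :
    ((q i).denom).eval z ≠ 0 := fun h => hz ⟨i, h⟩

theorem ratFunc_eval (r : RatFunc ℂ) (z : ℂ) :
    RatFunc.eval (RingHom.id ℂ) z r = r.num.eval z / r.denom.eval z := rfl

theorem analyticAt_polynomial_eval (p : Polynomial ℂ) (z : ℂ) :
    AnalyticAt ℂ (fun w => p.eval w) z :=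
  Differentiable.analyticAt p.differentiable z

theorem analyticAt_coeff {z : ℂ} (hz : z ∉ singularSet q) (i : Fin m) :
    AnalyticAt ℂ (fun w => RatFunc.eval (RingHom.id ℂ) w (q i)) z := by
  simp_rw [ratFunc_eval]
  exact (analyticAt_polynomial_eval _ z).div (analyticAt_polynomial_eval _ z)
    (denom_eval_ne_zero hz i)

/-- The differential equation multiplied by all denominators of its coefficients. -/
noncomputable def clearedEquation (q : Fin m → RatFunc ℂ) (f : ℂ → ℂ) (z : ℂ) : ℂ :=
  (∏ j, ((q j).denom).eval z) * iteratedDeriv m f z -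
    ∑ i : Fin m, (((q i).num).eval z * ∏ j ∈ Finset.univ.erase i, ((q j).denom).eval z) *
      iteratedDeriv (i : ℕ) f z

theorem clearedEquation_eq_zero_iff {f : ℂ → ℂ} {z : ℂ} (hz : z ∉ singularSet q) :
    clearedEquation q f z = 0 ↔ iteratedDeriv m f z =
      ∑ i : Fin m, RatFunc.eval (RingHom.id ℂ) z (q i) * iteratedDeriv (i : ℕ) f z := by
  have hD : ∏ j, ((q j).denom).eval z ≠ 0 :=
    Finset.prod_ne_zero_iff.2 fun j _ => denom_eval_ne_zero hz j
  have : clearedEquation q f z = (∏ j, ((q j).denom).eval z) * (iteratedDeriv m f z -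
      ∑ i : Fin m, RatFunc.eval (RingHom.id ℂ) z (q i) * iteratedDeriv (i : ℕ) f z) := by
    rw [clearedEquation, mul_sub, Finset.mul_sum]
    congr 1
    refine Finset.sum_congr rfl fun i _ => ?_
    rw [ratFunc_eval, ← Finset.mul_prod_erase _ _ (Finset.mem_univ i)]
    have := denom_eval_ne_zero hz i
    field_simp
  rw [this, mul_eq_zero, or_iff_right hD, sub_eq_zero]

theorem analyticAt_clearedEquation {f : ℂ → ℂ} {z : ℂ} (hf : AnalyticAt ℂ f z) :
    AnalyticAt ℂ (clearedEquation q f) z :=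
  ((Finset.analyticAt_fun_prod _ fun _ _ => analyticAt_polynomial_eval _ z).mul
    (hf.iteratedDeriv' m)).sub (Finset.analyticAt_fun_sum _ fun i _ =>
      ((analyticAt_polynomial_eval _ z).mul
        (Finset.analyticAt_fun_prod _ fun _ _ => analyticAt_polynomial_eval _ z)).mul
        (hf.iteratedDeriv' i))

theorem isSolutionNear_iff_eventually {f : ℂ → ℂ} {z : ℂ} : IsSolutionNear q z f ↔
    ∀ᶠ w in 𝓝 z, AnalyticAt ℂ f w ∧ iteratedDeriv m f w =
      ∑ i : Fin m, RatFunc.eval (RingHom.id ℂ) w (q i) * iteratedDeriv (i : ℕ) f w := by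
  rw [Metric.eventually_nhds_iff_ball]
  exact exists_congr fun ε => and_congr_right fun _ => forall₂_and.symm

theorem IsSolutionNear.congr {f g : ℂ → ℂ} {z : ℂ} (hf : IsSolutionNear q z f)
    (h : f =ᶠ[𝓝 z] g) : IsSolutionNear q z g := by
  rw [isSolutionNear_iff_eventually] at hf ⊢
  filter_upwards [hf, eventually_eventually_nhds.2 h] with w hw he
  have he : f =ᶠ[𝓝 w] g := he
  refine ⟨hw.1.congr he, ?_⟩
  rw [← he.iteratedDeriv_eq, hw.2]
  simp_rw [Filter.EventuallyEq.iteratedDeriv_eq _ he]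

theorem IsSolutionOn.isSolutionNear {W : Set ℂ} (hW : IsOpen W) {f : ℂ → ℂ}
    (hf : IsSolutionOn q W f) {z : ℂ} (hz : z ∈ W) : IsSolutionNear q z f :=
  isSolutionNear_iff_eventually.2 (by
    filter_upwards [hW.mem_nhds hz] with w hw using ⟨hf.1 w hw, hf.2 w hw⟩)

/-- Permanence of the differential equation under analytic continuation. -/
theorem IsSolutionNear.isSolutionOn {f : ℂ → ℂ} {W : Set ℂ} (hWo : IsOpen W)
    (hW : IsPreconnected W) (hf : DifferentiableOn ℂ f W) {z : ℂ} (hz : z ∈ W)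
    (hzS : z ∉ singularSet q) (h : IsSolutionNear q z f) :
    IsSolutionOn q (W \ singularSet q) f := by
  have ha := hf.analyticOnNhd hWo
  have h0 : Set.EqOn (clearedEquation q f) 0 W := by
    refine AnalyticOnNhd.eqOn_zero_of_preconnected_of_eventuallyEq_zero
      (fun w hw => analyticAt_clearedEquation (ha w hw)) hW hz ?_
    filter_upwards [isSolutionNear_iff_eventually.1 h,
      (finite_singularSet q).isClosed.isOpen_compl.mem_nhds hzS] with w hw hwS
    exact (clearedEquation_eq_zero_iff hwS).2 hw.2
  exact ⟨ha.mono Set.sdiff_subset, fun w hw => (clearedEquation_eq_zero_iff hw.2).1 (h0 hw.1)⟩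

theorem IsSolutionNear.sub_const_mul {f g : ℂ → ℂ} {z : ℂ} (hf : IsSolutionNear q z f) (c : ℂ)
    (hg : IsSolutionNear q z g) : IsSolutionNear q z fun w => f w - c * g w := by
  rw [isSolutionNear_iff_eventually] at hf hg ⊢
  filter_upwards [hf, hg] with w h1 h2
  refine ⟨h1.1.sub (analyticAt_const.mul h2.1), ?_⟩
  have : ∀ n, iteratedDeriv n (fun w => f w - c * g w) w =
      iteratedDeriv n f w - c * iteratedDeriv n g w := fun n => by
    have ha : AnalyticAt ℂ (fun w => c * g w) w := analyticAt_const.mul h2.1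
    rw [iteratedDeriv_fun_sub h1.1.contDiffAt ha.contDiffAt, iteratedDeriv_const_mul_field]
  simp_rw [this, h1.2, h2.2, mul_sub, Finset.sum_sub_distrib, Finset.mul_sum]
  congr 1
  exact Finset.sum_congr rfl fun i _ => by ring

/-! ### The companion system -/

/-- The linear map `Y ↦ (dᵢ Yᵢ + Yᵢ₊₁)ᵢ`, in which `Yₘ` stands for `∑ⱼ bⱼ Yⱼ`. -/
noncomputable def companion (d b : Fin m → ℂ) : (Fin m → ℂ) →L[ℂ] (Fin m → ℂ) :=
  ContinuousLinearMap.pi fun i => d i • ContinuousLinearMap.proj i +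
    if h : (i : ℕ) + 1 < m then ContinuousLinearMap.proj (⟨i + 1, h⟩ : Fin m)
    else ∑ j, b j • ContinuousLinearMap.proj j

theorem companion_apply (d b Y : Fin m → ℂ) (i : Fin m) :
    companion d b Y i = d i * Y i +
      if h : (i : ℕ) + 1 < m then Y ⟨i + 1, h⟩ else ∑ j, b j * Y j := by
  unfold companion
  split_ifs with h <;> simp [h]

theorem norm_companion_le (d b : Fin m → ℂ) : ‖companion d b‖ ≤ ‖d‖ + (1 + ∑ j, ‖b j‖) := by
  have h0 : 0 ≤ ∑ j, ‖b j‖ := Finset.sum_nonneg fun _ _ => norm_nonneg _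
  refine ContinuousLinearMap.opNorm_le_bound _ (by positivity) fun Y => ?_
  refine (pi_norm_le_iff_of_nonneg (by positivity)).2 fun i => ?_
  rw [companion_apply, add_mul]
  refine (norm_add_le _ _).trans (add_le_add ?_ ?_)
  · rw [norm_mul]
    exact mul_le_mul (norm_le_pi_norm d i) (norm_le_pi_norm Y i) (norm_nonneg _) (norm_nonneg _)
  · split_ifs with h
    · exact (norm_le_pi_norm Y _).trans (le_mul_of_one_le_left (norm_nonneg _) (by linarith))
    · refine (norm_sum_le _ _).trans ?_
      calc ∑ j, ‖b j * Y j‖ ≤ ∑ j, ‖b j‖ * ‖Y‖ := by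
            gcongr with j
            rw [norm_mul]
            gcongr
            exact norm_le_pi_norm Y j
        _ = (∑ j, ‖b j‖) * ‖Y‖ := by rw [Finset.sum_mul]
        _ ≤ _ := by gcongr; linarith

theorem differentiableOn_companion (d : Fin m → ℂ) {b : ℂ → Fin m → ℂ} {W : Set ℂ}
    (hb : ∀ j, DifferentiableOn ℂ (fun x => b x j) W) :
    DifferentiableOn ℂ (fun x => companion d (b x)) W := by
  let u : Fin m → (Fin m → ℂ) →L[ℂ] (Fin m → ℂ) := fun j => ContinuousLinearMap.pi fun i =>
    if (i : ℕ) + 1 < m then 0 else ContinuousLinearMap.proj j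
  have h : (fun x => companion d (b x)) = fun x => companion d 0 + ∑ j, b x j • u j := by
    funext x
    ext1 Y
    funext i
    rw [companion_apply, add_apply, Pi.add_apply, companion_apply,
      sum_apply, Finset.sum_apply]
    by_cases hi : (i : ℕ) + 1 < m <;> simp [hi, u]
  rw [h]
  exact (differentiableOn_const _).add
    (DifferentiableOn.fun_sum fun j _ => (hb j).smul_const (u j))

/-- The vector of derivatives of order `< m`. -/
noncomputable def jet (m : ℕ) (y : ℂ → ℂ) (z : ℂ) : Fin m → ℂ := fun i => iteratedDeriv i y z

theorem hasDerivAt_iteratedDeriv {y : ℂ → ℂ} {z : ℂ} (hy : AnalyticAt ℂ y z) (n : ℕ) :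
    HasDerivAt (iteratedDeriv n y) (iteratedDeriv (n + 1) y z) z := by
  rw [iteratedDeriv_succ]
  exact (hy.iteratedDeriv' n).differentiableAt.hasDerivAt

theorem IsSolutionOn.hasDerivAt_jet {W : Set ℂ} {y : ℂ → ℂ} (hy : IsSolutionOn q W y) {z : ℂ}
    (hz : z ∈ W) : HasDerivAt (jet m y)
      (companion 0 (fun j => RatFunc.eval (RingHom.id ℂ) z (q j)) (jet m y z)) z := by
  rw [hasDerivAt_pi]
  intro i
  have h := hasDerivAt_iteratedDeriv (hy.1 z hz) i
  refine h.congr_deriv (Eq.symm ?_)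
  rw [companion_apply, Pi.zero_apply, zero_mul, zero_add]
  split_ifs with hi
  · rfl
  · rw [show (i : ℕ) + 1 = m by omega, hy.2 z hz]
    rfl

/-- The derivatives of `y` of order `< m` in the logarithmic coordinate `x`, with `z = t + eˣ`,
scaled so that a regular singular point at `t` or at `∞` turns into a system with bounded
coefficients. -/
noncomputable def scaledJet (m : ℕ) (t : ℂ) (y : ℂ → ℂ) (x : ℂ) : Fin m → ℂ :=
  fun i => Complex.exp x ^ (i : ℕ) * iteratedDeriv i y (t + Complex.exp x)

/-- The coefficients of the equation in the logarithmic coordinate. -/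
noncomputable def scaledCoeff (q : Fin m → RatFunc ℂ) (t x : ℂ) (j : Fin m) : ℂ :=
  Complex.exp x ^ (m - (j : ℕ)) * RatFunc.eval (RingHom.id ℂ) (t + Complex.exp x) (q j)

/-- The system satisfied by scaled jets of solutions. -/
noncomputable def scaledSystem (q : Fin m → RatFunc ℂ) (t x : ℂ) :
    (Fin m → ℂ) →L[ℂ] (Fin m → ℂ) :=
  companion (fun i => ((i : ℕ) : ℂ)) (scaledCoeff q t x)

theorem hasDerivAt_exp_pow (n : ℕ) (x : ℂ) :
    HasDerivAt (fun x => Complex.exp x ^ n) (n * Complex.exp x ^ n) x := by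
  have h : (fun x => Complex.exp x ^ n) = fun x => Complex.exp (n * x) := by
    funext x; rw [Complex.exp_nat_mul]
  rw [h, ← Complex.exp_nat_mul, mul_comm]
  simpa using ((hasDerivAt_id x).const_mul (n : ℂ)).cexp

theorem IsSolutionOn.hasDerivAt_scaledJet {W : Set ℂ} {y : ℂ → ℂ} (hy : IsSolutionOn q W y)
    {t x : ℂ} (hx : t + Complex.exp x ∈ W) :
    HasDerivAt (scaledJet m t y) (scaledSystem q t x (scaledJet m t y x)) x := by
  rw [hasDerivAt_pi]
  intro i
  have h1 : HasDerivAt (fun x => t + Complex.exp x) (Complex.exp x) x :=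
    (Complex.hasDerivAt_exp x).const_add t
  have h := (hasDerivAt_exp_pow i x).mul
    ((hasDerivAt_iteratedDeriv (hy.1 _ hx) i).comp x h1)
  refine h.congr_deriv (Eq.symm ?_)
  rw [scaledSystem, companion_apply]
  congr 1
  · simp only [scaledJet, Function.comp]; ring
  · have h2 : ∀ a : ℂ, Complex.exp x ^ (i : ℕ) * (a * Complex.exp x) =
        Complex.exp x ^ ((i : ℕ) + 1) * a := fun a => by ring
    rw [h2]
    split_ifs with hi
    · rfl
    · rw [show (i : ℕ) + 1 = m by omega, hy.2 _ hx, Finset.mul_sum]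
      refine Finset.sum_congr rfl fun j _ => ?_
      simp only [scaledCoeff, scaledJet]
      have : Complex.exp x ^ m = Complex.exp x ^ (m - (j : ℕ)) * Complex.exp x ^ (j : ℕ) := by
        rw [← pow_add, Nat.sub_add_cancel j.2.le]
      rw [this]
      ring

theorem exists_norm_scaledSystem_le {t : ℂ} {X : Set ℂ} {C : ℝ}
    (h : ∀ x ∈ X, ∀ j, ‖scaledCoeff q t x j‖ ≤ C) :
    ∃ D : ℝ, 0 ≤ D ∧ ∀ x ∈ X, ‖scaledSystem q t x‖ ≤ D := by
  refine ⟨‖fun i : Fin m => ((i : ℕ) : ℂ)‖ + (1 + ∑ _j : Fin m, |C|), by positivity,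
    fun x hx => (norm_companion_le _ _).trans ?_⟩
  gcongr with j
  exact (h x hx j).trans (le_abs_self C)

theorem differentiableOn_scaledSystem {t : ℂ} {X : Set ℂ}
    (h : ∀ x ∈ X, t + Complex.exp x ∉ singularSet q) :
    DifferentiableOn ℂ (scaledSystem q t) X := by
  refine differentiableOn_companion _ fun j x hx => ?_
  have h1 := (analyticAt_coeff (h x hx) j).differentiableAt.comp (𝕜 := ℂ) x
    ((Complex.differentiableAt_exp (x := x)).const_add t)
  exact ((Complex.differentiableAt_exp.pow _).mul h1).differentiableWithinAt

/-! ### Ordinary points -/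

theorem exists_ball_bounded_coeff {p : ℂ} (hp : p ∉ singularSet q) :
    ∃ ε > 0, ∃ C : ℝ, 0 ≤ C ∧ ∀ w ∈ Metric.ball p ε, w ∉ singularSet q ∧
      ‖companion 0 (fun j => RatFunc.eval (RingHom.id ℂ) w (q j))‖ ≤ C := by
  have h1 := (finite_singularSet q).isClosed.isOpen_compl.mem_nhds hp
  have h2 : ∀ᶠ w in 𝓝 p, ∀ j, ‖RatFunc.eval (RingHom.id ℂ) w (q j)‖ <
      ‖RatFunc.eval (RingHom.id ℂ) p (q j)‖ + 1 :=
    eventually_all.2 fun j =>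
      (analyticAt_coeff hp j).continuousAt.norm.eventually_lt_const (lt_add_one _)
  obtain ⟨ε, hε, hball⟩ := Metric.eventually_nhds_iff_ball.1 (Filter.Eventually.and h1 h2)
  refine ⟨ε, hε, ‖(0 : Fin m → ℂ)‖ + (1 + ∑ j, (‖RatFunc.eval (RingHom.id ℂ) p (q j)‖ + 1)),
    by positivity, fun w hw => ⟨(hball w hw).1, (norm_companion_le _ _).trans ?_⟩⟩
  gcongr with j
  exact ((hball w hw).2 j).le

/-- Solutions extend across ordinary points. -/
theorem extendsWithin_of_notMem (hm : 0 < m) {f : ℂ → ℂ} {z : ℂ} {R : ℝ} (hR : 0 < R)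
    (hz : z ∉ singularSet q) (hf : DifferentiableOn ℂ f (Metric.ball z R))
    (hsol : IsSolutionNear q z f) {p : ℂ} (hp : p ∉ singularSet q) :
    ExtendsWithin f (Metric.ball z R) p := by
  have hs := hsol.isSolutionOn Metric.isOpen_ball (convex_ball z R).isPreconnected hf
    (Metric.mem_ball_self hR) hz
  obtain ⟨ε, hε, C, hC, hball⟩ := exists_ball_bounded_coeff hp
  obtain ⟨Z, hZ, hYZ⟩ := LinearODE.exists_extension (convex_ball p ε) Metric.isOpen_ball hC
    (fun w hw => (hball w hw).2)
    (differentiableOn_companion 0 fun j w hw =>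
      (analyticAt_coeff (hball w hw).1 j).differentiableAt.differentiableWithinAt)
    (Set.inter_subset_left (t := Metric.ball z R)) ((convex_ball p ε).inter (convex_ball z R))
    (Y := jet m f) (fun w hw => hs.hasDerivAt_jet ⟨hw.2, (hball w hw.1).1⟩)
  refine ⟨fun w => Z w ⟨0, hm⟩, ?_, ?_⟩
  · have : DifferentiableOn ℂ (fun w => Z w ⟨0, hm⟩) (Metric.ball p ε) := fun w hw =>
      ((hasDerivAt_pi.1 (hZ w hw)) ⟨0, hm⟩).differentiableAt.differentiableWithinAt
    exact this.analyticOnNhd Metric.isOpen_ball p (Metric.mem_ball_self hε)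
  · filter_upwards [self_mem_nhdsWithin, mem_nhdsWithin_of_mem_nhds (Metric.ball_mem_nhds p hε)]
      with w hw hwp
    rw [← hYZ ⟨hwp, hw⟩]
    simp [jet]

theorem IsSolutionNear.exists_extendsToBall {f : ℂ → ℂ} {z : ℂ} (h : IsSolutionNear q z f) :
    ∃ R > 0, ExtendsToBall f z R := by
  obtain ⟨ε, hε, hf⟩ := h
  exact ⟨ε, hε, f, fun w hw => (hf.1 w hw).differentiableAt.differentiableWithinAt, by rfl⟩

/-- The obstruction to extending a solution to the whole plane is a singular point: the radius of
convergence of the Taylor series of a solution is the distance to a point of `S`. -/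
theorem exists_singular_of_not_entire (hm : 0 < m) {f : ℂ → ℂ} {z : ℂ} (hz : z ∉ singularSet q)
    (hsol : IsSolutionNear q z f) (hf : ¬ IsEntireGerm z f) :
    ∃ t ∈ singularSet q, ExtendsToBall f z (dist z t) ∧
      ∀ R > dist z t, ¬ ExtendsToBall f z R := by
  obtain ⟨R₁, hR₁, hne⟩ : ∃ R₁ > 0, ¬ ExtendsToBall f z R₁ := by
    by_contra! h
    exact hf (isEntireGerm_of_forall_extendsToBall h)
  obtain ⟨R₀, hR₀, h₀⟩ := hsol.exists_extendsToBall
  let A : Set ℝ := {R | ExtendsToBall f z R}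
  have hbdd : BddAbove A := ⟨R₁, fun R hR => le_of_not_gt fun hlt => hne (hR.mono hlt.le)⟩
  have hpos : 0 < sSup A := hR₀.trans_le (le_csSup hbdd h₀)
  have hA : ExtendsToBall f z (sSup A) := ExtendsToBall.of_forall_lt hpos fun r _ hr => by
    obtain ⟨R, hR, hrR⟩ := exists_lt_of_lt_csSup ⟨R₀, h₀⟩ hr
    exact ExtendsToBall.mono hR hrR.le
  have hmax : ∀ R > sSup A, ¬ ExtendsToBall f z R := fun R hR h =>
    (le_csSup hbdd (show R ∈ A from h)).not_gt hR
  obtain ⟨g, hg, hfg⟩ := id hA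
  have hgext : ¬ ∀ p ∈ Metric.sphere z (sSup A), ExtendsWithin g (Metric.ball z (sSup A)) p := by
    intro h
    obtain ⟨R', hR', G, hG, hgG⟩ := exists_extendsToBall_gt hpos hg h
    exact hmax R' hR' ⟨G, hG, hfg.trans hgG⟩
  push Not at hgext
  obtain ⟨p, hp, hpext⟩ := hgext
  have hpS : p ∈ singularSet q := by
    by_contra hpS
    exact hpext (extendsWithin_of_notMem hm hpos hz hg (hsol.congr hfg) hpS)
  have hd : dist z p = sSup A := by rw [dist_comm]; exact hp
  exact ⟨p, hpS, by rwa [hd], by rwa [hd]⟩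

/-- A solution extends until the next singular point. -/
theorem ExtendsToBall.of_gap (hm : 0 < m) {f : ℂ → ℂ} {z : ℂ} (hz : z ∉ singularSet q)
    (hsol : IsSolutionNear q z f) {R R' : ℝ} (hf : ∀ r < R, ExtendsToBall f z r)
    (hgap : ∀ t ∈ singularSet q, R ≤ dist z t → R' ≤ dist z t) : ExtendsToBall f z R' := by
  by_contra hR'
  have hne : ¬ IsEntireGerm z f := fun ⟨g, hg, hfg⟩ => hR' ⟨g, hg.differentiableOn, hfg⟩
  obtain ⟨t, ht, h1, h2⟩ := exists_singular_of_not_entire hm hz hsol hne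
  have h3 : R ≤ dist z t := by
    by_contra! hlt
    obtain ⟨r, hr1, hr2⟩ := exists_between hlt
    exact h2 r hr1 (hf r hr2)
  exact hR' (h1.mono (hgap t ht h3))

end FuchsianODE

/-! ### Functions of a logarithmic coordinate -/

/-- The half-plane covering a punctured disc of radius `r` under the exponential map. -/
def logHalfPlane (r : ℝ) : Set ℂ := {x | x.re < Real.log r}

theorem isOpen_logHalfPlane (r : ℝ) : IsOpen (logHalfPlane r) :=
  isOpen_lt Complex.continuous_re continuous_const

theorem convex_logHalfPlane (r : ℝ) : Convex ℝ (logHalfPlane r) :=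
  convex_halfSpace_re_lt _

theorem mem_logHalfPlane {r : ℝ} (hr : 0 < r) {x : ℂ} :
    x ∈ logHalfPlane r ↔ ‖Complex.exp x‖ < r := by
  rw [Complex.norm_exp]
  exact Real.lt_log_iff_exp_lt hr

theorem log_mem_logHalfPlane {r : ℝ} (hr : 0 < r) {w : ℂ} (hw : w ≠ 0) (hwr : ‖w‖ < r) :
    Complex.log w ∈ logHalfPlane r := by
  rwa [mem_logHalfPlane hr, Complex.exp_log hw]

theorem add_two_pi_mem_logHalfPlane {r : ℝ} {x : ℂ} :
    x + 2 * Real.pi * Complex.I ∈ logHalfPlane r ↔ x ∈ logHalfPlane r := by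
  simp [logHalfPlane]

theorem periodic_eq_of_exp_eq {r : ℝ} (hr : 0 < r) {Ψ : ℂ → ℂ}
    (hper : ∀ x ∈ logHalfPlane r, Ψ (x + 2 * Real.pi * Complex.I) = Ψ x) {x y : ℂ}
    (hx : x ∈ logHalfPlane r) (h : Complex.exp x = Complex.exp y) : Ψ x = Ψ y := by
  have hnat : ∀ n : ℕ, ∀ x ∈ logHalfPlane r, Ψ (x + n * (2 * Real.pi * Complex.I)) = Ψ x := by
    intro n
    induction n with
    | zero => simp
    | succ n ih =>
      intro x hx
      have h1 : x + (n + 1 : ℕ) * (2 * Real.pi * Complex.I) =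
          (x + 2 * Real.pi * Complex.I) + n * (2 * Real.pi * Complex.I) := by push_cast; ring
      rw [h1, ih _ (add_two_pi_mem_logHalfPlane.2 hx), hper x hx]
  have hy : y ∈ logHalfPlane r := by rwa [mem_logHalfPlane hr, ← h, ← mem_logHalfPlane hr]
  obtain ⟨n, hn⟩ := Complex.exp_eq_exp_iff_exists_int.1 h
  obtain ⟨k, rfl | rfl⟩ := n.eq_nat_or_neg
  · rw [hn]
    exact_mod_cast hnat k y hy
  · have h2 : y = x + k * (2 * Real.pi * Complex.I) := by
      rw [hn]; push_cast; ring
    rw [h2, hnat k x hx]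

/-- A periodic holomorphic function on a left half-plane, growing at most exponentially on a
horizontal strip, is a Laurent series in `exp x` with finitely many negative powers. -/
theorem exists_meromorphic_of_periodic {r : ℝ} (hr : 0 < r) (hr1 : r ≤ 1) {Ψ : ℂ → ℂ}
    (hΨ : DifferentiableOn ℂ Ψ (logHalfPlane r))
    (hper : ∀ x ∈ logHalfPlane r, Ψ (x + 2 * Real.pi * Complex.I) = Ψ x) {K A : ℝ} (hK : 0 ≤ K)
    (hA : 0 ≤ A)
    (hbd : ∀ x ∈ logHalfPlane r, |x.im| ≤ Real.pi → ‖Ψ x‖ ≤ K * Real.exp (A * ‖x‖)) :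
    ∃ P : ℕ, ∃ h : ℂ → ℂ, DifferentiableOn ℂ h (Metric.ball 0 r) ∧
      ∀ x ∈ logHalfPlane r, Ψ x = (Complex.exp x ^ P)⁻¹ * h (Complex.exp x) := by
  obtain ⟨P, hP⟩ := exists_nat_ge A
  let η : ℂ → ℂ := fun w => w ^ P * Ψ (Complex.log w)
  have hlog : ∀ w ∈ Metric.ball (0 : ℂ) r \ {0}, Complex.log w ∈ logHalfPlane r := fun w hw =>
    log_mem_logHalfPlane hr hw.2 (by simpa using hw.1)
  have hd : DifferentiableOn ℂ η (Metric.ball 0 r \ {0}) := by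
    intro w hw
    have hw0 : w ≠ 0 := hw.2
    have hwr : ‖w‖ < r := by simpa using hw.1
    refine DifferentiableAt.differentiableWithinAt (.mul (by fun_prop) ?_)
    by_cases hws : w ∈ Complex.slitPlane
    · exact (hΨ.differentiableAt ((isOpen_logHalfPlane r).mem_nhds (hlog w hw))).comp w
        (Complex.differentiableAt_log hws)
    · -- near the branch cut, use the branch `log (-w) + πi` of the logarithm
      have hwn : -w ∈ Complex.slitPlane := by
        rw [Complex.mem_slitPlane_iff] at hws ⊢
        push Not at hws
        simp only [Complex.neg_re, Complex.neg_im, neg_ne_zero]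
        left
        have : w.re ≠ 0 := fun h => hw0 (Complex.ext h hws.2)
        have := lt_of_le_of_ne hws.1 this
        linarith
      have hexp : ∀ w : ℂ, w ≠ 0 →
          Complex.exp (Complex.log (-w) + Real.pi * Complex.I) = w := fun w hw => by
        rw [Complex.exp_add, Complex.exp_log (neg_ne_zero.2 hw), Complex.exp_pi_mul_I]; ring
      have hmem : Complex.log (-w) + Real.pi * Complex.I ∈ logHalfPlane r := by
        rwa [mem_logHalfPlane hr, hexp w hw0]
      have hdn : DifferentiableAt ℂ (fun w => Ψ (Complex.log (-w) + Real.pi * Complex.I)) w := by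
        refine DifferentiableAt.comp (g := Ψ) w
          (hΨ.differentiableAt ((isOpen_logHalfPlane r).mem_nhds hmem)) ?_
        exact (DifferentiableAt.clog (by fun_prop) hwn).add_const _
      refine hdn.congr_of_eventuallyEq ?_
      have hnhds : Metric.ball (0 : ℂ) r \ {0} ∈ 𝓝 w :=
        (Metric.isOpen_ball.sdiff isClosed_singleton).mem_nhds hw
      filter_upwards [hnhds] with v hv
      exact periodic_eq_of_exp_eq hr hper (hlog v hv)
        (by rw [hexp v hv.2, Complex.exp_log hv.2])
  have hb : BddAbove (norm ∘ η '' (Metric.ball 0 r \ {0})) := by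
    refine ⟨K * Real.exp (A * Real.pi), ?_⟩
    rintro _ ⟨w, hw, rfl⟩
    have hw0 : 0 < ‖w‖ := norm_pos_iff.2 hw.2
    have hwr : ‖w‖ < r := by simpa using hw.1
    have hl : Real.log ‖w‖ ≤ 0 := Real.log_nonpos hw0.le (hwr.le.trans hr1)
    have h1 := hbd _ (hlog w hw) (by rw [Complex.log_im]; exact Complex.abs_arg_le_pi w)
    have h2 : ‖Complex.log w‖ ≤ -Real.log ‖w‖ + Real.pi := by
      refine (Complex.norm_le_abs_re_add_abs_im _).trans ?_
      rw [Complex.log_re, Complex.log_im, abs_of_nonpos hl]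
      gcongr
      exact Complex.abs_arg_le_pi w
    have h3 : ‖w‖ ^ P = Real.exp (P * Real.log ‖w‖) := by
      rw [Real.exp_nat_mul, Real.exp_log hw0]
    simp only [Function.comp, η]
    rw [norm_mul, norm_pow, h3]
    calc Real.exp (P * Real.log ‖w‖) * ‖Ψ (Complex.log w)‖
        ≤ Real.exp (P * Real.log ‖w‖) * (K * Real.exp (A * (-Real.log ‖w‖ + Real.pi))) := by
          gcongr
          exact h1.trans (by gcongr)
      _ = K * Real.exp ((P - A) * Real.log ‖w‖ + A * Real.pi) := by
          rw [mul_left_comm, ← Real.exp_add]; congr 2; ring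
      _ ≤ _ := by
          gcongr
          nlinarith
  have hball : Metric.ball (0 : ℂ) r ∈ 𝓝 0 := Metric.ball_mem_nhds 0 hr
  refine ⟨P, _, Complex.differentiableOn_update_limUnder_of_bddAbove hball hd hb, fun x hx => ?_⟩
  have he := Complex.exp_ne_zero x
  rw [Function.update_of_ne he]
  simp only [η]
  rw [periodic_eq_of_exp_eq hr hper hx (Complex.exp_log he).symm,
    inv_mul_cancel_left₀ (pow_ne_zero _ he)]

/-- A holomorphic function on a left half-plane of at most exponential growth, which the
translation by `2πi` multiplies by a constant up to adding a holomorphic function of `exp x`, is of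
the form `exp (μ x) h (exp x) + x g (exp x) + k (exp x)`; here either `μ` is not an integer and
there is no logarithmic term, or `-μ` is a natural number. -/
theorem exists_form_of_monodromy {r : ℝ} (hr : 0 < r) (hr1 : r ≤ 1) {Φ G : ℂ → ℂ} {α : ℂ}
    (hΦ : DifferentiableOn ℂ Φ (logHalfPlane r)) (hG : DifferentiableOn ℂ G (Metric.ball 0 r))
    (hmon : ∀ x ∈ logHalfPlane r,
      Φ (x + 2 * Real.pi * Complex.I) = α * Φ x + G (Complex.exp x)) {K A : ℝ} (hA : 0 ≤ A)
    (hbd : ∀ x ∈ logHalfPlane r, ‖Φ x‖ ≤ K * Real.exp (A * ‖x‖)) :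
    ∃ μ : ℂ, ∃ h g k : ℂ → ℂ, DifferentiableOn ℂ h (Metric.ball 0 r) ∧
      DifferentiableOn ℂ g (Metric.ball 0 r) ∧ DifferentiableOn ℂ k (Metric.ball 0 r) ∧
      (((∀ n : ℤ, μ ≠ n) ∧ g = 0) ∨ ∃ P : ℕ, μ = -P) ∧
      ∀ x ∈ logHalfPlane r, Φ x =
        Complex.exp (μ * x) * h (Complex.exp x) + x * g (Complex.exp x) + k (Complex.exp x) := by
  have hTne : (2 * Real.pi * Complex.I : ℂ) ≠ 0 := by
    simp [Real.pi_ne_zero]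
  have hmem : ∀ x ∈ logHalfPlane r, Complex.exp x ∈ Metric.ball (0 : ℂ) r := fun x hx => by
    simpa using (mem_logHalfPlane hr).1 hx
  have hexpT : ∀ x : ℂ, Complex.exp (x + 2 * Real.pi * Complex.I) = Complex.exp x := fun x => by
    rw [Complex.exp_add, Complex.exp_two_pi_mul_I, mul_one]
  have hGe : DifferentiableOn ℂ (fun x => G (Complex.exp x)) (logHalfPlane r) :=
    hG.comp Complex.differentiable_exp.differentiableOn hmem
  have hK : 0 ≤ K := by
    have hx : (⟨Real.log r - 1, 0⟩ : ℂ) ∈ logHalfPlane r := by simp [logHalfPlane]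
    exact nonneg_of_mul_nonneg_left ((norm_nonneg _).trans (hbd _ hx)) (Real.exp_pos _)
  -- the inhomogeneous term grows at most exponentially because `Φ` does
  let T : ℝ := ‖(2 * Real.pi * Complex.I : ℂ)‖
  have hGbd : ∀ x ∈ logHalfPlane r,
      ‖G (Complex.exp x)‖ ≤ (K * Real.exp (A * T) + ‖α‖ * K) * Real.exp (A * ‖x‖) := by
    intro x hx
    have h1 : G (Complex.exp x) = Φ (x + 2 * Real.pi * Complex.I) - α * Φ x := by
      rw [hmon x hx]; ring
    have h2 := hbd _ (add_two_pi_mem_logHalfPlane.2 hx)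
    have h3 : K * Real.exp (A * ‖x + 2 * Real.pi * Complex.I‖) ≤
        K * Real.exp (A * T) * Real.exp (A * ‖x‖) := by
      rw [mul_assoc K, ← Real.exp_add, ← mul_add, add_comm T]
      gcongr
      exact norm_add_le _ _
    rw [h1]
    refine (norm_sub_le _ _).trans ?_
    rw [norm_mul, add_mul, mul_assoc ‖α‖]
    exact add_le_add (h2.trans h3) (by gcongr; exact hbd x hx)
  set K' : ℝ := K * Real.exp (A * T) + ‖α‖ * K with hK'
  have hK'0 : 0 ≤ K' := by positivity
  -- if `α = 0`, then `Φ` is itself a function of `exp x`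
  by_cases hα0 : α = 0
  · refine ⟨0, 0, 0, G, differentiableOn_const _, differentiableOn_const _, hG, Or.inr ⟨0, by simp⟩,
      fun x hx => ?_⟩
    have hx' : x - 2 * Real.pi * Complex.I ∈ logHalfPlane r := by
      rw [← add_two_pi_mem_logHalfPlane, sub_add_cancel]; exact hx
    have := hmon _ hx'
    rw [sub_add_cancel, hα0, ← hexpT, sub_add_cancel] at this
    simpa using this
  -- if `α = 1`, subtracting a multiple of `x G (exp x)` makes `Φ` periodic
  by_cases hα1 : α = 1
  · let Ψ : ℂ → ℂ := fun x => Φ x - x * G (Complex.exp x) / (2 * Real.pi * Complex.I)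
    obtain ⟨P, h, hh, hΨh⟩ := exists_meromorphic_of_periodic hr hr1 (Ψ := Ψ)
      (hΦ.sub ((differentiableOn_id.mul hGe).div_const _)) (fun x hx => by
        simp only [Ψ]
        rw [hmon x hx, hexpT, hα1]
        field_simp
        ring) (K := K + K' / T) (A := A + 1) (by positivity) (by positivity) (fun x hx _ => by
        have h1 : ‖x‖ ≤ Real.exp ‖x‖ := by
          have := Real.add_one_le_exp ‖x‖
          linarith
        have h2 : Real.exp ((A + 1) * ‖x‖) = Real.exp (A * ‖x‖) * Real.exp ‖x‖ := by
          rw [← Real.exp_add]; ring_nf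
        have h3 : (1 : ℝ) ≤ Real.exp ‖x‖ := Real.one_le_exp (norm_nonneg _)
        have hT : 0 < T := norm_pos_iff.2 hTne
        refine (norm_sub_le _ _).trans ?_
        rw [norm_div, norm_mul, add_mul, h2]
        refine add_le_add ?_ ?_
        · calc ‖Φ x‖ ≤ K * Real.exp (A * ‖x‖) * 1 := by rw [mul_one]; exact hbd x hx
            _ ≤ K * Real.exp (A * ‖x‖) * Real.exp ‖x‖ := by gcongr
            _ = _ := by ring
        · calc ‖x‖ * ‖G (Complex.exp x)‖ / T ≤ Real.exp ‖x‖ * (K' * Real.exp (A * ‖x‖)) / T := by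
                gcongr
                exact hGbd x hx
            _ = _ := by ring)
    refine ⟨-P, h, fun w => G w / (2 * Real.pi * Complex.I), 0, hh, hG.div_const _,
      differentiableOn_const _, Or.inr ⟨P, rfl⟩, fun x hx => ?_⟩
    have h1 : Φ x = Ψ x + x * (G (Complex.exp x) / (2 * Real.pi * Complex.I)) := by
      simp only [Ψ]; ring
    rw [h1, hΨh x hx, neg_mul, Complex.exp_neg, Complex.exp_nat_mul]
    simp
  · -- otherwise adding `G (exp x) / (α - 1)` makes `Φ` an eigenfunction of the translation
    have hα1' : α - 1 ≠ 0 := sub_ne_zero.2 hα1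
    let μ : ℂ := Complex.log α / (2 * Real.pi * Complex.I)
    have hμ : Complex.exp (μ * (2 * Real.pi * Complex.I)) = α := by
      rw [div_mul_cancel₀ _ hTne, Complex.exp_log hα0]
    have hμn : ∀ n : ℤ, μ ≠ n := fun n hn => hα1 (by
      rw [← hμ, hn, Complex.exp_int_mul_two_pi_mul_I])
    let Ψ : ℂ → ℂ := fun x => Complex.exp (-(μ * x)) * (Φ x + G (Complex.exp x) / (α - 1))
    obtain ⟨P, h, hh, hΨh⟩ := exists_meromorphic_of_periodic hr hr1 (Ψ := Ψ)
      (DifferentiableOn.mul (by fun_prop) (hΦ.add (hGe.div_const _))) (fun x hx => by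
        simp only [Ψ]
        rw [hmon x hx, hexpT, mul_add μ, neg_add, Complex.exp_add,
          Complex.exp_neg (μ * (2 * Real.pi * Complex.I)), hμ]
        field_simp
        ring) (K := K + K' / ‖α - 1‖) (A := ‖μ‖ + A) (by positivity) (by positivity)
        (fun x hx _ => by
        have h1 : ‖Complex.exp (-(μ * x))‖ ≤ Real.exp (‖μ‖ * ‖x‖) := by
          refine (Complex.norm_exp_le_exp_norm _).trans_eq ?_
          rw [norm_neg, norm_mul]
        have h2 : ‖Φ x + G (Complex.exp x) / (α - 1)‖ ≤
            (K + K' / ‖α - 1‖) * Real.exp (A * ‖x‖) := by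
          refine (norm_add_le _ _).trans ?_
          rw [norm_div, add_mul, div_mul_eq_mul_div]
          exact add_le_add (hbd x hx) (by gcongr; exact hGbd x hx)
        calc ‖Ψ x‖ ≤ Real.exp (‖μ‖ * ‖x‖) * ((K + K' / ‖α - 1‖) * Real.exp (A * ‖x‖)) := by
              simp only [Ψ]
              rw [norm_mul]
              gcongr
          _ = _ := by rw [add_mul ‖μ‖, Real.exp_add]; ring)
    refine ⟨μ - P, h, 0, fun w => -(G w / (α - 1)), hh, differentiableOn_const _,
      (hG.div_const _).neg, Or.inl ⟨fun n hn => hμn (n + P) ?_, rfl⟩, fun x hx => ?_⟩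
    · push_cast
      rw [← hn]; ring
    · have h1 : Φ x = Complex.exp (μ * x) * Ψ x - G (Complex.exp x) / (α - 1) := by
        simp only [Ψ]
        rw [← mul_assoc, ← Complex.exp_add, add_neg_cancel, Complex.exp_zero]
        ring
      rw [h1, hΨh x hx, sub_mul, sub_eq_add_neg (μ * x), Complex.exp_add, Complex.exp_neg,
        Complex.exp_nat_mul]
      simp
      ring

namespace FuchsianODE

variable {m : ℕ} {q : Fin m → RatFunc ℂ}

/-! ### Solutions near a regular singular point -/

theorem eventually_bounded_mul_coeff (hreg : IsRegularAtFinite q) (t : ℂ) (i : Fin m) :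
    ∃ C : ℝ, ∀ᶠ w in 𝓝 t, w ≠ t →
      ‖(w - t) ^ (m - (i : ℕ)) * RatFunc.eval (RingHom.id ℂ) w (q i)‖ ≤ C := by
  obtain ⟨d, hd, hdt⟩ := Polynomial.exists_eq_pow_rootMultiplicity_mul_and_not_dvd
    (q i).denom (q i).denom_ne_zero t
  set k := (q i).denom.rootMultiplicity t with hk
  have hki : k ≤ m - (i : ℕ) := hreg t i
  have hdt0 : d.eval t ≠ 0 := fun h => hdt (Polynomial.dvd_iff_isRoot.2 h)
  let F : ℂ → ℂ := fun w => (w - t) ^ (m - (i : ℕ) - k) * ((q i).num.eval w / d.eval w)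
  have ha : AnalyticAt ℂ F t :=
    ((analyticAt_id.sub analyticAt_const).pow _).mul
      ((analyticAt_polynomial_eval _ t).div (analyticAt_polynomial_eval _ t) hdt0)
  refine ⟨‖F t‖ + 1, ?_⟩
  filter_upwards [ha.continuousAt.norm.eventually_lt_const (lt_add_one _)] with w hw hwt
  refine le_of_eq_of_le ?_ hw.le
  have hwt' : (w - t) ≠ 0 := sub_ne_zero.2 hwt
  rw [ratFunc_eval]
  rw [hd]
  rw [Polynomial.eval_mul, Polynomial.eval_pow, Polynomial.eval_sub, Polynomial.eval_X,
    Polynomial.eval_C]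
  simp only [F]
  congr 1
  obtain ⟨j, hj⟩ := Nat.exists_eq_add_of_le hki
  rw [hj, Nat.add_sub_cancel_left, pow_add]
  field_simp

/-- On a half-plane covering a small punctured disc about a regular singular point, the system in
the logarithmic coordinate is holomorphic and bounded. -/
theorem exists_bounded_scaledSystem (hreg : IsRegularAtFinite q) (t : ℂ) :
    ∃ r₀ > 0, ∃ C : ℝ, 0 ≤ C ∧ ∀ w ∈ Metric.ball t r₀, w ≠ t → w ∉ singularSet q ∧
      ∀ x, t + Complex.exp x = w → ‖scaledSystem q t x‖ ≤ C := by
  choose C hC using eventually_bounded_mul_coeff hreg t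
  have h1 : ∀ᶠ w in 𝓝 t, w ≠ t → w ∉ singularSet q := by
    have := ((finite_singularSet q).subset (Set.sdiff_subset (t := {t}))).isClosed.isOpen_compl.mem_nhds
      (show t ∈ (singularSet q \ {t})ᶜ by simp)
    filter_upwards [this] with w hw hwt hwS using hw ⟨hwS, hwt⟩
  obtain ⟨r₀, hr₀, hball⟩ := Metric.eventually_nhds_iff_ball.1
    (h1.and (eventually_all.2 hC))
  obtain ⟨D, hD, hDb⟩ := exists_norm_scaledSystem_le (q := q) (t := t)
    (X := {x | t + Complex.exp x ∈ Metric.ball t r₀}) (C := ∑ j, |C j|) (fun x hx j => by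
      have h2 := (hball _ hx).2 j (by simp)
      rw [add_sub_cancel_left] at h2
      exact (h2.trans (le_abs_self _)).trans
        (Finset.single_le_sum (f := fun j => |C j|) (fun j _ => abs_nonneg _) (Finset.mem_univ j)))
  exact ⟨r₀, hr₀, D, hD, fun w hw hwt => ⟨(hball w hw).1 hwt, fun x hx => hDb x (by
    rw [Set.mem_ofPred_eq, hx]; exact hw)⟩⟩

theorem exp_mem_slitPlane {x : ℂ} (hx : |x.im| < Real.pi) : Complex.exp x ∈ Complex.slitPlane := by
  rw [Complex.mem_slitPlane_iff_arg]
  refine ⟨fun h => ?_, Complex.exp_ne_zero x⟩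
  have h1 := abs_lt.1 hx
  rw [← Complex.log_im, Complex.log_exp h1.1 h1.2.le] at h
  linarith

/-- The strip covering a slit disc under the exponential map. -/
def logStrip (r : ℝ) : Set ℂ := logHalfPlane r ∩ {x | |x.im| < Real.pi}

theorem isOpen_logStrip (r : ℝ) : IsOpen (logStrip r) :=
  (isOpen_logHalfPlane r).inter
    (isOpen_lt (continuous_abs.comp Complex.continuous_im) continuous_const)

theorem convex_logStrip (r : ℝ) : Convex ℝ (logStrip r) := by
  have : {x : ℂ | |x.im| < Real.pi} = {x | x.im < Real.pi} ∩ {x | -Real.pi < x.im} := by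
    ext x; simp [abs_lt, and_comm]
  refine (convex_logHalfPlane r).inter ?_
  rw [this]
  exact (convex_halfSpace_im_lt _).inter (convex_halfSpace_im_gt _)

theorem exp_mem_slitDisc {r : ℝ} (hr : 0 < r) (t : ℂ) {x : ℂ} (hx : x ∈ logStrip r) :
    t + Complex.exp x ∈ slitDisc t r :=
  ⟨by simpa using (mem_logHalfPlane hr).1 hx.1, by
    rw [add_sub_cancel_left]; exact exp_mem_slitPlane hx.2⟩

theorem log_mem_logStrip {r : ℝ} (hr : 0 < r) {t w : ℂ} (hw : w ∈ slitDisc t r) :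
    Complex.log (w - t) ∈ logStrip r := by
  have h := Complex.mem_slitPlane_iff_arg.1 hw.2
  refine ⟨log_mem_logHalfPlane hr h.2 (by simpa [dist_eq_norm] using hw.1), ?_⟩
  have : |(w - t).arg| < Real.pi := abs_lt.2
    ⟨Complex.neg_pi_lt_arg _, lt_of_le_of_ne (Complex.arg_le_pi _) h.1⟩
  simpa [Complex.log_im] using this

/-- The solutions near a regular singular point `t` at which the equation is generic: in the
logarithmic coordinate `x`, with `z = t + exp x`, every solution is a multiple of a fixed function
`Φ` plus a holomorphic function of `z`, and `Φ` is known up to functions holomorphic at `t`. -/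
theorem exists_local_structure (hm : 0 < m) (hreg : IsRegularAtFinite q) (hgen : IsGeneric q)
    {t : ℂ} (ht : t ∈ singularSet q) :
    ∃ r > 0, (∀ w ∈ Metric.ball t r, w ≠ t → w ∉ singularSet q) ∧
      ∃ Φ : ℂ → ℂ, DifferentiableOn ℂ Φ (logHalfPlane r) ∧
      (∀ x₀ ∈ logHalfPlane r, ∀ f, IsSolutionNear q (t + Complex.exp x₀) f →
        ∃ a : ℂ, ∃ h : ℂ → ℂ, DifferentiableOn ℂ h (Metric.ball t r) ∧
          ∀ᶠ x in 𝓝 x₀, f (t + Complex.exp x) = a * Φ x + h (t + Complex.exp x)) ∧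
      ∃ μ : ℂ, ∃ h g k : ℂ → ℂ, DifferentiableOn ℂ h (Metric.ball 0 r) ∧
        DifferentiableOn ℂ g (Metric.ball 0 r) ∧ DifferentiableOn ℂ k (Metric.ball 0 r) ∧
        (((∀ n : ℤ, μ ≠ n) ∧ g = 0) ∨ ∃ P : ℕ, μ = -P) ∧
        ∀ x ∈ logHalfPlane r, Φ x =
          Complex.exp (μ * x) * h (Complex.exp x) + x * g (Complex.exp x) + k (Complex.exp x) := by
  obtain ⟨r₀, hr₀, C, hC, hball⟩ := exists_bounded_scaledSystem hreg t
  obtain ⟨r₁, hr₁, -, y, ⟨hysol, hyind, -⟩, k, -, hyext⟩ := hgen t ht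
  -- a common radius on which the extendable members of the basis are holomorphic
  obtain ⟨r, hr, hr1, hrr₀, hrr₁, G, hG⟩ : ∃ r > 0, r ≤ 1 ∧ r ≤ r₀ ∧ r ≤ r₁ ∧
      ∃ G : Fin m → ℂ → ℂ, ∀ i ≠ k, DifferentiableOn ℂ (G i) (Metric.ball t r) ∧
        ∀ w ∈ Metric.ball t r, w ∈ slitDisc t r₁ → y i w = G i w := by
    choose! G hGa hG using hyext
    have : ∀ᶠ w in 𝓝 t, ∀ i, i ≠ k → AnalyticAt ℂ (G i) w ∧
        (w ∈ slitDisc t r₁ → y i w = G i w) := by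
      refine eventually_all.2 fun i => ?_
      by_cases hi : i = k
      · simp [hi]
      · filter_upwards [(hGa i hi).eventually_analyticAt, eventually_nhdsWithin_iff.1 (hG i hi)]
          with w h1 h2 _ using ⟨h1, h2⟩
    obtain ⟨ε, hε, hb⟩ := Metric.eventually_nhds_iff_ball.1 this
    refine ⟨min (min ε 1) (min r₀ r₁), lt_min (lt_min hε one_pos) (lt_min hr₀ hr₁),
      (min_le_left _ _).trans (min_le_right _ _), (min_le_right _ _).trans (min_le_left _ _),
      (min_le_right _ _).trans (min_le_right _ _), G, fun i hi => ⟨fun w hw => ?_, fun w hw => ?_⟩⟩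
    · exact (hb w (Metric.ball_subset_ball ((min_le_left _ _).trans (min_le_left _ _)) hw) i
        hi).1.differentiableAt.differentiableWithinAt
    · exact (hb w (Metric.ball_subset_ball ((min_le_left _ _).trans (min_le_left _ _)) hw) i hi).2
  let H := logHalfPlane r
  have hHo : IsOpen H := isOpen_logHalfPlane r
  have hHc : Convex ℝ H := convex_logHalfPlane r
  have hHball : ∀ x ∈ H, t + Complex.exp x ∈ Metric.ball t r := fun x hx => by
    simpa using (mem_logHalfPlane hr).1 hx
  have hHS : ∀ x ∈ H, t + Complex.exp x ∉ singularSet q := fun x hx =>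
    (hball _ (Metric.ball_subset_ball hrr₀ (hHball x hx)) (by simp)).1
  have hB : ∀ x ∈ H, ‖scaledSystem q t x‖ ≤ C := fun x hx =>
    (hball _ (Metric.ball_subset_ball hrr₀ (hHball x hx)) (by simp)).2 x rfl
  have hBd : DifferentiableOn ℂ (scaledSystem q t) H := differentiableOn_scaledSystem hHS
  have hSo : IsOpen (logStrip r) := isOpen_logStrip r
  have hSsub : logStrip r ⊆ logStrip r₁ := fun x hx =>
    ⟨lt_of_lt_of_le hx.1 (Real.log_le_log hr hrr₁), hx.2⟩
  have hSslit : ∀ x ∈ logStrip r, t + Complex.exp x ∈ slitDisc t r₁ := fun x hx =>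
    exp_mem_slitDisc hr₁ t (hSsub hx)
  have hZ : ∀ i, ∃ Z : ℂ → Fin m → ℂ, (∀ x ∈ H, HasDerivAt Z (scaledSystem q t x (Z x)) x) ∧
      Set.EqOn (scaledJet m t (y i)) Z (logStrip r) := fun i =>
    LinearODE.exists_extension hHc hHo hC hB hBd Set.inter_subset_left (convex_logStrip r)
      fun x hx => (hysol i).hasDerivAt_scaledJet (hSslit x hx)
  choose Z hZd hZy using hZ
  have hZ0 : ∀ i, DifferentiableOn ℂ (fun x => Z i x ⟨0, hm⟩) H := fun i x hx =>
    (hasDerivAt_pi.1 (hZd i x hx) _).differentiableAt.differentiableWithinAt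
  obtain ⟨xs, hxs⟩ : ∃ x, x ∈ logStrip r := ⟨⟨Real.log r - 1, 0⟩, by
    simp [logStrip, logHalfPlane, Real.pi_pos]⟩
  have hZ0y : ∀ i, ∀ x ∈ logStrip r, Z i x ⟨0, hm⟩ = y i (t + Complex.exp x) := fun i x hx => by
    rw [← hZy i hx]; simp [scaledJet]
  have hcomb : ∀ a : Fin m → ℂ, ∀ x ∈ H, HasDerivAt (fun x => ∑ i, a i • Z i x)
      (scaledSystem q t x (∑ i, a i • Z i x)) x := fun a x hx => by
    rw [map_sum]
    simp_rw [map_smul]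
    exact HasDerivAt.fun_sum fun i _ => (hZd i x hx).const_smul (a i)
  -- the extended basis is linearly independent at each point of the half-plane
  have hli : ∀ x ∈ H, LinearIndependent ℂ fun i => Z i x := by
    intro x hx
    rw [Fintype.linearIndependent_iff]
    intro a ha
    have h0 := LinearODE.eqOn hHc hB (hcomb a) (Z := fun _ => 0)
      (fun x _ => by simpa using hasDerivAt_const x (0 : Fin m → ℂ)) hx ha
    -- the vanishing combination is zero near `t`, hence on the whole slit disc
    have hd : DifferentiableOn ℂ (fun x => ∑ i, a i * y i (t + Complex.exp x)) (logStrip r₁) :=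
      DifferentiableOn.fun_sum fun i _ => DifferentiableOn.const_mul (fun x hx =>
        (DifferentiableAt.comp (g := y i) x
          ((hysol i).1 _ (exp_mem_slitDisc hr₁ t hx)).differentiableAt
          (by fun_prop)).differentiableWithinAt) _
    have hd0 : Set.EqOn (fun x => ∑ i, a i * y i (t + Complex.exp x)) (fun _ => 0)
        (logStrip r₁) := by
      refine eqOn_of_convex (isOpen_logStrip r₁) (convex_logStrip r₁) hd
        (differentiableOn_const _) (hSsub hxs) ?_
      filter_upwards [hSo.mem_nhds hxs] with x hx
      have h1 := congrFun (h0 hx.1) ⟨0, hm⟩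
      simp only [Finset.sum_apply, Pi.smul_apply, smul_eq_mul, Pi.zero_apply] at h1
      rw [← h1]
      exact Finset.sum_congr rfl fun i _ => by rw [hZ0y i x hx]
    refine hyind a fun w hw => ?_
    have h1 := hd0 (log_mem_logStrip hr₁ hw)
    have h2 : t + Complex.exp (Complex.log (w - t)) = w := by
      rw [Complex.exp_log (Complex.slitPlane_ne_zero hw.2)]; ring
    simpa only [h2] using h1
  have hspan : ∀ x ∈ H, ∀ v : Fin m → ℂ, ∃ a : Fin m → ℂ, v = ∑ i, a i • Z i x := by
    intro x hx v
    have h1 := (hli x hx).span_eq_top_of_card_eq_finrank' (by simp)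
    have h2 : v ∈ Submodule.span ℂ (Set.range fun i => Z i x) := by rw [h1]; trivial
    obtain ⟨a, ha⟩ := (Submodule.mem_span_range_iff_exists_fun ℂ).1 h2
    exact ⟨a, ha.symm⟩
  have hGZ : ∀ i ≠ k, ∀ x ∈ H, Z i x ⟨0, hm⟩ = G i (t + Complex.exp x) := by
    intro i hi
    have hd : DifferentiableOn ℂ (fun x => G i (t + Complex.exp x)) H :=
      (hG i hi).1.comp (by fun_prop) hHball
    refine eqOn_of_convex hHo hHc (hZ0 i) hd hxs.1 ?_
    filter_upwards [hSo.mem_nhds hxs] with x hx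
    rw [hZ0y i x hx, (hG i hi).2 _ (hHball x hx.1) (hSslit x hx)]
  have hsplit : ∀ a : Fin m → ℂ, ∀ x ∈ H, (∑ i, a i • Z i x) ⟨0, hm⟩ =
      a k * Z k x ⟨0, hm⟩ + ∑ i ∈ Finset.univ.erase k, a i * G i (t + Complex.exp x) := by
    intro a x hx
    rw [Finset.sum_apply, ← Finset.add_sum_erase _ _ (Finset.mem_univ k)]
    congr 1
    refine Finset.sum_congr rfl fun i hi => ?_
    rw [Pi.smul_apply, smul_eq_mul, hGZ i (Finset.ne_of_mem_erase hi) x hx]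
  have hGd : ∀ a : Fin m → ℂ, DifferentiableOn ℂ
      (fun w => ∑ i ∈ Finset.univ.erase k, a i * G i w) (Metric.ball t r) := fun a =>
    DifferentiableOn.fun_sum fun i hi => ((hG i (Finset.ne_of_mem_erase hi)).1).const_mul _
  refine ⟨r, hr, fun w hw hwt => (hball w (Metric.ball_subset_ball hrr₀ hw) hwt).1,
    fun x => Z k x ⟨0, hm⟩, hZ0 k, fun x₀ hx₀ f hf => ?_, ?_⟩
  · obtain ⟨a, ha⟩ := hspan x₀ hx₀ (scaledJet m t f x₀)
    refine ⟨a k, _, hGd a, ?_⟩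
    obtain ⟨ε, hε, hfε⟩ := hf
    have h1 : ∀ᶠ x in 𝓝 x₀, t + Complex.exp x ∈ Metric.ball (t + Complex.exp x₀) ε :=
      ContinuousAt.preimage_mem_nhds (f := fun x => t + Complex.exp x) (by fun_prop)
        (Metric.ball_mem_nhds _ hε)
    obtain ⟨δ, hδ, hb⟩ := Metric.eventually_nhds_iff_ball.1 (h1.and (hHo.mem_nhds hx₀))
    have h2 := LinearODE.eqOn (convex_ball x₀ δ) (fun x hx => hB x (hb x hx).2)
      (fun x hx => hfε.hasDerivAt_scaledJet (hb x hx).1) (fun x hx => hcomb a x (hb x hx).2)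
      (Metric.mem_ball_self hδ) ha
    filter_upwards [Metric.ball_mem_nhds x₀ hδ] with x hx
    rw [← hsplit a x (hb x hx).2]
    refine Eq.trans ?_ (congrFun (h2 hx) ⟨0, hm⟩)
    simp [scaledJet]
  · have hmemT : ∀ x ∈ H, x + 2 * Real.pi * Complex.I ∈ H := fun x hx =>
      add_two_pi_mem_logHalfPlane.2 hx
    have hexpT : ∀ x : ℂ, Complex.exp (x + 2 * Real.pi * Complex.I) = Complex.exp x := fun x => by
      rw [Complex.exp_add, Complex.exp_two_pi_mul_I, mul_one]
    have hshift : ∀ x ∈ H, HasDerivAt (fun x => Z k (x + 2 * Real.pi * Complex.I))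
        (scaledSystem q t x (Z k (x + 2 * Real.pi * Complex.I))) x := fun x hx => by
      have h1 := (hZd k _ (hmemT x hx)).comp_add_const x (2 * Real.pi * Complex.I)
      have h2 : scaledSystem q t (x + 2 * Real.pi * Complex.I) = scaledSystem q t x := by
        unfold scaledSystem scaledCoeff
        rw [hexpT]
      rwa [h2] at h1
    -- the monodromy: translation by `2πi` maps `Z k` to a combination of the basis
    obtain ⟨a, ha⟩ := hspan xs hxs.1 (Z k (xs + 2 * Real.pi * Complex.I))
    have hT := LinearODE.eqOn hHc hB hshift (hcomb a) hxs.1 ha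
    refine exists_form_of_monodromy hr hr1 (Φ := fun x => Z k x ⟨0, hm⟩)
      (G := fun w => ∑ i ∈ Finset.univ.erase k, a i * G i (t + w)) (α := a k)
      (K := ‖Z k xs‖ * Real.exp (C * ‖xs‖)) (A := C) (hZ0 k) ?_ (fun x hx => ?_) hC
      fun x hx => ?_
    · refine (hGd a).comp (f := fun w => t + w) (by fun_prop) fun w hw => ?_
      simpa using hw
    · rw [← hsplit a x hx]
      exact congrFun (hT hx) _
    · refine (norm_le_pi_norm (Z k x) _).trans
        ((LinearODE.norm_le_exp hHc hB (hZd k) hxs.1 hx).trans ?_)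
      rw [mul_assoc, ← Real.exp_add, ← mul_add, add_comm ‖xs‖]
      gcongr
      exact norm_sub_le _ _

/-! ### Taylor coefficients of solutions -/

theorem dist_ne_of_notMem_bisectorSet {z : ℂ} (hz : z ∉ bisectorSet q) {s t : ℂ}
    (hs : s ∈ singularSet q) (ht : t ∈ singularSet q) (hst : s ≠ t) : dist z s ≠ dist z t :=
  fun h => hz ⟨s, hs, t, ht, hst, AffineSubspace.mem_perpBisector_iff_dist_eq.2 h⟩

/-- Off the bisectors, the circle about `z` through a singular point `t` contains no other
singular point, so a solution that extends across `t` extends to a larger disc. -/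
theorem exists_extendsToBall_of_extendsWithin (hm : 0 < m) {z t : ℂ} (hzA : z ∉ bisectorSet q)
    (hzS : z ∉ singularSet q) (ht : t ∈ singularSet q) {f : ℂ → ℂ} (hsol : IsSolutionNear q z f)
    (hf : DifferentiableOn ℂ f (Metric.ball z (dist z t)))
    (hext : ExtendsWithin f (Metric.ball z (dist z t)) t) :
    ∃ R > dist z t, ExtendsToBall f z R := by
  have hpos : 0 < dist z t := dist_pos.2 fun h => hzS (h ▸ ht)
  refine exists_extendsToBall_gt hpos hf fun p hp => ?_
  by_cases hpS : p ∈ singularSet q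
  · obtain rfl : p = t := by
      by_contra hpt
      exact dist_ne_of_notMem_bisectorSet hzA hpS ht hpt (by rw [dist_comm]; exact hp)
    exact hext
  · exact extendsWithin_of_notMem hm hpos hzS hf hsol hpS

theorem div_mem_ball_one {z t w : ℂ} (hzt : z ≠ t) (hw : w ∈ Metric.ball z (dist z t)) :
    (w - t) / (z - t) ∈ Metric.ball (1 : ℂ) 1 := by
  have h0 : z - t ≠ 0 := sub_ne_zero.2 hzt
  have h1 : (w - t) / (z - t) - 1 = (w - z) / (z - t) := by field_simp; ring
  rw [Metric.mem_ball, dist_eq_norm, h1, norm_div, div_lt_one (norm_pos_iff.2 h0)]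
  simpa [dist_eq_norm] using hw

/-- A branch of `log (w - t)` on the disc about `z` with `t` on its boundary. -/
noncomputable def discLog (z t w : ℂ) : ℂ := Complex.log ((w - t) / (z - t)) + Complex.log (z - t)

theorem exp_discLog {z t w : ℂ} (hzt : z ≠ t) (hwt : w ≠ t) :
    Complex.exp (discLog z t w) = w - t := by
  have h0 : z - t ≠ 0 := sub_ne_zero.2 hzt
  rw [discLog, Complex.exp_add, Complex.exp_log (div_ne_zero (sub_ne_zero.2 hwt) h0),
    Complex.exp_log h0, div_mul_cancel₀ _ h0]

theorem ne_of_mem_ball {z t w : ℂ} (hw : w ∈ Metric.ball z (dist z t)) : w ≠ t := by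
  rintro rfl
  rw [Metric.mem_ball, dist_comm] at hw
  exact lt_irrefl _ hw

theorem differentiableAt_discLog {z t w : ℂ} (hzt : z ≠ t)
    (hw : w ∈ Metric.ball z (dist z t)) : DifferentiableAt ℂ (discLog z t) w :=
  (DifferentiableAt.clog (f := fun w => (w - t) / (z - t))
    ((differentiableAt_id.sub_const t).div_const (z - t))
    (ball_one_subset_slitPlane (div_mem_ball_one hzt hw))).add_const _

theorem discLog_mem {z t w : ℂ} {r : ℝ} (hr : 0 < r) (hzt : z ≠ t)
    (hw : w ∈ Metric.ball z (dist z t)) (hwr : w ∈ Metric.ball t r) :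
    discLog z t w ∈ logHalfPlane r := by
  rw [mem_logHalfPlane hr, exp_discLog hzt (ne_of_mem_ball hw)]
  simpa [dist_eq_norm] using hwr

/-- The form of a solution on a disc near a singular point on the boundary. -/
theorem exists_eqOn_disc {z t : ℂ} {r : ℝ} (hr : 0 < r) (hzt : z ≠ t) (hzS : z ∉ singularSet q)
    (hrS : ∀ w ∈ Metric.ball t r, w ≠ t → w ∉ singularSet q) {Φ : ℂ → ℂ}
    (hΦ : DifferentiableOn ℂ Φ (logHalfPlane r))
    (hloc : ∀ x₀ ∈ logHalfPlane r, ∀ f, IsSolutionNear q (t + Complex.exp x₀) f →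
        ∃ a : ℂ, ∃ h : ℂ → ℂ, DifferentiableOn ℂ h (Metric.ball t r) ∧
          ∀ᶠ x in 𝓝 x₀, f (t + Complex.exp x) = a * Φ x + h (t + Complex.exp x))
    {f : ℂ → ℂ} (hsol : IsSolutionNear q z f)
    (hf : DifferentiableOn ℂ f (Metric.ball z (dist z t))) :
    ∃ a : ℂ, ∃ h : ℂ → ℂ, DifferentiableOn ℂ h (Metric.ball t r) ∧
      ∀ w ∈ Metric.ball z (dist z t) ∩ Metric.ball t r, f w = a * Φ (discLog z t w) + h w := by
  have hpos : 0 < dist z t := dist_pos.2 hzt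
  have hWo : IsOpen (Metric.ball z (dist z t) ∩ Metric.ball t r) :=
    Metric.isOpen_ball.inter Metric.isOpen_ball
  obtain ⟨w₀, hw₀r, hw₀⟩ : ∃ w, w ∈ Metric.ball t r ∧ w ∈ Metric.ball z (dist z t) := by
    have : t ∈ closure (Metric.ball z (dist z t)) := by
      rw [closure_ball z hpos.ne', Metric.mem_closedBall, dist_comm]
    exact mem_closure_iff.1 this _ Metric.isOpen_ball (Metric.mem_ball_self hr)
  have hw₀t := ne_of_mem_ball hw₀
  have hexp : ∀ w, w ≠ t → t + Complex.exp (discLog z t w) = w := fun w hw => by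
    rw [exp_discLog hzt hw]; ring
  have hsol₀ : IsSolutionNear q w₀ f :=
    (hsol.isSolutionOn Metric.isOpen_ball (convex_ball _ _).isPreconnected hf
      (Metric.mem_ball_self hpos) hzS).isSolutionNear
      (Metric.isOpen_ball.sdiff (finite_singularSet q).isClosed) ⟨hw₀, hrS w₀ hw₀r hw₀t⟩
  obtain ⟨a, h, hh, hfh⟩ := hloc _ (discLog_mem hr hzt hw₀ hw₀r) f (by rwa [hexp w₀ hw₀t])
  refine ⟨a, h, hh, ?_⟩
  have hd : DifferentiableOn ℂ (fun w => a * Φ (discLog z t w) + h w)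
      (Metric.ball z (dist z t) ∩ Metric.ball t r) := by
    refine DifferentiableOn.add (DifferentiableOn.const_mul (hΦ.comp (fun w hw =>
      (differentiableAt_discLog hzt hw.1).differentiableWithinAt) fun w hw =>
        discLog_mem hr hzt hw.1 hw.2) a) (hh.mono Set.inter_subset_right)
  refine eqOn_of_convex hWo ((convex_ball _ _).inter (convex_ball _ _))
    (hf.mono Set.inter_subset_left) hd ⟨hw₀, hw₀r⟩ ?_
  filter_upwards [hWo.mem_nhds ⟨hw₀, hw₀r⟩,
    (differentiableAt_discLog hzt hw₀).continuousAt.eventually hfh] with w hw hw'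
  rwa [hexp w (ne_of_mem_ball hw.1)] at hw'

/-- Modulo solutions extending across `t`, solutions form a space of dimension at most one. -/
theorem exists_sub_const_mul_extends (hm : 0 < m) (hreg : IsRegularAtFinite q)
    (hgen : IsGeneric q) {z t : ℂ} (hzA : z ∉ bisectorSet q)
    (hzS : z ∉ singularSet q) (ht : t ∈ singularSet q) {f₁ f₂ : ℂ → ℂ}
    (hsol₁ : IsSolutionNear q z f₁) (hsol₂ : IsSolutionNear q z f₂)
    (h₁ : ExtendsToBall f₁ z (dist z t)) (h₂ : ExtendsToBall f₂ z (dist z t))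
    (hne : ¬ ∃ R > dist z t, ExtendsToBall f₂ z R) :
    ∃ c : ℂ, ∃ R > dist z t, ExtendsToBall (fun w => f₁ w - c * f₂ w) z R := by
  have hzt : z ≠ t := fun h => hzS (h ▸ ht)
  obtain ⟨r, hr, hrS, Φ, hΦ, hloc, -⟩ := exists_local_structure hm hreg hgen ht
  obtain ⟨F₁, hF₁, hfF₁⟩ := h₁
  obtain ⟨F₂, hF₂, hfF₂⟩ := h₂
  have hs₁ := hsol₁.congr hfF₁
  have hs₂ := hsol₂.congr hfF₂
  obtain ⟨a₁, k₁, hk₁, he₁⟩ := exists_eqOn_disc hr hzt hzS hrS hΦ hloc hs₁ hF₁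
  obtain ⟨a₂, k₂, hk₂, he₂⟩ := exists_eqOn_disc hr hzt hzS hrS hΦ hloc hs₂ hF₂
  have hball : Metric.ball t r ∈ 𝓝 t := Metric.ball_mem_nhds t hr
  have hmem : ∀ᶠ w in 𝓝[Metric.ball z (dist z t)] t,
      w ∈ Metric.ball z (dist z t) ∩ Metric.ball t r := by
    filter_upwards [self_mem_nhdsWithin, mem_nhdsWithin_of_mem_nhds hball] with w h1 h2
      using ⟨h1, h2⟩
  have ha₂ : a₂ ≠ 0 := by
    rintro rfl
    obtain ⟨R, hR, G, hG, hFG⟩ := exists_extendsToBall_of_extendsWithin hm hzA hzS ht hs₂ hF₂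
      ⟨k₂, hk₂.analyticAt hball, by
        filter_upwards [hmem] with w hw
        rw [he₂ w hw]; ring⟩
    exact hne ⟨R, hR, G, hG, hfF₂.trans hFG⟩
  refine ⟨a₁ / a₂, ?_⟩
  obtain ⟨R, hR, G, hG, hFG⟩ := exists_extendsToBall_of_extendsWithin hm hzA hzS ht
    (hs₁.sub_const_mul (a₁ / a₂) hs₂) (hF₁.sub (hF₂.const_mul _))
    ⟨fun w => k₁ w - a₁ / a₂ * k₂ w,
      (hk₁.analyticAt hball).sub (analyticAt_const.mul (hk₂.analyticAt hball)), by
        filter_upwards [hmem] with w hw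
        rw [he₁ w hw, he₂ w hw]
        field_simp
        ring⟩
  refine ⟨R, hR, G, hG, EventuallyEq.trans ?_ hFG⟩
  filter_upwards [hfF₁, hfF₂] with w h1 h2
  rw [h1, h2]

theorem iteratedDeriv_comp_affine {f : ℂ → ℂ} {t c : ℂ} {V W : Set ℂ} (hV : IsOpen V)
    (hW : IsOpen W) (hf : DifferentiableOn ℂ f W) (hVW : ∀ v ∈ V, t + c * v ∈ W) (n : ℕ) :
    Set.EqOn (iteratedDeriv n fun v => f (t + c * v))
      (fun v => c ^ n * iteratedDeriv n f (t + c * v)) V := by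
  induction n with
  | zero => intro v _; simp
  | succ n ih =>
    intro v hv
    have h1 : HasDerivAt (fun v => t + c * v) c v := by
      simpa using ((hasDerivAt_id v).const_mul c).const_add t
    have h2 := (hasDerivAt_iteratedDeriv (hf.analyticOnNhd hW _ (hVW v hv)) n).comp v h1
    rw [iteratedDeriv_succ, (ih.eventuallyEq_of_mem (hV.mem_nhds hv)).deriv_eq]
    refine (h2.const_mul (c ^ n)).deriv.trans ?_
    ring

/-- The Taylor coefficients of a solution that extends up to, but not across, the singular
point `t` are at least of the size of `(z - t) ^ (-n)`, up to powers of `n`. -/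
theorem polyLower_of_singular (hm : 0 < m) (hreg : IsRegularAtFinite q)
    (hgen : IsGeneric q) {z t : ℂ} (hzA : z ∉ bisectorSet q)
    (hzS : z ∉ singularSet q) (ht : t ∈ singularSet q) {f : ℂ → ℂ} (hsol : IsSolutionNear q z f)
    (h : ExtendsToBall f z (dist z t)) (hne : ¬ ∃ R > dist z t, ExtendsToBall f z R) :
    PolyLower fun n => (z - t) ^ n * taylorCoeff f z n := by
  have hzt : z ≠ t := fun h => hzS (h ▸ ht)
  have hzt0 : z - t ≠ 0 := sub_ne_zero.2 hzt
  have hpos : 0 < dist z t := dist_pos.2 hzt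
  obtain ⟨r, hr, hrS, Φ, hΦ, hloc, μ, h₁, g, k, hh₁, hg, hk, hμ, hform⟩ :=
    exists_local_structure hm hreg hgen ht
  obtain ⟨F, hF, hfF⟩ := h
  have hs := hsol.congr hfF
  have hneF : ¬ ExtendsWithin F (Metric.ball z (dist z t)) t := fun hext => by
    obtain ⟨R, hR, G, hG, hFG⟩ := exists_extendsToBall_of_extendsWithin hm hzA hzS ht hs hF hext
    exact hne ⟨R, hR, G, hG, hfF.trans hFG⟩
  have hextF : ∀ p ∈ Metric.sphere z (dist z t), p ≠ t →
      ExtendsWithin F (Metric.ball z (dist z t)) p := fun p hp hpt => by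
    refine extendsWithin_of_notMem hm hpos hzS hF hs fun hpS => ?_
    exact dist_ne_of_notMem_bisectorSet hzA hpS ht hpt (by rw [dist_comm]; exact hp)
  obtain ⟨a, l, hl, he⟩ := exists_eqOn_disc hr hzt hzS hrS hΦ hloc hs hF
  -- normalize: `w = t + (z - t) v`, which maps the disc `|v - 1| < 1` onto the disc of `F`
  let σ : ℂ → ℂ := fun v => t + (z - t) * v
  have hσd : Differentiable ℂ σ := by fun_prop
  have hσdist : ∀ v p, dist (σ v) (σ p) = dist z t * dist v p := fun v p => by
    rw [dist_eq_norm, dist_eq_norm z, dist_eq_norm v, ← norm_mul]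
    congr 1
    simp only [σ]; ring
  have hσ1 : σ 1 = z := by simp only [σ]; ring
  have hσ0 : σ 0 = t := by simp [σ]
  have hσball : ∀ v, σ v ∈ Metric.ball z (dist z t) ↔ v ∈ Metric.ball (1 : ℂ) 1 := fun v => by
    rw [Metric.mem_ball, Metric.mem_ball, ← hσ1, hσdist, hσ1, mul_lt_iff_lt_one_right hpos]
  have hFσ : DifferentiableOn ℂ (fun v => F (σ v)) (Metric.ball 1 1) :=
    hF.comp hσd.differentiableOn fun v hv => (hσball v).2 hv
  have hσtend : ∀ p, Tendsto σ (𝓝[Metric.ball 1 1] p) (𝓝[Metric.ball z (dist z t)] (σ p)) :=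
    fun p => hσd.continuous.continuousWithinAt.tendsto_nhdsWithin fun v hv => (hσball v).2 hv
  have hextσ : ∀ p ∈ Metric.sphere (1 : ℂ) 1, p ≠ 0 →
      ExtendsWithin (fun v => F (σ v)) (Metric.ball 1 1) p := by
    intro p hp hp0
    obtain ⟨G, hG, hFG⟩ := hextF (σ p) (by
      have := hσdist p 1
      rw [Metric.mem_sphere.1 hp, hσ1, mul_one] at this
      exact this) (fun h => by
        rw [← hσ0, ← dist_eq_zero, hσdist, mul_eq_zero] at h
        exact h.elim hpos.ne' fun h => hp0 (dist_eq_zero.1 h))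
    exact ⟨fun v => G (σ v), hG.fun_comp (hσd.analyticAt p), (hσtend p).eventually hFG⟩
  have hneσ : ¬ ExtendsWithin (fun v => F (σ v)) (Metric.ball 1 1) 0 := by
    rintro ⟨G, hG, hFG⟩
    have hτ : AnalyticAt ℂ (fun w => (w - t) / (z - t)) t := by fun_prop
    have hτ0 : (t - t) / (z - t) = 0 := by simp
    have hστ : ∀ w, σ ((w - t) / (z - t)) = w := fun w => by
      simp only [σ]; field_simp; ring
    refine hneF ⟨fun w => G ((w - t) / (z - t)), AnalyticAt.fun_comp (by rwa [hτ0]) hτ, ?_⟩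
    have htend : Tendsto (fun w => (w - t) / (z - t)) (𝓝[Metric.ball z (dist z t)] t)
        (𝓝[Metric.ball 1 1] 0) := by
      have := hτ.continuousAt.continuousWithinAt.tendsto_nhdsWithin
        (s := Metric.ball z (dist z t)) (t := Metric.ball 1 1)
        fun w hw => div_mem_ball_one hzt hw
      rwa [hτ0] at this
    filter_upwards [htend.eventually hFG] with w hw
    rw [← hw, hστ]
  have hcoef : taylorCoeff (fun v => F (σ v)) 1 = fun n => (z - t) ^ n * taylorCoeff f z n := by
    funext n
    rw [taylorCoeff_congr hfF, taylorCoeff, taylorCoeff, ← mul_div_assoc]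
    congr 1
    have := iteratedDeriv_comp_affine (t := t) (c := z - t) (V := Metric.ball 1 1) Metric.isOpen_ball
      Metric.isOpen_ball hF (fun v hv => (hσball v).2 hv) n (Metric.mem_ball_self one_pos)
    have h1 : t + (z - t) * 1 = z := hσ1
    simpa only [h1] using this
  have hsmall : ∀ G : ℂ → ℂ, DifferentiableOn ℂ G (Metric.ball 0 r) →
      AnalyticAt ℂ (fun v => G ((z - t) * v)) 0 := fun G hG =>
    AnalyticAt.fun_comp (by
      rw [mul_zero]; exact hG.analyticAt (Metric.ball_mem_nhds 0 hr)) (by fun_prop)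
  have hlσ : AnalyticAt ℂ (fun v => l (σ v)) 0 :=
    AnalyticAt.fun_comp (by rw [hσ0]; exact hl.analyticAt (Metric.ball_mem_nhds t hr))
      (hσd.analyticAt 0)
  have hev : (fun v => F (σ v)) =ᶠ[𝓝[Metric.ball 1 1] 0] fun v =>
      v ^ μ * (a * (Complex.exp (μ * Complex.log (z - t)) * h₁ ((z - t) * v))) +
        (a * g ((z - t) * v)) * Complex.log v +
        (a * (Complex.log (z - t) * g ((z - t) * v) + k ((z - t) * v)) + l (σ v)) := by
    have hr' : ∀ᶠ v in 𝓝 (0 : ℂ), σ v ∈ Metric.ball t r :=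
      hσd.continuous.continuousAt.preimage_mem_nhds (by
        rw [hσ0]; exact Metric.ball_mem_nhds t hr)
    filter_upwards [self_mem_nhdsWithin, hr'.filter_mono nhdsWithin_le_nhds] with v hv hvr
    have hv0 := Complex.slitPlane_ne_zero (ball_one_subset_slitPlane hv)
    have hσv := (hσball v).2 hv
    have h1 : discLog z t (σ v) = Complex.log v + Complex.log (z - t) := by
      rw [discLog]
      congr 2
      simp only [σ]
      field_simp
      ring
    have h2 : Complex.exp (discLog z t (σ v)) = (z - t) * v := by
      rw [exp_discLog hzt (ne_of_mem_ball hσv)]; simp [σ]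
    rw [he _ ⟨hσv, hvr⟩, hform _ (discLog_mem hr hzt hσv hvr), h2, h1, mul_add μ, Complex.exp_add,
      Complex.cpow_def_of_ne_zero hv0, mul_comm (Complex.log v) μ]
    ring
  rw [← hcoef]
  obtain ⟨hμn, hg0⟩ | ⟨P, hP⟩ := hμ
  · refine polyLower_of_algebraic hFσ hextσ hneσ (μ := μ)
      (h := fun v => a * (Complex.exp (μ * Complex.log (z - t)) * h₁ ((z - t) * v)))
      (k := fun v =>
        a * (Complex.log (z - t) * g ((z - t) * v) + k ((z - t) * v)) + l (σ v))
      (fun n => by exact_mod_cast hμn n) (fun n => by exact_mod_cast hμn (-n))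
      (analyticAt_const.mul (analyticAt_const.mul (hsmall h₁ hh₁)))
      ((analyticAt_const.mul ((analyticAt_const.mul (hsmall g hg)).add (hsmall k hk))).add hlσ) ?_
    filter_upwards [hev] with v hv
    rw [hv, hg0]
    simp
  · refine polyLower_of_logarithmic hFσ hextσ hneσ (P := P)
      (h := fun v => a * (Complex.exp (μ * Complex.log (z - t)) * h₁ ((z - t) * v)))
      (g := fun v => a * g ((z - t) * v))
      (k := fun v =>
        a * (Complex.log (z - t) * g ((z - t) * v) + k ((z - t) * v)) + l (σ v))
      (analyticAt_const.mul (analyticAt_const.mul (hsmall h₁ hh₁)))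
      (analyticAt_const.mul (hsmall g hg))
      ((analyticAt_const.mul ((analyticAt_const.mul (hsmall g hg)).add (hsmall k hk))).add hlσ) ?_
    filter_upwards [hev] with v hv
    rw [hv, hP, Complex.cpow_neg, Complex.cpow_natCast]

theorem exists_norm_taylorCoeff_le {g : ℂ → ℂ} {z : ℂ} {ρ R : ℝ} (hρ : 0 < ρ) (hR : ρ < R)
    (hg : ExtendsToBall g z R) : ∃ D : ℝ, ∀ n, ‖taylorCoeff g z n‖ ≤ D / ρ ^ n := by
  obtain ⟨G, hG, hgG⟩ := hg
  have hsub : Metric.closedBall z ρ ⊆ Metric.ball z R := Metric.closedBall_subset_ball hR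
  obtain ⟨D, hD⟩ := (isCompact_closedBall z ρ).exists_bound_of_continuousOn
    (hG.continuousOn.mono hsub)
  refine ⟨D, fun n => ?_⟩
  have h1 := Complex.norm_iteratedDeriv_le_of_forall_mem_sphere_norm_le n hρ
    (DifferentiableOn.diffContOnCl (hG.mono ((closure_mono Metric.ball_subset_closedBall).trans
      (by rw [Metric.isClosed_closedBall.closure_eq]; exact hsub))))
    (fun w hw => hD w (Metric.sphere_subset_closedBall hw))
  have hn : (0 : ℝ) < n.factorial := by exact_mod_cast n.factorial_pos
  rw [taylorCoeff_congr hgG, taylorCoeff, norm_div, Complex.norm_natCast, div_le_iff₀ hn]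
  refine h1.trans_eq ?_
  ring

/-- A germ extending across the circle of convergence of `f` has negligible Taylor
coefficients. -/
theorem tendsto_iteratedDeriv_div_zero {f g : ℂ → ℂ} {z t : ℂ} (hzt : z ≠ t)
    (hf : PolyLower fun n => (z - t) ^ n * taylorCoeff f z n) {R : ℝ} (hR : dist z t < R)
    (hg : ExtendsToBall g z R) :
    Tendsto (fun n => iteratedDeriv n g z / iteratedDeriv n f z) atTop (𝓝 0) := by
  obtain ⟨ρ, hρ1, hρ2⟩ := exists_between hR
  have hpos : 0 < dist z t := dist_pos.2 hzt
  have hρ : 0 < ρ := hpos.trans hρ1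
  obtain ⟨D, hD⟩ := exists_norm_taylorCoeff_le hρ hρ2 hg
  obtain ⟨c, hc, M, hM⟩ := hf
  have hlim : Tendsto (fun n : ℕ => D / c * ((n : ℝ) ^ M * (dist z t / ρ) ^ n)) atTop (𝓝 0) := by
    have := (tendsto_pow_const_mul_const_pow_of_abs_lt_one M
      (r := dist z t / ρ) (by rw [abs_of_pos (by positivity), div_lt_one hρ]; exact hρ1)).const_mul
      (D / c)
    simpa using this
  refine squeeze_zero_norm' ?_ hlim
  filter_upwards [hM] with n hn
  have hfac : (n.factorial : ℂ) ≠ 0 := by exact_mod_cast n.factorial_ne_zero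
  have h1 : iteratedDeriv n g z / iteratedDeriv n f z = taylorCoeff g z n / taylorCoeff f z n := by
    rw [taylorCoeff, taylorCoeff, div_div_div_cancel_right₀ hfac]
  rw [norm_mul, norm_pow, ← dist_eq_norm] at hn
  have hf0 : 0 < ‖taylorCoeff f z n‖ := by
    by_contra hle
    have : ‖taylorCoeff f z n‖ = 0 := le_antisymm (not_lt.1 hle) (norm_nonneg _)
    rw [this, mul_zero, zero_mul] at hn
    linarith
  have hD0 : 0 ≤ D := by
    have := (norm_nonneg _).trans (hD 0)
    simpa using this
  rw [h1, norm_div, div_le_iff₀ hf0]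
  calc ‖taylorCoeff g z n‖ ≤ D / ρ ^ n := hD n
    _ = D / c * (1 / ρ ^ n) * c := by field_simp
    _ ≤ D / c * (1 / ρ ^ n) * (dist z t ^ n * ‖taylorCoeff f z n‖ * (n : ℝ) ^ M) := by gcongr
    _ = _ := by rw [div_pow]; ring

/-! ### The point at infinity -/

theorem exists_polynomial_of_growth {g : ℂ → ℂ} (hg : Differentiable ℂ g) {K R₀ : ℝ} {N : ℕ}
    (h : ∀ w, R₀ < ‖w‖ → ‖g w‖ ≤ K * ‖w‖ ^ N) : ∃ p : Polynomial ℂ, ∀ w, g w = p.eval w := by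
  have h0 : ∀ n, N < n → iteratedDeriv n g 0 = 0 := by
    intro n hn
    have h1 : ∀ᶠ R : ℝ in atTop, ‖iteratedDeriv n g 0‖ ≤ n.factorial * K * R⁻¹ := by
      filter_upwards [eventually_gt_atTop R₀, eventually_ge_atTop 1] with R hR hR1
      have hR0 : 0 < R := by linarith
      have hs : ∀ w ∈ Metric.sphere (0 : ℂ) R, ‖w‖ = R := fun w hw => by simpa using hw
      have h2 := Complex.norm_iteratedDeriv_le_of_forall_mem_sphere_norm_le n hR0
        (hg.diffContOnCl (s := Metric.ball 0 R)) (C := K * R ^ N)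
        (fun w hw => by have := h w (by rwa [hs w hw]); rwa [hs w hw] at this)
      refine h2.trans ?_
      have hK : 0 ≤ K := by
        have := (norm_nonneg _).trans (h R (by simpa [abs_of_pos hR0] using hR))
        exact nonneg_of_mul_nonneg_left this (by simp; positivity)
      rw [mul_assoc, mul_div_assoc, mul_div_assoc]
      gcongr
      rw [div_le_iff₀ (by positivity), inv_mul_eq_div, le_div_iff₀ hR0, ← pow_succ]
      exact pow_le_pow_right₀ hR1 hn
    have h3 : Tendsto (fun R : ℝ => n.factorial * K * R⁻¹) atTop (𝓝 0) := by
      simpa using tendsto_inv_atTop_zero.const_mul (n.factorial * K)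
    exact norm_le_zero_iff.1 (ge_of_tendsto h3 h1)
  refine ⟨∑ n ∈ Finset.range (N + 1),
    Polynomial.monomial n (((n.factorial : ℂ))⁻¹ * iteratedDeriv n g 0), fun w => ?_⟩
  rw [← Complex.taylorSeries_eq_of_entire' (c := 0) (z := w) hg, Polynomial.eval_finsetSum,
    tsum_eq_sum (s := Finset.range (N + 1))]
  · simp
  · intro n hn
    rw [h0 n (by simpa using hn)]
    simp

theorem exists_bounded_coeff_at_infinity (hinf : IsRegularAtInfinity q) :
    ∃ R₀ : ℝ, 1 ≤ R₀ ∧ ∃ C : ℝ, ∀ w : ℂ, R₀ < ‖w‖ → w ∉ singularSet q ∧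
      ∀ i : Fin m, ‖w ^ (m - (i : ℕ)) * RatFunc.eval (RingHom.id ℂ) w (q i)‖ ≤ C := by
  have h1 : ∀ i : Fin m, ∃ C : ℝ, ∀ᶠ w in Bornology.cobounded ℂ,
      ‖w ^ (m - (i : ℕ)) * (q i).num.eval w‖ ≤ C * ‖(q i).denom.eval w‖ := fun i => by
    have hdeg : (Polynomial.X ^ (m - (i : ℕ)) * (q i).num).degree ≤ (q i).denom.degree := by
      rw [Polynomial.degree_mul, Polynomial.degree_X_pow, add_comm]
      exact hinf i
    obtain ⟨C, hC⟩ := (Polynomial.isBigO_cobounded_of_degree_le hdeg).bound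
    refine ⟨C, hC.mono fun w hw => ?_⟩
    simpa using hw
  choose C hC using h1
  have h2 : ∀ᶠ w in Bornology.cobounded ℂ, w ∉ singularSet q :=
    Bornology.isBounded_def.1 (finite_singularSet q).isBounded
  obtain ⟨R, -, hR⟩ := (Filter.hasBasis_cobounded_norm (E := ℂ)).eventually_iff.1
    (h2.and (eventually_all.2 hC))
  refine ⟨max R 1, le_max_right _ _, ∑ i, |C i|, fun w hw => ?_⟩
  have hw' := hR (show w ∈ {x : ℂ | R ≤ ‖x‖} from (le_max_left _ _).trans hw.le)
  refine ⟨hw'.1, fun i => ?_⟩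
  have hd := denom_eval_ne_zero hw'.1 i
  have h3 : ‖w ^ (m - (i : ℕ)) * RatFunc.eval (RingHom.id ℂ) w (q i)‖ ≤ C i := by
    rw [ratFunc_eval, ← mul_div_assoc, norm_div, div_le_iff₀ (norm_pos_iff.2 hd)]
    exact hw'.2 i
  exact (h3.trans (le_abs_self _)).trans
    (Finset.single_le_sum (f := fun j => |C j|) (fun j _ => abs_nonneg _) (Finset.mem_univ i))

/-- If `∞` is a regular singular point, entire solutions grow polynomially, hence are
polynomials. -/
theorem isPolynomialGerm_of_isEntireGerm (hm : 0 < m) (hinf : IsRegularAtInfinity q) {z : ℂ}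
    (hz : z ∉ singularSet q) {f : ℂ → ℂ} (hsol : IsSolutionNear q z f) (hf : IsEntireGerm z f) :
    IsPolynomialGerm z f := by
  obtain ⟨g, hg, hfg⟩ := hf
  have hs := (hsol.congr hfg).isSolutionOn isOpen_univ isPreconnected_univ
    hg.differentiableOn (Set.mem_univ z) hz
  obtain ⟨R₀, hR₀, C, hC⟩ := exists_bounded_coeff_at_infinity hinf
  have hR₀pos : 0 < R₀ := by linarith
  let X : Set ℂ := {x | Real.log R₀ < x.re}
  have hX : ∀ x ∈ X, R₀ < ‖0 + Complex.exp x‖ := fun x hx => by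
    rw [zero_add, Complex.norm_exp]
    exact (Real.log_lt_iff_lt_exp hR₀pos).1 hx
  obtain ⟨D, hD, hB⟩ := exists_norm_scaledSystem_le (q := q) (t := 0) (X := X) (C := C)
    fun x hx j => by simpa [scaledCoeff] using (hC _ (hX x hx)).2 j
  let x₁ : ℂ := ⟨Real.log R₀ + 1, 0⟩
  have hx₁ : x₁ ∈ X := by simp [X, x₁]
  obtain ⟨N, hN⟩ := exists_nat_ge D
  have hgrowth : ∀ w, R₀ < ‖w‖ →
      ‖g w‖ ≤ ‖scaledJet m 0 g x₁‖ * Real.exp (D * (Real.pi + ‖x₁‖)) * ‖w‖ ^ N := by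
    intro w hw
    have hw0 : 0 < ‖w‖ := hR₀pos.trans hw
    have hxX : Complex.log w ∈ X := by
      simp only [X, Set.mem_ofPred_eq, Complex.log_re]
      exact Real.log_lt_log hR₀pos hw
    have h1 := LinearODE.norm_le_exp (convex_halfSpace_re_gt (Real.log R₀)) hB
      (fun x hx => hs.hasDerivAt_scaledJet ⟨Set.mem_univ _, (hC _ (hX x hx)).1⟩) hx₁ hxX
    have h2 : ‖g w‖ ≤ ‖scaledJet m 0 g (Complex.log w)‖ := by
      refine le_of_eq_of_le ?_ (norm_le_pi_norm _ ⟨0, hm⟩)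
      simp [scaledJet, Complex.exp_log (norm_pos_iff.1 hw0)]
    have hl : 0 ≤ Real.log ‖w‖ := Real.log_nonneg (hR₀.trans hw.le)
    have h3 : ‖Complex.log w - x₁‖ ≤ Real.log ‖w‖ + (Real.pi + ‖x₁‖) := by
      refine (norm_sub_le _ _).trans ?_
      rw [← add_assoc]
      gcongr
      refine (Complex.norm_le_abs_re_add_abs_im _).trans ?_
      rw [Complex.log_re, Complex.log_im, abs_of_nonneg hl]
      gcongr
      exact Complex.abs_arg_le_pi w
    refine (h2.trans h1).trans ?_
    rw [mul_assoc]
    gcongr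
    calc Real.exp (D * ‖Complex.log w - x₁‖)
        ≤ Real.exp (D * (Real.log ‖w‖ + (Real.pi + ‖x₁‖))) := by gcongr
      _ = Real.exp (D * (Real.pi + ‖x₁‖)) * Real.exp (D * Real.log ‖w‖) := by
          rw [← Real.exp_add]; congr 1; ring
      _ ≤ Real.exp (D * (Real.pi + ‖x₁‖)) * Real.exp (N * Real.log ‖w‖) := by gcongr
      _ = _ := by rw [Real.exp_nat_mul, Real.exp_log hw0]
  obtain ⟨p, hp⟩ := exists_polynomial_of_growth hg hgrowth
  exact ⟨p, hfg.trans (Eventually.of_forall hp)⟩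

/-! ### Persistence along paths -/

/-- The radius of convergence of a solution reaches beyond the singular point `t` at all centres
near `z` or at none: off the bisectors the circle through `t` meets no other singular point, so
there is a positive gap before the next obstruction. -/
theorem eventually_extends_beyond_iff (hm : 0 < m) {z t : ℂ} (hzA : z ∉ bisectorSet q)
    (hzS : z ∉ singularSet q) (ht : t ∈ singularSet q) {f : ℂ → ℂ} (hsol : IsSolutionNear q z f) :
    ∀ᶠ z' in 𝓝 z, (∃ R > dist z' t, ExtendsToBall f z' R) ↔
      ∃ R > dist z t, ExtendsToBall f z R := by
  obtain ⟨ε, hε, hsolε⟩ := hsol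
  have hd : DifferentiableOn ℂ f (Metric.ball z ε) := hsolε.1.differentiableOn
  obtain ⟨η, hη, hgap⟩ : ∃ η > 0, ∀ u ∈ singularSet q, u ≠ t →
      η ≤ |dist z u - dist z t| := by
    obtain hS | hS := (singularSet q \ {t}).eq_empty_or_nonempty
    · exact ⟨1, one_pos, fun u hu hut => absurd hS (Set.Nonempty.ne_empty ⟨u, hu, hut⟩)⟩
    · obtain ⟨u₀, hu₀, hmin⟩ := Set.exists_min_image _ (fun u => |dist z u - dist z t|)
        ((finite_singularSet q).subset Set.sdiff_subset) hS
      exact ⟨_, abs_pos.2 (sub_ne_zero.2 (dist_ne_of_notMem_bisectorSet hzA hu₀.1 ht hu₀.2)),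
        fun u hu hut => hmin u ⟨hu, hut⟩⟩
  have hforward : (∃ R > dist z t, ExtendsToBall f z R) →
      ∀ᶠ z' in 𝓝 z, ∃ R > dist z' t, ExtendsToBall f z' R := by
    rintro ⟨R, hR, hf⟩
    have hδ : 0 < min (ε / 2) ((R - dist z t) / 2) := lt_min (by linarith) (by linarith)
    filter_upwards [Metric.ball_mem_nhds z hδ] with z' hz'
    rw [Metric.mem_ball, lt_min_iff] at hz'
    have htri := dist_triangle z' z t
    have hnn : 0 ≤ dist z t := dist_nonneg
    refine ⟨R - dist z' z, by linarith, hf.recenter (δ := ε - dist z' z)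
      (hd.mono (Metric.ball_subset_ball' (by linarith))) ?_ (by linarith)⟩
    rw [Metric.mem_ball, dist_comm]
    linarith
  have hback : ∀ᶠ z' in 𝓝 z, (∃ R > dist z' t, ExtendsToBall f z' R) →
      ∃ R > dist z t, ExtendsToBall f z R := by
    have hδ : 0 < min ε (η / 4) := lt_min hε (by linarith)
    filter_upwards [Metric.ball_mem_nhds z hδ,
      (finite_singularSet q).isClosed.isOpen_compl.mem_nhds hzS] with z' hz' hzS'
    rintro ⟨R, hR, hf⟩
    rw [Metric.mem_ball, lt_min_iff] at hz'
    have hsol' : IsSolutionNear q z' f := hsolε.isSolutionNear Metric.isOpen_ball hz'.1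
    have hbig : ExtendsToBall f z' (dist z t + η - dist z' z) := by
      refine ExtendsToBall.of_gap hm hzS' hsol' (fun r hr => hf.mono hr.le) fun u hu hRu => ?_
      have hut : u ≠ t := by rintro rfl; linarith
      have h1 := hgap u hu hut
      have h2 := dist_triangle z z' u
      have h3 := dist_triangle z' z u
      have h4 := dist_triangle z z' t
      have h5 := dist_comm z z'
      obtain habs | habs := abs_cases (dist z u - dist z t) <;> linarith
    have hc := dist_comm z z'
    have hnn : 0 ≤ dist z t := dist_nonneg
    exact ⟨_, by linarith, hbig.recenter hd hz'.1 (by linarith)⟩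
  by_cases h : ∃ R > dist z t, ExtendsToBall f z R
  · filter_upwards [hforward h] with z' hz'
    exact iff_of_true hz' h
  · filter_upwards [hback] with z' hz'
    exact iff_of_false (fun h' => h (hz' h')) h

theorem iff_of_locally_iff {P : unitInterval → Prop} (h : ∀ s, ∀ᶠ s' in 𝓝 s, P s' ↔ P s) :
    P 1 ↔ P 0 := by
  have hP : IsLocallyConstant P := (IsLocallyConstant.iff_eventually_eq P).2 fun s =>
    (h s).mono fun _ hs => propext hs
  exact iff_of_eq (hP.apply_eq_of_isPreconnected isPreconnected_univ (Set.mem_univ 1)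
    (Set.mem_univ 0))

variable {z₀ z : ℂ} {γ : Path z₀ z} {f : ℂ → ℂ} {F : unitInterval → ℂ → ℂ}

theorem IsContinuationAlong.sub_const_mul {g : ℂ → ℂ} {G : unitInterval → ℂ → ℂ}
    (hF : IsContinuationAlong γ f F) (c : ℂ) (hG : IsContinuationAlong γ g G) :
    IsContinuationAlong γ (fun w => f w - c * g w) fun s w => F s w - c * G s w := by
  refine ⟨?_, fun s => (hF.2.1 s).sub (analyticAt_const.mul (hG.2.1 s)), fun s => ?_⟩
  · filter_upwards [hF.1, hG.1] with w h1 h2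
    rw [h1, h2]
  · filter_upwards [hF.2.2 s, hG.2.2 s] with s' hs hs'
    filter_upwards [hs, hs'] with w h1 h2
    rw [h1, h2]

theorem IsContinuationAlong.isSolutionNear (hF : IsContinuationAlong γ f F)
    (hγ : ∀ s, γ s ∉ singularSet q) (hf : IsSolutionNear q z₀ f) (s : unitInterval) :
    IsSolutionNear q (γ s) (F s) := by
  have hloc : IsLocallyConstant fun s => IsSolutionNear q (γ s) (F s) := by
    refine (IsLocallyConstant.iff_eventually_eq _).2 fun s => ?_
    obtain ⟨ε, hε, hball⟩ := Metric.eventually_nhds_iff_ball.1 (hF.2.1 s).eventually_analyticAt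
    have hd : DifferentiableOn ℂ (F s) (Metric.ball (γ s) ε) := fun w hw =>
      (hball w hw).differentiableAt.differentiableWithinAt
    have hW : IsOpen (Metric.ball (γ s) ε \ singularSet q) :=
      Metric.isOpen_ball.sdiff (finite_singularSet q).isClosed
    filter_upwards [hF.2.2 s, γ.continuous.continuousAt.preimage_mem_nhds
      (Metric.ball_mem_nhds (γ s) hε)] with s' hs' hball'
    refine propext ⟨fun h => ?_, fun h => ?_⟩
    · exact ((h.congr hs').isSolutionOn Metric.isOpen_ball (convex_ball _ _).isPreconnected hd
        hball' (hγ s')).isSolutionNear hW ⟨Metric.mem_ball_self hε, hγ s⟩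
    · exact ((h.isSolutionOn Metric.isOpen_ball (convex_ball _ _).isPreconnected hd
        (Metric.mem_ball_self hε) (hγ s)).isSolutionNear hW ⟨hball', hγ s'⟩).congr hs'.symm
  have h0 : IsSolutionNear q (γ 0) (F 0) := by
    rw [γ.source]
    exact hf.congr hF.1.symm
  exact (hloc.apply_eq_of_isPreconnected isPreconnected_univ (Set.mem_univ s)
    (Set.mem_univ 0)).symm ▸ h0

theorem dist_lt_dist_iff_of_path (γ : Path z₀ z) (hγ : ∀ s, γ s ∉ bisectorSet q) {t u : ℂ}
    (ht : t ∈ singularSet q) (hu : u ∈ singularSet q) :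
    dist z u < dist z t ↔ dist z₀ u < dist z₀ t := by
  obtain rfl | hut := eq_or_ne u t
  · simp
  have hcont : ∀ v : ℂ, Continuous fun s => dist (γ s) v := fun v =>
    γ.continuous.dist continuous_const
  have := iff_of_locally_iff (P := fun s => dist (γ s) u < dist (γ s) t) fun s => by
    obtain hlt | hlt := (dist_ne_of_notMem_bisectorSet (hγ s) hu ht hut).lt_or_gt
    · filter_upwards [(hcont u).continuousAt.eventually_lt (hcont t).continuousAt hlt] with s' hs'
      exact iff_of_true hs' hlt
    · filter_upwards [(hcont t).continuousAt.eventually_lt (hcont u).continuousAt hlt] with s' hs'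
      exact iff_of_false hs'.not_gt hlt.not_gt
  simpa using this

/-- Whether the disc of convergence reaches beyond a given singular point does not change under
continuation along a path that avoids the bisectors. -/
theorem IsContinuationAlong.extends_beyond_iff (hm : 0 < m) (hF : IsContinuationAlong γ f F)
    (hγA : ∀ s, γ s ∉ bisectorSet q) (hγS : ∀ s, γ s ∉ singularSet q)
    (hf : IsSolutionNear q z₀ f) {t : ℂ} (ht : t ∈ singularSet q) :
    (∃ R > dist z t, ExtendsToBall (F 1) z R) ↔ ∃ R > dist z₀ t, ExtendsToBall f z₀ R := by
  have hcongr : ∀ {g h : ℂ → ℂ} {w : ℂ}, g =ᶠ[𝓝 w] h → ∀ R,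
      ExtendsToBall g w R ↔ ExtendsToBall h w R := fun hgh R =>
    ⟨fun ⟨k, hk, hgk⟩ => ⟨k, hk, hgh.symm.trans hgk⟩, fun ⟨k, hk, hhk⟩ => ⟨k, hk, hgh.trans hhk⟩⟩
  have := iff_of_locally_iff
    (P := fun s => ∃ R > dist (γ s) t, ExtendsToBall (F s) (γ s) R) fun s => by
      filter_upwards [hF.2.2 s, γ.continuous.continuousAt.eventually
        (eventually_extends_beyond_iff hm (hγA s) (hγS s) ht (hF.isSolutionNear hγS hf s))]
        with s' hs' h
      rw [← h]
      simp_rw [hcongr hs']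
  simpa [hcongr hF.1] using this

/-- If at the start of a path the disc of convergence reaches up to `t`, then it does so at the end:
an obstruction nearer than `t` at the end would be one at the start, since the ordering of the
singular points by distance does not change along the path. -/
theorem IsContinuationAlong.extends_disc (hm : 0 < m) (hF : IsContinuationAlong γ f F)
    (hγA : ∀ s, γ s ∉ bisectorSet q) (hγS : ∀ s, γ s ∉ singularSet q)
    (hf : IsSolutionNear q z₀ f) {t : ℂ} (ht : t ∈ singularSet q)
    (h : ExtendsToBall f z₀ (dist z₀ t)) : ExtendsToBall (F 1) z (dist z t) := by
  by_contra hne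
  have hzS : z ∉ singularSet q := by simpa using hγS 1
  have hsol : IsSolutionNear q z (F 1) := by simpa using hF.isSolutionNear hγS hf 1
  obtain ⟨u, hu, h1, h2⟩ := exists_singular_of_not_entire hm hzS hsol
    fun ⟨g, hg, hfg⟩ => hne ⟨g, hg.differentiableOn, hfg⟩
  have hlt : dist z u < dist z t := by
    by_contra! hle
    exact hne (h1.mono hle)
  obtain ⟨R, hR, hR'⟩ := (hF.extends_beyond_iff hm hγA hγS hf hu).2
    ⟨_, (dist_lt_dist_iff_of_path γ hγA ht hu).1 hlt, h⟩
  exact h2 R hR hR'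

/-! ### The limit of the quotients of derivatives -/

theorem eventuallyEq_zero_of_order_zero {q : Fin 0 → RatFunc ℂ} {z : ℂ} {f : ℂ → ℂ}
    (hf : IsSolutionNear q z f) : f =ᶠ[𝓝 z] fun _ => 0 := by
  filter_upwards [isSolutionNear_iff_eventually.1 hf] with w hw
  simpa using hw.2

theorem tendsto_onePoint_infty_of_inv {u v : ℕ → ℂ} (hv : ∀ᶠ n in atTop, v n ≠ 0)
    (hu : ∀ᶠ n in atTop, u n ≠ 0) (h : Tendsto (fun n => v n / u n) atTop (𝓝 0)) :
    Tendsto (fun n => ((u n / v n : ℂ) : OnePoint ℂ)) atTop (𝓝 OnePoint.infty) := by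
  have h1 : Tendsto (fun n => (v n / u n)⁻¹) atTop (Bornology.cobounded ℂ) := by
    refine tendsto_inv₀_nhdsNE_zero.comp (tendsto_nhdsWithin_iff.2 ⟨h, ?_⟩)
    filter_upwards [hv, hu] with n h1 h2 using div_ne_zero h1 h2
  have h2 : Tendsto ((↑) : ℂ → OnePoint ℂ) (Bornology.cobounded ℂ) (𝓝 OnePoint.infty) := by
    rw [Metric.cobounded_eq_cocompact, ← coclosedCompact_eq_cocompact]
    exact OnePoint.tendsto_coe_infty
  simpa [Function.comp_def] using h2.comp h1

variable {z₀ z : ℂ} {γ : Path z₀ z} {f g : ℂ → ℂ} {F G : unitInterval → ℂ → ℂ}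

/-- If `t` is the singular point that bounds the disc of convergence at the start of a path, then the
lower bound of `polyLower_of_singular` holds at its end. -/
theorem IsContinuationAlong.polyLower (hm : 0 < m) (hreg : IsRegularAtFinite q)
    (hgen : IsGeneric q) (hF : IsContinuationAlong γ f F)
    (hγA : ∀ s, γ s ∉ bisectorSet q) (hγS : ∀ s, γ s ∉ singularSet q)
    (hf : IsSolutionNear q z₀ f) {t : ℂ} (ht : t ∈ singularSet q)
    (hin : ExtendsToBall f z₀ (dist z₀ t)) (hout : ¬ ∃ R > dist z₀ t, ExtendsToBall f z₀ R) :
    PolyLower fun n => (z - t) ^ n * taylorCoeff (F 1) z n :=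
  polyLower_of_singular hm hreg hgen (by simpa using hγA 1) (by simpa using hγS 1) ht
    (by simpa using hF.isSolutionNear hγS hf 1) (hF.extends_disc hm hγA hγS hf ht hin)
    fun h => hout ((hF.extends_beyond_iff hm hγA hγS hf ht).1 h)

theorem IsContinuationAlong.eventually_iteratedDeriv_ne_zero (hm : 0 < m)
    (hreg : IsRegularAtFinite q) (hgen : IsGeneric q) (hF : IsContinuationAlong γ f F)
    (hγA : ∀ s, γ s ∉ bisectorSet q) (hγS : ∀ s, γ s ∉ singularSet q)
    (hf : IsSolutionNear q z₀ f) {t : ℂ} (ht : t ∈ singularSet q)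
    (hin : ExtendsToBall f z₀ (dist z₀ t)) (hout : ¬ ∃ R > dist z₀ t, ExtendsToBall f z₀ R) :
    ∀ᶠ n : ℕ in atTop, iteratedDeriv n (F 1) z ≠ 0 := by
  filter_upwards [(hF.polyLower hm hreg hgen hγA hγS hf ht hin hout).eventually_ne] with n hn h
  simp [taylorCoeff, h] at hn

/-- If the disc of convergence of `g` reaches beyond the singular point `t` that bounds the disc of
convergence of `f`, then `g` is negligible against `f` at the end of any path. -/
theorem IsContinuationAlong.tendsto_div_zero (hm : 0 < m) (hreg : IsRegularAtFinite q)
    (hgen : IsGeneric q) (hF : IsContinuationAlong γ f F) (hG : IsContinuationAlong γ g G)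
    (hγA : ∀ s, γ s ∉ bisectorSet q) (hγS : ∀ s, γ s ∉ singularSet q)
    (hf : IsSolutionNear q z₀ f) (hg : IsSolutionNear q z₀ g) {t : ℂ} (ht : t ∈ singularSet q)
    (hin : ExtendsToBall f z₀ (dist z₀ t)) (hout : ¬ ∃ R > dist z₀ t, ExtendsToBall f z₀ R)
    (hext : ∃ R > dist z₀ t, ExtendsToBall g z₀ R) :
    Tendsto (fun n : ℕ => iteratedDeriv n (G 1) z / iteratedDeriv n (F 1) z) atTop (𝓝 0) := by
  have hzS : z ∉ singularSet q := by simpa using hγS 1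
  obtain ⟨R, hR, hGR⟩ := (hG.extends_beyond_iff hm hγA hγS hg ht).2 hext
  exact tendsto_iteratedDeriv_div_zero (fun h => hzS (h ▸ ht))
    (hF.polyLower hm hreg hgen hγA hγS hf ht hin hout) hR hGR

theorem IsContinuationAlong.tendsto_div_const (hm : 0 < m) (hreg : IsRegularAtFinite q)
    (hgen : IsGeneric q) (hF : IsContinuationAlong γ f F) (hG : IsContinuationAlong γ g G)
    (hγA : ∀ s, γ s ∉ bisectorSet q) (hγS : ∀ s, γ s ∉ singularSet q)
    (hf : IsSolutionNear q z₀ f) (hg : IsSolutionNear q z₀ g) {t : ℂ} (ht : t ∈ singularSet q)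
    (hin : ExtendsToBall f z₀ (dist z₀ t)) (hout : ¬ ∃ R > dist z₀ t, ExtendsToBall f z₀ R) {c : ℂ}
    (hext : ∃ R > dist z₀ t, ExtendsToBall (fun w => g w - c * f w) z₀ R) :
    Tendsto (fun n : ℕ => iteratedDeriv n (G 1) z / iteratedDeriv n (F 1) z) atTop (𝓝 c) := by
  have h := (hF.tendsto_div_zero hm hreg hgen (hG.sub_const_mul c hF) hγA hγS hf
    (hg.sub_const_mul c hf) ht hin hout hext).const_add c
  rw [add_zero] at h
  refine h.congr' ?_
  filter_upwards [hF.eventually_iteratedDeriv_ne_zero hm hreg hgen hγA hγS hf ht hin hout]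
    with n hn
  have hFa : AnalyticAt ℂ (F 1) z := by simpa using hF.2.1 1
  have hGa : AnalyticAt ℂ (G 1) z := by simpa using hG.2.1 1
  have hca : AnalyticAt ℂ (fun w => c * F 1 w) z := analyticAt_const.mul hFa
  rw [iteratedDeriv_fun_sub hGa.contDiffAt hca.contDiffAt, iteratedDeriv_const_mul_field]
  field_simp
  ring

end FuchsianODE

theorem proposition1 {m : ℕ} (q : Fin m → RatFunc ℂ)
    (hreg : FuchsianODE.IsRegularAtFinite q) (hgen : FuchsianODE.IsGeneric q)
    (U : Set ℂ)
    (hU : ∃ x ∈ (FuchsianODE.bisectorSet q)ᶜ,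
      U = connectedComponentIn (FuchsianODE.bisectorSet q)ᶜ x)
    (z₀ : ℂ) (hz₀ : z₀ ∈ U \ FuchsianODE.singularSet q)
    (f₁ f₂ : ℂ → ℂ)
    (hf₁ : FuchsianODE.IsSolutionNear q z₀ f₁) (hf₂ : FuchsianODE.IsSolutionNear q z₀ f₂)
    (hne : ¬ FuchsianODE.IsEntireGerm z₀ f₂ ∨
      (FuchsianODE.IsRegularAtInfinity q ∧ ¬ FuchsianODE.IsPolynomialGerm z₀ f₂)) :
    ∃ c : OnePoint ℂ,
      (∀ (z : ℂ) (γ : Path z₀ z), (∀ s, γ s ∈ U \ FuchsianODE.singularSet q) →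
        ∀ F₁ F₂ : unitInterval → ℂ → ℂ,
          FuchsianODE.IsContinuationAlong γ f₁ F₁ → FuchsianODE.IsContinuationAlong γ f₂ F₂ →
          (∀ᶠ n : ℕ in Filter.atTop, iteratedDeriv n (F₂ 1) z ≠ 0) ∧
          Filter.Tendsto
            (fun n : ℕ =>
              ((iteratedDeriv n (F₁ 1) z / iteratedDeriv n (F₂ 1) z : ℂ) : OnePoint ℂ))
            Filter.atTop (nhds c)) ∧
      (¬ FuchsianODE.ExtendsAcrossNearest q z₀ f₂ → c ≠ OnePoint.infty) ∧
      (¬ FuchsianODE.ExtendsAcrossNearest q z₀ f₂ → FuchsianODE.ExtendsAcrossNearest q z₀ f₁ →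
        c = ((0 : ℂ) : OnePoint ℂ)) := by
  obtain ⟨x, -, hUx⟩ := hU
  have hUA : ∀ w ∈ U, w ∉ FuchsianODE.bisectorSet q := fun w hw =>
    connectedComponentIn_subset _ x (hUx ▸ hw)
  have hzA := hUA z₀ hz₀.1
  have hzS := hz₀.2
  have hm : 0 < m := by
    by_contra! h0
    obtain rfl := Nat.le_zero.1 h0
    have h := FuchsianODE.eventuallyEq_zero_of_order_zero hf₂
    obtain hne | ⟨-, hne⟩ := hne
    · exact hne ⟨fun _ => 0, differentiable_const 0, h⟩
    · exact hne ⟨0, by simpa using h⟩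
  have hent : ¬ FuchsianODE.IsEntireGerm z₀ f₂ := by
    obtain hne | ⟨hinf, hne⟩ := hne
    · exact hne
    · exact fun h => hne (FuchsianODE.isPolynomialGerm_of_isEntireGerm hm hinf hzS hf₂ h)
  obtain ⟨t, ht, hin, hout'⟩ := FuchsianODE.exists_singular_of_not_entire hm hzS hf₂ hent
  have hout : ¬ ∃ R > dist z₀ t, ExtendsToBall f₂ z₀ R := fun ⟨R, hR, h⟩ => hout' R hR h
  have hinf : Metric.infDist z₀ (FuchsianODE.singularSet q) ≤ dist z₀ t :=
    Metric.infDist_le_dist_of_mem ht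
  have hpath : ∀ {z : ℂ} {γ : Path z₀ z}, (∀ s, γ s ∈ U \ FuchsianODE.singularSet q) →
      (∀ s, γ s ∉ FuchsianODE.bisectorSet q) ∧ ∀ s, γ s ∉ FuchsianODE.singularSet q :=
    fun hγ => ⟨fun s => hUA _ (hγ s).1, fun s => (hγ s).2⟩
  -- if `f₂` stops at the nearest singular point, then `t` is that point
  have hnear : ¬ FuchsianODE.ExtendsAcrossNearest q z₀ f₂ →
      dist z₀ t = Metric.infDist z₀ (FuchsianODE.singularSet q) := fun h =>
    le_antisymm (not_lt.1 fun hlt => h ⟨_, hlt, hin⟩) hinf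
  by_cases hext : ∃ R > dist z₀ t, ExtendsToBall f₁ z₀ R
  · refine ⟨((0 : ℂ) : OnePoint ℂ), fun z γ hγ F₁ F₂ hF₁ hF₂ => ?_,
      fun _ => OnePoint.coe_ne_infty _, fun _ _ => rfl⟩
    obtain ⟨hγA, hγS⟩ := hpath hγ
    exact ⟨hF₂.eventually_iteratedDeriv_ne_zero hm hreg hgen hγA hγS hf₂ ht hin hout,
      (OnePoint.continuous_coe.tendsto 0).comp
        (hF₂.tendsto_div_zero hm hreg hgen hF₁ hγA hγS hf₂ hf₁ ht hin hout hext)⟩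
  by_cases hin₁ : ExtendsToBall f₁ z₀ (dist z₀ t)
  · obtain ⟨c, hc⟩ := FuchsianODE.exists_sub_const_mul_extends hm hreg hgen hzA hzS ht hf₁ hf₂
      hin₁ hin hout
    refine ⟨(c : OnePoint ℂ), fun z γ hγ F₁ F₂ hF₁ hF₂ => ?_,
      fun _ => OnePoint.coe_ne_infty _, fun h₂ ⟨R, hR, h₁⟩ => ?_⟩
    · obtain ⟨hγA, hγS⟩ := hpath hγ
      exact ⟨hF₂.eventually_iteratedDeriv_ne_zero hm hreg hgen hγA hγS hf₂ ht hin hout,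
        (OnePoint.continuous_coe.tendsto c).comp
          (hF₂.tendsto_div_const hm hreg hgen hF₁ hγA hγS hf₂ hf₁ ht hin hout hc)⟩
    · exact absurd ⟨R, (hnear h₂).trans_lt hR, h₁⟩ hext
  -- the disc of convergence of `f₁` is smaller than that of `f₂`
  obtain ⟨u, hu, hin₁', hout₁'⟩ := FuchsianODE.exists_singular_of_not_entire hm hzS hf₁
    fun ⟨g, hg, hfg⟩ => hin₁ ⟨g, hg.differentiableOn, hfg⟩
  have hut : dist z₀ u < dist z₀ t := not_le.1 fun hle => hin₁ (hin₁'.mono hle)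
  have hout₁ : ¬ ∃ R > dist z₀ u, ExtendsToBall f₁ z₀ R := fun ⟨R, hR, h⟩ => hout₁' R hR h
  have hcross : FuchsianODE.ExtendsAcrossNearest q z₀ f₂ :=
    ⟨_, (Metric.infDist_le_dist_of_mem hu).trans_lt hut, hin⟩
  refine ⟨OnePoint.infty, fun z γ hγ F₁ F₂ hF₁ hF₂ => ?_,
    fun h => absurd hcross h, fun h => absurd hcross h⟩
  obtain ⟨hγA, hγS⟩ := hpath hγ
  have h₂ := hF₂.eventually_iteratedDeriv_ne_zero hm hreg hgen hγA hγS hf₂ ht hin hout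
  exact ⟨h₂, FuchsianODE.tendsto_onePoint_infty_of_inv h₂
    (hF₁.eventually_iteratedDeriv_ne_zero hm hreg hgen hγA hγS hf₁ hu hin₁' hout₁)
    (hF₁.tendsto_div_zero hm hreg hgen hF₂ hγA hγS hf₁ hf₂ hu hin₁' hout₁ ⟨_, hut, hin⟩)⟩
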